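/- Let $P$ be a $3$-dimensional convex polytope in a finite-dimensional real vector space and let $f$ be a linear functional that is generic on $P$, meaning that $f$ is nonconstant on every edge of $P$. An $f$-monotone path on $P$ is a path in the graph of $P$ along which $f$ strictly increases, from the vertex minimizing $f$ on $P$ to the vertex maximizing $f$ on $P$. Let $G(P,f)$ be the graph whose nodes are the $f$-monotone paths on $P$, two of them being adjacent if they differ by a polygon flip, that is, if for some $2$-dimensional face $F$ of $P$ they follow the two different $f$-monotone paths on $F$ from the source (minimum of $f$ on $F$) to the sink (maximum of $f$ on $F$) and they agree outside $F$. For $f$-monotone paths $\gamma,\gamma'$ on $P$ let $\nu(\gamma,\gamma')$ be the number of connected components of the set of values $t\in f(P)$ for which $\gamma$ and $\gamma'$ meet the fiber $f^{-1}(t)\cap P$ in different points; this number is finite. Then any two $f$-monotone paths $\gamma,\gamma'$ on $P$ are joined by a walk in $G(P,f)$, and their distance satisfies $$ d_{G(P,f)}(\gamma,\gamma') \le \frac{\nu(\gamma,\gamma')}{2}\cdot f_2(P), $$ where $f_2(P)$ is the (finite) number of $2$-dimensional faces of $P$. -/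

import Mathlib

namespace MonotoneFlip

variable {E : Type*} [NormedAddCommGroup E] [NormedSpace ℝ E]

/-- A (convex) polytope: the convex hull of a finite set of points. -/
def IsPolytope (P : Set E) : Prop :=
  ∃ S : Set E, S.Finite ∧ P = convexHull ℝ S

/-- The dimension of a set: that of its affine span. -/
noncomputable def dim (P : Set E) : ℕ :=
  Module.finrank ℝ (vectorSpan ℝ P)

/-- `F` is a `k`-dimensional face of `P`: a nonempty set of the form
`{x ∈ P | l x = max of l over P}` for some linear functional `l` (with `l = 0` giving `P`),
of dimension `k`. -/
def IsFaceOfDim (P : Set E) (k : ℕ) (F : Set E) : Prop :=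
  F.Nonempty ∧ IsExposed ℝ P F ∧ dim F = k

/-- The number `f_k(P)` of `k`-dimensional faces of `P`. -/
noncomputable def numFaces (k : ℕ) (P : Set E) : ℕ :=
  {F : Set E | IsFaceOfDim P k F}.ncard

/-- The segment from `u` to `v` is an edge (a 1-dimensional face) of `P`. -/
def IsEdge (P : Set E) (u v : E) : Prop :=
  IsFaceOfDim P 1 (segment ℝ u v)

/-- `f` is generic on `P`: it is not constant on any edge of `P`. -/
def IsGeneric (P : Set E) (f : E →ₗ[ℝ] ℝ) : Prop :=
  ∀ u v : E, IsEdge P u v → f u ≠ f v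

/-- An `f`-monotone path on `P`, given by the list of its successive vertices: it starts at a
vertex minimizing `f` on `P`, ends at a vertex maximizing `f` on `P`, and moves along edges of `P`
in the direction of increasing `f`. -/
@[ext]
structure MonotonePath (P : Set E) (f : E →ₗ[ℝ] ℝ) where
  vertices : List E
  ne_nil : vertices ≠ []
  isVertex : ∀ v ∈ vertices, IsFaceOfDim P 0 {v}
  source : ∀ x ∈ P, f (vertices.head ne_nil) ≤ f x
  sink : ∀ x ∈ P, f x ≤ f (vertices.getLast ne_nil)
  chain : vertices.IsChain (fun u v => IsEdge P u v ∧ f u < f v)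

/-- The union of the edges of an `f`-monotone path. -/
def MonotonePath.support {P : Set E} {f : E →ₗ[ℝ] ℝ} (γ : MonotonePath P f) : Set E :=
  {x | ∃ u v : E, [u, v] <:+: γ.vertices ∧ x ∈ segment ℝ u v}

/-- The set of values `t ∈ f(P)` for which `γ` and `γ'` disagree on the fiber `f⁻¹(t) ∩ P`. -/
def disagreement {P : Set E} {f : E →ₗ[ℝ] ℝ} (γ γ' : MonotonePath P f) : Set ℝ :=
  {t ∈ f '' P | γ.support ∩ f ⁻¹' {t} ≠ γ'.support ∩ f ⁻¹' {t}}

/-- The number `ν(γ, γ')` of connected components of the set of levels on which `γ` and `γ'`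
disagree. -/
noncomputable def nu {P : Set E} {f : E →ₗ[ℝ] ℝ} (γ γ' : MonotonePath P f) : ℕ :=
  Nat.card (ConnectedComponents (disagreement γ γ'))

/-- `γ` and `γ'` differ by a polygon flip across the 2-dimensional face `F` of `P`: they follow two
different `f`-monotone paths on `F` (from the source to the sink of `F`) and agree outside `F`. -/
def DifferByFlip {P : Set E} {f : E →ₗ[ℝ] ℝ} (γ γ' : MonotonePath P f) (F : Set E) : Prop :=
  IsFaceOfDim P 2 F ∧ ∃ p q : MonotonePath F f, p ≠ q ∧ ∃ a b : List E,
    γ.vertices = a ++ p.vertices ++ b ∧ γ'.vertices = a ++ q.vertices ++ b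

/-- The graph `G(P, f)` of `f`-monotone paths on `P`, with adjacency given by polygon flips. -/
def flipGraph (P : Set E) (f : E →ₗ[ℝ] ℝ) : SimpleGraph (MonotonePath P f) where
  Adj γ γ' := ∃ F : Set E, DifferByFlip γ γ' F
  symm := ⟨fun _ _ ⟨F, hF, p, q, hpq, a, b, h, h'⟩ => ⟨F, hF, q, p, hpq.symm, a, b, h', h⟩⟩
  loopless := ⟨fun _ ⟨_, _, p, q, hpq, a, b, h, h'⟩ => hpq (MonotonePath.ext (by
    simpa using h.symm.trans h'))⟩

end MonotoneFlip

/-! ### Faces, vertices and edges of polytopes. -/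

namespace MonotoneFlip

open Set

variable {E : Type*} [NormedAddCommGroup E] [NormedSpace ℝ E]

/-! A monotone path meets each level of `f` in exactly one point. Fix an axis running from the
lowest to the highest vertex through the interior of `P` (`Frame`, `exists_frame`). On every inner
level the boundary of `P` is a closed convex curve around the axis, so distinct boundary points lie
on distinct rays from it (`distinctRays`) and are cyclically ordered (`Ccw`, `ccw_total`).

Suppose that two paths differ exactly on one open interval of levels. Their two strands bound two
regions of the boundary sphere, and each region is a union of facets: over the interval, the
interior of a facet is connected and avoids both paths, so it lies on one side. Let `S` be the set
of facets swept counterclockwise from `γ` to `γ'`; `Inv` expresses this level by level, and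
`exists_inv` constructs `S`. If `S` is nonempty, some facet of `S` has its whole right boundary on
`γ` (`exists_flippable`). Flipping `γ` across it (`exists_flip`) removes precisely that facet from
`S` (`Inv.flip`), and an empty `S` forces the paths to be equal (`Inv.eq_of_empty`). Hence the
distance is at most the size of `S` (`Inv.dist_le`). Exchanging the paths turns `S` into its
complement (`Inv.swap`), so the distance is at most the smaller of two numbers with sum `f_2(P)`,
that is, at most half of `f_2(P)` (`two_mul_dist_le`).

A flippable facet is found by climbing along `γ`. Take the lowest edge whose left facet lies in `S`:
below that edge this facet cannot extend, so the lower part of its right boundary is on `γ`. If the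
facet extends above the point where `γ` leaves it, the left facet of the next edge is also in `S`
and has the same property. The climb stops because `γ` has finitely many edges.

In general the disagreement set is a finite union of open intervals whose ends are levels of common
vertices. Replacing `γ` by `γ'` over one interval (`exists_replace`) costs at most half of `f_2(P)`
flips and removes a component, so induction on the number of components finishes
(`two_mul_dist_le_card_mul`). -/

theorem vectorSpan_convexHull_eq (S : Set E) : vectorSpan ℝ (convexHull ℝ S) = vectorSpan ℝ S := by
  rw [← direction_affineSpan, affineSpan_convexHull, direction_affineSpan]

theorem dim_singleton (v : E) : dim ({v} : Set E) = 0 := by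
  simp [dim]

theorem dim_segment {u v : E} (h : u ≠ v) : dim (segment ℝ u v) = 1 := by
  rw [dim, ← convexHull_pair, vectorSpan_convexHull_eq, vectorSpan_pair]
  exact finrank_span_singleton (by simpa [sub_eq_zero] using h)

theorem IsEdge.ne {P : Set E} {u v : E} (h : IsEdge P u v) : u ≠ v := by
  rintro rfl
  have := h.2.2
  rw [segment_same, dim_singleton] at this
  omega

theorem IsFaceOfDim.subset {P F : Set E} {k : ℕ} (h : IsFaceOfDim P k F) : F ⊆ P := h.2.1.subset

theorem isExposed_of_functional [FiniteDimensional ℝ E] {P : Set E} (l : E →ₗ[ℝ] ℝ) (k : ℝ)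
    (hl : ∀ y ∈ P, l y ≤ k) : IsExposed ℝ P {x ∈ P | l x = k} := by
  rintro ⟨w, hw, hwk⟩
  refine ⟨LinearMap.toContinuousLinearMap l, ?_⟩
  ext x
  constructor
  · rintro ⟨hx, hxk⟩
    exact ⟨hx, fun y hy => by simpa [hxk] using hl y hy⟩
  · rintro ⟨hx, h⟩
    refine ⟨hx, le_antisymm (hl x hx) ?_⟩
    simpa [hwk] using h w hw

theorem exists_functional_of_isExposed {P F : Set E} (h : IsExposed ℝ P F) (hF : F.Nonempty) :
    ∃ (l : E →ₗ[ℝ] ℝ) (k : ℝ), (∀ y ∈ P, l y ≤ k) ∧ F = {x ∈ P | l x = k} := by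
  obtain ⟨l, hl⟩ := h hF
  obtain ⟨w, hw⟩ := hF
  rw [hl] at hw
  refine ⟨l, l w, fun y hy => hw.2 y hy, ?_⟩
  rw [hl]
  ext x
  constructor
  · rintro ⟨hx, h⟩
    exact ⟨hx, le_antisymm (hw.2 x hx) (h w hw.1)⟩
  · rintro ⟨hx, h⟩
    refine ⟨hx, fun y hy => ?_⟩
    change l x = l w at h
    rw [h]
    exact hw.2 y hy

theorem functional_le_of_convexHull {V : Set E} (l : E →ₗ[ℝ] ℝ) {k : ℝ} (hl : ∀ y ∈ V, l y ≤ k) :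
    ∀ y ∈ convexHull ℝ V, l y ≤ k := fun _ hy =>
  convexHull_min (t := {x | l x ≤ k}) hl (convex_halfSpace_le l.isLinear k) hy

/-- The points that either lie strictly below `k` or belong to the hull of the maximizers form a
convex set containing `V`: a proper combination of two points with one of them strictly below is
again strictly below. -/
theorem face_convexHull {V : Set E} (l : E →ₗ[ℝ] ℝ) {k : ℝ} (hl : ∀ y ∈ V, l y ≤ k) :
    {x ∈ convexHull ℝ V | l x = k} = convexHull ℝ {v ∈ V | l v = k} := by
  have hle : ∀ y ∈ convexHull ℝ {v ∈ V | l v = k}, l y = k := fun _ hy =>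
    convexHull_min (t := {x | l x = k}) (fun x hx => hx.2) (convex_hyperplane l.isLinear k) hy
  apply Subset.antisymm
  · rintro x ⟨hx, hxk⟩
    have key : convexHull ℝ V ⊆ {x | l x < k ∨ x ∈ convexHull ℝ {v ∈ V | l v = k}} := by
      apply convexHull_min
      · intro v hv
        rcases (hl v hv).lt_or_eq with h | h
        · exact Or.inl h
        · exact Or.inr (subset_convexHull ℝ _ ⟨hv, h⟩)
      · intro y hy z hz a b ha hb hab
        have hyk : l y ≤ k := by
          rcases hy with h | h
          · exact h.le
          · exact (hle y h).le
        have hzk : l z ≤ k := by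
          rcases hz with h | h
          · exact h.le
          · exact (hle z h).le
        rcases ha.eq_or_lt with rfl | ha'
        · have : b = 1 := by linarith
          simpa [this] using hz
        rcases hb.eq_or_lt with rfl | hb'
        · have : a = 1 := by linarith
          simpa [this] using hy
        have e : k = a * k + b * k := by rw [← add_mul, hab, one_mul]
        rcases hy with h | h
        · left
          simp only [map_add, map_smul, smul_eq_mul]
          have h1 := mul_lt_mul_of_pos_left h ha'
          have h2 := mul_le_mul_of_nonneg_left hzk hb
          linarith
        rcases hz with h' | h'
        · left
          simp only [map_add, map_smul, smul_eq_mul]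
          have h1 := mul_lt_mul_of_pos_left h' hb'
          have h2 := mul_le_mul_of_nonneg_left hyk ha
          linarith
        · right
          exact convex_convexHull ℝ _ h h' ha hb hab
    rcases key hx with h | h
    · exact absurd hxk h.ne
    · exact h
  · intro x hx
    exact ⟨convexHull_mono (fun v hv => hv.1) hx, hle x hx⟩

theorem isExposed_eq_convexHull {V F : Set E} (h : IsExposed ℝ (convexHull ℝ V) F) :
    F = convexHull ℝ (V ∩ F) := by
  rcases F.eq_empty_or_nonempty with rfl | hF
  · simp
  obtain ⟨l, k, hl, hlF⟩ := exists_functional_of_isExposed h hF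
  have := face_convexHull l (fun y hy => hl y (subset_convexHull ℝ V hy))
  rw [← hlF] at this
  conv_lhs => rw [this]
  congr 1
  ext v
  constructor
  · rintro ⟨hv, h⟩
    exact ⟨hv, by rw [hlF]; exact ⟨subset_convexHull ℝ V hv, h⟩⟩
  · rintro ⟨hv, h⟩
    rw [hlF] at h
    exact ⟨hv, h.2⟩

theorem IsPolytope.finite_exposed {P : Set E} (hP : IsPolytope P) :
    {F : Set E | IsExposed ℝ P F}.Finite := by
  obtain ⟨V, hV, rfl⟩ := hP
  refine Set.Finite.subset (hV.finite_subsets.image (fun W => convexHull ℝ W)) ?_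
  intro F hF
  exact ⟨V ∩ F, inter_subset_left, (isExposed_eq_convexHull hF).symm⟩

theorem IsPolytope.finite_faces {P : Set E} (hP : IsPolytope P) (k : ℕ) :
    {F : Set E | IsFaceOfDim P k F}.Finite :=
  hP.finite_exposed.subset fun _ h => h.2.1

theorem IsPolytope.of_isExposed {P F : Set E} (hP : IsPolytope P) (h : IsExposed ℝ P F) :
    IsPolytope F := by
  obtain ⟨V, hV, rfl⟩ := hP
  exact ⟨V ∩ F, hV.inter_of_left F, isExposed_eq_convexHull h⟩

theorem IsPolytope.convex {P : Set E} (hP : IsPolytope P) : Convex ℝ P := by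
  obtain ⟨V, _, rfl⟩ := hP
  exact convex_convexHull ℝ V

theorem IsPolytope.isCompact {P : Set E} (hP : IsPolytope P) : IsCompact P := by
  obtain ⟨V, hV, rfl⟩ := hP
  exact hV.isCompact_convexHull (𝕜 := ℝ)

theorem isPolytope_segment (u v : E) : IsPolytope (segment ℝ u v) :=
  ⟨{u, v}, by simp, convexHull_pair u v |>.symm⟩

/-- An exposed face of an exposed face of a polytope is an exposed face of the polytope. -/
theorem IsPolytope.isExposed_trans [FiniteDimensional ℝ E] {P F G : Set E} (hP : IsPolytope P)
    (hF : IsExposed ℝ P F) (hG : IsExposed ℝ F G) : IsExposed ℝ P G := by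
  obtain ⟨V, hV, rfl⟩ := hP
  rcases G.eq_empty_or_nonempty with rfl | hGne
  · exact isExposed_empty
  obtain ⟨l, k, hl, hlF⟩ := exists_functional_of_isExposed hF (hGne.mono hG.subset)
  obtain ⟨l', k', hl', hlG⟩ := exists_functional_of_isExposed hG hGne
  have hlV : ∀ v ∈ V, l v ≤ k := fun v hv => hl v (subset_convexHull ℝ V hv)
  -- The face `G` will be exposed by `l' + N • l`. Since `V` is finite, `N` can be so large that
  -- leaving `F` costs more in `N • l` than can be gained in `l'`.
  obtain ⟨N, hN⟩ : ∃ N : ℝ, ∀ v ∈ V, l v < k → l' v - k' < N * (k - l v) := by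
    obtain ⟨N, hN⟩ := (hV.image (fun v => (l' v - k') / (k - l v))).bddAbove
    refine ⟨N + 1, fun v hv hvk => ?_⟩
    have h0 : 0 < k - l v := by linarith
    have h1 : (l' v - k') / (k - l v) ≤ N := hN ⟨v, hv, rfl⟩
    have h2 : (l' v - k') / (k - l v) < N + 1 := by linarith
    rwa [div_lt_iff₀ h0] at h2
  have hmem : ∀ v ∈ V, l v = k → v ∈ F := fun v hv h => by
    rw [hlF]; exact ⟨subset_convexHull ℝ V hv, h⟩
  have hle : ∀ v ∈ V, (l' + N • l) v ≤ k' + N * k := by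
    intro v hv
    simp only [LinearMap.add_apply, LinearMap.smul_apply, smul_eq_mul]
    rcases (hlV v hv).lt_or_eq with h | h
    · have := hN v hv h
      nlinarith
    · rw [h]
      have := hl' v (hmem v hv h)
      linarith
  have e1 : {x ∈ convexHull ℝ V | (l' + N • l) x = k' + N * k} = G := by
    rw [face_convexHull _ hle]
    have hG2 : G = convexHull ℝ ((V ∩ F) ∩ G) := by
      have hF2 := isExposed_eq_convexHull hF
      rw [hF2] at hG
      have := isExposed_eq_convexHull hG
      exact this
    rw [hG2]
    congr 1
    ext v
    constructor
    · rintro ⟨hv, h⟩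
      simp only [LinearMap.add_apply, LinearMap.smul_apply, smul_eq_mul] at h
      rcases (hlV v hv).lt_or_eq with h' | h'
      · have := hN v hv h'
        nlinarith
      · have h2 := hmem v hv h'
        refine ⟨⟨hv, h2⟩, ?_⟩
        rw [hlG]
        rw [h'] at h
        exact ⟨h2, by linarith⟩
    · rintro ⟨⟨hv, h⟩, h'⟩
      refine ⟨hv, ?_⟩
      rw [hlF] at h
      rw [hlG] at h'
      simp only [LinearMap.add_apply, LinearMap.smul_apply, smul_eq_mul]
      rw [h.2, h'.2]
  rw [← e1]
  exact isExposed_of_functional _ _ (functional_le_of_convexHull _ hle)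

theorem IsPolytope.isFaceOfDim_trans [FiniteDimensional ℝ E] {P F G : Set E} {k : ℕ}
    (hP : IsPolytope P) (hF : IsExposed ℝ P F) (hG : IsFaceOfDim F k G) : IsFaceOfDim P k G :=
  ⟨hG.1, hP.isExposed_trans hF hG.2.1, hG.2.2⟩

/-- The hull of a set on a line is the segment between its extreme points for a functional. -/
theorem eq_segment_of_line {V : Set E} {a b : E} (l : E →ₗ[ℝ] ℝ) (ha : a ∈ V) (hb : b ∈ V)
    (hab : l b < l a)
    (h : ∀ y ∈ V, l b ≤ l y ∧ l y ≤ l a ∧ ∃ s : ℝ, y - b = s • (a - b)) :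
    convexHull ℝ V = segment ℝ b a := by
  apply Subset.antisymm
  · apply convexHull_min _ (convex_segment b a)
    intro y hy
    obtain ⟨h1, h2, s, hs⟩ := h y hy
    have e : l y - l b = s * (l a - l b) := by
      rw [← map_sub, hs, map_smul, map_sub, smul_eq_mul]
    have hs0 : 0 ≤ s := by
      by_contra h'
      push Not at h'
      nlinarith
    have hs1 : s ≤ 1 := by
      by_contra h'
      push Not at h'
      nlinarith
    rw [segment_eq_image']
    exact ⟨s, ⟨hs0, hs1⟩, by simp only [← hs]; abel⟩
  · rw [← convexHull_pair]
    apply convexHull_mono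
    rintro x (rfl | rfl)
    · exact hb
    · exact ha

theorem exists_dual_separating [FiniteDimensional ℝ E] {d w : E}
    (h : w ∉ Submodule.span ℝ {d}) : ∃ l : E →ₗ[ℝ] ℝ, l d = 0 ∧ 0 < l w := by
  obtain ⟨l, hl, hl'⟩ := Submodule.exists_dual_map_eq_bot_of_notMem h inferInstance
  have hd : l d = 0 := by
    have : l d ∈ (Submodule.span ℝ {d}).map l :=
      Submodule.mem_map_of_mem (Submodule.mem_span_singleton_self d)
    rw [hl'] at this
    simpa using this
  rcases lt_or_gt_of_ne hl with h | h
  · exact ⟨-l, by simp [hd], by simpa using h⟩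
  · exact ⟨l, hd, h⟩

theorem exists_dual_lt [FiniteDimensional ℝ E] {x y : E} (h : x ≠ y) :
    ∃ l : E →ₗ[ℝ] ℝ, l x < l y := by
  obtain ⟨l, -, hl⟩ := exists_dual_separating (d := (0 : E)) (w := y - x) (by
    simpa [sub_eq_zero] using h.symm)
  exact ⟨l, by simpa using hl⟩

/-- Induction on the number of generating points. A proper face with two points has fewer
generators. If there is none, the generators are collinear, for otherwise a functional can be tilted
about its maximizer until a second generator becomes maximal, and this exposes such a face. -/
theorem IsPolytope.exists_edge [FiniteDimensional ℝ E] {Q : Set E} (hQ : IsPolytope Q) {x y : E}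
    (hx : x ∈ Q) (hy : y ∈ Q) (hxy : x ≠ y) : ∃ u v, IsEdge Q u v := by
  obtain ⟨V, hV, rfl⟩ := hQ
  induction hn : V.ncard using Nat.strong_induction_on generalizing V x y with
  | _ n ih =>
  by_cases hface : ∃ (G : Set E), IsExposed ℝ (convexHull ℝ V) G ∧ G ≠ convexHull ℝ V ∧
      ∃ x ∈ G, ∃ y ∈ G, x ≠ y
  · obtain ⟨G, hG, hne, a, ha, b, hb, hab⟩ := hface
    have e := isExposed_eq_convexHull hG
    have hlt : (V ∩ G).ncard < n := by
      rw [← hn]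
      apply Set.ncard_lt_ncard _ hV
      refine ⟨inter_subset_left, fun h => hne ?_⟩
      rw [e, inter_eq_left.2 (fun v hv => (h hv).2)]
    rw [e] at ha hb
    obtain ⟨u, v, huv⟩ := ih _ hlt hab (V ∩ G) (hV.inter_of_left G) ha hb rfl
    rw [← e] at huv
    exact ⟨u, v, IsPolytope.isFaceOfDim_trans ⟨V, hV, rfl⟩ hG huv⟩
  · push Not at hface
    obtain ⟨l, hl⟩ := exists_dual_lt hxy
    have hVne : V.Nonempty := convexHull_nonempty_iff.1 ⟨x, hx⟩
    obtain ⟨a, haV, ha⟩ := Set.exists_max_image V l hV hVne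
    obtain ⟨b, hbV, hb⟩ := Set.exists_min_image V l hV hVne
    have hab : l b < l a := by
      by_contra h
      have h1 := functional_le_of_convexHull l ha y hy
      have h2 := functional_le_of_convexHull (-l) (k := -l b) (fun v hv => by simpa using hb v hv)
        x hx
      simp only [LinearMap.neg_apply] at h2
      linarith
    by_cases hline : ∀ y ∈ V, y - b ∈ Submodule.span ℝ {a - b}
    · have e : convexHull ℝ V = segment ℝ b a :=
        eq_segment_of_line l haV hbV hab fun y hy => ⟨hb y hy, ha y hy, by
          obtain ⟨s, hs⟩ := Submodule.mem_span_singleton.1 (hline y hy)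
          exact ⟨s, hs.symm⟩⟩
      refine ⟨b, a, ?_⟩
      rw [IsEdge, e]
      exact ⟨⟨b, left_mem_segment ℝ b a⟩, IsExposed.refl _,
        dim_segment fun h => hab.ne (congrArg l h)⟩
    · exfalso
      push Not at hline
      obtain ⟨c, hcV, hc⟩ := hline
      obtain ⟨k, hk, hkc⟩ := exists_dual_separating hc
      rw [map_sub] at hk hkc
      -- The least tilt `r` at which some point `z` with `k a < k z` catches up with `a`. The
      -- functional `l + r • k` is then maximal at both `a` and `z`, but not at `b`, because `k a =
      -- k b` and `l b < l a`.
      obtain ⟨z, ⟨hzV, hz⟩, hzmin⟩ := Set.exists_min_image {y ∈ V | k a < k y}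
        (fun y => (l a - l y) / (k y - k a)) (hV.subset fun _ h => h.1) ⟨c, hcV, by linarith⟩
      set r := (l a - l z) / (k z - k a) with hr
      have hr0 : 0 ≤ r := div_nonneg (by linarith [ha z hzV]) (by linarith)
      have hle : ∀ y ∈ V, (l + r • k) y ≤ l a + r * k a := by
        intro y hy
        simp only [LinearMap.add_apply, LinearMap.smul_apply, smul_eq_mul]
        rcases le_or_gt (k y) (k a) with h | h
        · have := mul_le_mul_of_nonneg_left h hr0
          linarith [ha y hy]
        · have h1 : r ≤ (l a - l y) / (k y - k a) := hzmin y ⟨hy, h⟩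
          rw [le_div_iff₀ (by linarith)] at h1
          linarith
      have hexp := isExposed_of_functional (l + r • k) _ (functional_le_of_convexHull _ hle)
      have hza : z = a := by
        apply hface _ hexp _ z _ a
        · refine ⟨subset_convexHull ℝ V haV, ?_⟩
          simp
        · intro h
          have : b ∈ convexHull ℝ V := subset_convexHull ℝ V hbV
          rw [← h] at this
          have := this.2
          simp only [LinearMap.add_apply, LinearMap.smul_apply, smul_eq_mul] at this
          have hkk : k a = k b := by linarith
          rw [hkk] at this
          linarith
        · refine ⟨subset_convexHull ℝ V hzV, ?_⟩
          simp only [LinearMap.add_apply, LinearMap.smul_apply, smul_eq_mul]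
          have : r * (k z - k a) = l a - l z := by
            rw [hr]; field_simp [(sub_pos.2 hz).ne']
          linarith
      rw [hza] at hz
      exact hz.false

theorem IsEdge.symm {P : Set E} {u v : E} (h : IsEdge P u v) : IsEdge P v u := by
  rwa [IsEdge, segment_symm]

theorem IsEdge.left_mem {P : Set E} {u v : E} (h : IsEdge P u v) : u ∈ P :=
  h.subset (left_mem_segment ℝ u v)

theorem IsEdge.right_mem {P : Set E} {u v : E} (h : IsEdge P u v) : v ∈ P :=
  h.subset (right_mem_segment ℝ u v)

theorem isVertex_segment [FiniteDimensional ℝ E] {u v : E} (h : u ≠ v) :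
    IsFaceOfDim (segment ℝ u v) 0 {u} := by
  obtain ⟨l, hl⟩ := exists_dual_lt h.symm
  refine ⟨singleton_nonempty u, ?_, dim_singleton u⟩
  have hle : ∀ y ∈ ({u, v} : Set E), l y ≤ l u := by
    rintro y (rfl | rfl)
    · exact le_rfl
    · exact hl.le
  have e := face_convexHull l hle
  have e2 : {x ∈ ({u, v} : Set E) | l x = l u} = {u} := by
    ext x
    constructor
    · rintro ⟨rfl | rfl, h'⟩
      · rfl
      · exact absurd h' hl.ne
    · rintro rfl
      exact ⟨Or.inl rfl, rfl⟩
  rw [e2, convexHull_singleton, convexHull_pair] at e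
  rw [← e]
  apply isExposed_of_functional
  rw [← convexHull_pair]
  exact functional_le_of_convexHull l hle

theorem IsPolytope.isVertex_left [FiniteDimensional ℝ E] {P : Set E} (hP : IsPolytope P) {u v : E}
    (h : IsEdge P u v) : IsFaceOfDim P 0 {u} :=
  hP.isFaceOfDim_trans h.2.1 (isVertex_segment h.ne)

theorem IsPolytope.isVertex_right [FiniteDimensional ℝ E] {P : Set E} (hP : IsPolytope P)
    {u v : E} (h : IsEdge P u v) : IsFaceOfDim P 0 {v} :=
  hP.isVertex_left h.symm

theorem IsFaceOfDim.eq_or_eq_of_mem_segment {P : Set E} {v a b : E} (h : IsFaceOfDim P 0 {v})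
    (ha : a ∈ P) (hb : b ∈ P) (hv : v ∈ segment ℝ a b) : v = a ∨ v = b := by
  by_contra! hne
  exact hne.1 (h.2.1.isExtreme.left_mem_of_mem_openSegment ha hb rfl
    (mem_openSegment_of_ne_left_right hne.1.symm hne.2.symm hv)).symm

theorem IsPolytope.exists_lt_of_face [FiniteDimensional ℝ E] {P G : Set E} (hP : IsPolytope P)
    {f : E →ₗ[ℝ] ℝ} (hf : IsGeneric P f) (hG : IsExposed ℝ P G) {x y : E} (hx : x ∈ G)
    (hy : y ∈ G) (hxy : x ≠ y) : ∃ u ∈ G, ∃ v ∈ G, f u < f v := by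
  obtain ⟨u, v, huv⟩ := (hP.of_isExposed hG).exists_edge hx hy hxy
  have := hf u v (hP.isFaceOfDim_trans hG huv)
  rcases lt_or_gt_of_ne this with h | h
  · exact ⟨u, huv.left_mem, v, huv.right_mem, h⟩
  · exact ⟨v, huv.right_mem, u, huv.left_mem, h⟩

/-- The maximizers of `f` on `G` form a face of `P`. With two points it would contain an edge on
which `f` is constant, against genericity. -/
theorem IsPolytope.exists_sink [FiniteDimensional ℝ E] {P G : Set E} (hP : IsPolytope P)
    {f : E →ₗ[ℝ] ℝ} (hf : IsGeneric P f) (hG : IsExposed ℝ P G) (hne : G.Nonempty) :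
    ∃ s ∈ G, IsFaceOfDim G 0 {s} ∧ (∀ y ∈ G, f y ≤ f s) ∧ ∀ y ∈ G, f y = f s → y = s := by
  obtain ⟨s, hs, hmax⟩ := (hP.of_isExposed hG).isCompact.exists_isMaxOn hne
    (LinearMap.continuous_of_finiteDimensional f).continuousOn
  have hmax' : ∀ y ∈ G, f y ≤ f s := hmax
  have hexp := isExposed_of_functional f (f s) hmax'
  have huniq : ∀ y ∈ G, f y = f s → y = s := by
    intro y hy hys
    by_contra hne
    obtain ⟨u, hu, v, hv, huv⟩ := hP.exists_lt_of_face hf (hP.isExposed_trans hG hexp) ⟨hy, hys⟩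
      ⟨hs, rfl⟩ hne
    rw [hu.2, hv.2] at huv
    exact huv.false
  refine ⟨s, hs, ⟨singleton_nonempty s, ?_, dim_singleton s⟩, hmax', huniq⟩
  convert hexp using 1
  ext x
  constructor
  · rintro rfl
    exact ⟨hs, rfl⟩
  · rintro ⟨hx, h⟩
    exact huniq x hx h

theorem IsGeneric.neg {P : Set E} {f : E →ₗ[ℝ] ℝ} (hf : IsGeneric P f) : IsGeneric P (-f) :=
  fun u v h h' => hf u v h (by simpa using h')

theorem IsPolytope.exists_source [FiniteDimensional ℝ E] {P G : Set E} (hP : IsPolytope P)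
    {f : E →ₗ[ℝ] ℝ} (hf : IsGeneric P f) (hG : IsExposed ℝ P G) (hne : G.Nonempty) :
    ∃ s ∈ G, IsFaceOfDim G 0 {s} ∧ (∀ y ∈ G, f s ≤ f y) ∧ ∀ y ∈ G, f y = f s → y = s := by
  obtain ⟨s, hs, h1, h2, h3⟩ := hP.exists_sink hf.neg hG hne
  exact ⟨s, hs, h1, fun y hy => by simpa using h2 y hy, fun y hy h => h3 y hy (by simpa using h)⟩

theorem IsGeneric.of_isExposed [FiniteDimensional ℝ E] {P G : Set E} (hP : IsPolytope P)
    {f : E →ₗ[ℝ] ℝ} (hf : IsGeneric P f) (hG : IsExposed ℝ P G) : IsGeneric G f :=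
  fun u v h => hf u v (hP.isFaceOfDim_trans hG h)

theorem IsPolytope.injOn_edge [FiniteDimensional ℝ E] {P : Set E} {f : E →ₗ[ℝ] ℝ}
    (hf : IsGeneric P f) {u v x y : E} (h : IsEdge P u v) (hx : x ∈ segment ℝ u v)
    (hy : y ∈ segment ℝ u v) (hxy : f x = f y) : x = y := by
  rw [segment_eq_image'] at hx hy
  obtain ⟨a, -, rfl⟩ := hx
  obtain ⟨b, -, rfl⟩ := hy
  simp only [map_add, map_smul, map_sub, smul_eq_mul] at hxy
  have h0 : f v - f u ≠ 0 := sub_ne_zero.2 (hf u v h).symm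
  have : a = b := mul_right_cancel₀ h0 (by linarith)
  rw [this]

end MonotoneFlip

namespace MonotoneFlip

open Set

/-! ### The cyclic order of rays in the plane -/

/-- The determinant of two plane vectors. -/
def cr (a b : ℝ × ℝ) : ℝ := a.1 * b.2 - a.2 * b.1

/-- The scalar product of two plane vectors. -/
def dt (a b : ℝ × ℝ) : ℝ := a.1 * b.1 + a.2 * b.2

/-- The rays spanned by `a`, `b`, `c` are in counterclockwise cyclic order. -/
def Ccw (a b c : ℝ × ℝ) : Prop :=
  (0 < cr a b ∧ 0 < cr b c) ∨ (0 < cr b c ∧ 0 < cr c a) ∨ (0 < cr c a ∧ 0 < cr a b)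

/-- The vectors `a` and `b` span different rays. -/
def DistinctRays (a b : ℝ × ℝ) : Prop := cr a b ≠ 0 ∨ dt a b < 0

theorem cr_swap (a b : ℝ × ℝ) : cr b a = -cr a b := by unfold cr; ring

theorem dt_swap (a b : ℝ × ℝ) : dt b a = dt a b := by unfold dt; ring

theorem cr_self (a : ℝ × ℝ) : cr a a = 0 := by unfold cr; ring

theorem DistinctRays.symm {a b : ℝ × ℝ} (h : DistinctRays a b) : DistinctRays b a := by
  unfold DistinctRays at *
  rwa [cr_swap, dt_swap, neg_ne_zero]

theorem Ccw.rotate {a b c : ℝ × ℝ} (h : Ccw a b c) : Ccw b c a := by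
  unfold Ccw at *
  tauto

theorem Ccw.asymm {a b c : ℝ × ℝ} (h : Ccw a b c) : ¬ Ccw a c b := by
  unfold Ccw at *
  rw [cr_swap b c, cr_swap c a, cr_swap a b]
  rintro (h' | h' | h') <;> rcases h with h | h | h <;> linarith [h.1, h.2, h'.1, h'.2]

/-- The Grassmann–Plücker relation `pl` among the six determinants excludes the sign patterns that
would violate transitivity. -/
theorem Ccw.trans {a b c d : ℝ × ℝ} (h : Ccw a b c) (h' : Ccw a c d) : Ccw a b d := by
  have pl : cr a b * cr c d + cr c a * cr b d = cr d a * cr b c := by unfold cr; ring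
  unfold Ccw at *
  have e1 := cr_swap a c
  rcases h with ⟨h1, h2⟩ | ⟨h1, h2⟩ | ⟨h1, h2⟩ <;> rcases h' with ⟨h3, h4⟩ | ⟨h3, h4⟩ | ⟨h3, h4⟩
  · by_cases hda : 0 < cr d a
    · exact Or.inr (Or.inr ⟨hda, h1⟩)
    · left
      refine ⟨h1, ?_⟩
      by_contra hbd
      have i1 := mul_pos h1 h4
      have i2 := mul_nonneg h3.le (not_lt.1 hbd |> neg_nonneg.2)
      have i3 := mul_nonneg (not_lt.1 hda |> neg_nonneg.2) h2.le
      nlinarith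
  · exact Or.inr (Or.inr ⟨h4, h1⟩)
  · exact Or.inr (Or.inr ⟨h3, h1⟩)
  · linarith
  · by_cases hab : 0 < cr a b
    · exact Or.inr (Or.inr ⟨h4, hab⟩)
    · right; left
      refine ⟨?_, h4⟩
      by_contra hbd
      have i1 := mul_pos h4 h1
      have i2 := mul_nonneg h2.le (not_lt.1 hbd |> neg_nonneg.2)
      have i3 := mul_nonneg (not_lt.1 hab |> neg_nonneg.2) h3.le
      nlinarith
  · linarith
  · linarith
  · exact Or.inr (Or.inr ⟨h4, h2⟩)
  · linarith

theorem Ccw.trans_right {a b c d : ℝ × ℝ} (h : Ccw a b c) (h' : Ccw a c d) : Ccw b c d :=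
  (h'.rotate.trans h.rotate.rotate).rotate.rotate

/-- The vectors satisfy the linear relation `cr b c • a + cr c a • b + cr a b • c = 0`; `i1`, `i2`,
`i3` are its scalar products with `a`, `b`, `c`. Two determinants of equal nonzero sign decide the
order, and the relation excludes the other sign patterns. -/
theorem ccw_total {a b c : ℝ × ℝ} (h1 : DistinctRays a b) (h2 : DistinctRays b c)
    (h3 : DistinctRays c a) : Ccw a b c ∨ Ccw a c b := by
  have i1 : cr b c * dt a a + cr c a * dt b a + cr a b * dt c a = 0 := by unfold cr dt; ring
  have i2 : cr b c * dt a b + cr c a * dt b b + cr a b * dt c b = 0 := by unfold cr dt; ring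
  have i3 : cr b c * dt a c + cr c a * dt b c + cr a b * dt c c = 0 := by unfold cr dt; ring
  have p1 : 0 ≤ dt a a := add_nonneg (mul_self_nonneg _) (mul_self_nonneg _)
  have p2 : 0 ≤ dt b b := add_nonneg (mul_self_nonneg _) (mul_self_nonneg _)
  have p3 : 0 ≤ dt c c := add_nonneg (mul_self_nonneg _) (mul_self_nonneg _)
  -- Three rays on one line cannot be pairwise opposite.
  have q : cr a b = 0 → cr b c = 0 → cr c a = 0 → False := by
    intro z1 z2 z3
    have d1 := h1.resolve_left (not_not.2 z1)
    have d2 := h2.resolve_left (not_not.2 z2)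
    have d3 := h3.resolve_left (not_not.2 z3)
    have j : dt a b * dt b c * dt c a = dt a a * dt b c ^ 2
      + dt b c * (cr a b * cr c a) := by unfold dt cr; ring
    rw [z1] at j
    have := mul_pos_of_neg_of_neg d1 d2
    have := mul_neg_of_pos_of_neg this d3
    nlinarith [sq_nonneg (dt b c), mul_nonneg p1 (sq_nonneg (dt b c))]
  unfold Ccw
  unfold DistinctRays at h1 h2 h3
  rw [cr_swap b c, cr_swap c a, cr_swap a b]
  rw [dt_swap a b] at i1
  rw [dt_swap b c] at i2
  rw [dt_swap c a] at i3
  rcases lt_trichotomy (cr a b) 0 with s1 | s1 | s1 <;>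
  rcases lt_trichotomy (cr b c) 0 with s2 | s2 | s2 <;>
  rcases lt_trichotomy (cr c a) 0 with s3 | s3 | s3
  all_goals first
    | (left; left; constructor <;> linarith)
    | (left; right; left; constructor <;> linarith)
    | (left; right; right; constructor <;> linarith)
    | (right; left; constructor <;> linarith)
    | (right; right; left; constructor <;> linarith)
    | (right; right; right; constructor <;> linarith)
    | skip
  all_goals exfalso
  all_goals first
    | exact q s1 s2 s3
    | skip
  all_goals
    simp only [s1, s2, s3, ne_eq, not_true_eq_false, false_or] at h1 h2 h3
  all_goals
    first
    | rw [s1] at i1 i2 i3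
    | rw [s2] at i1 i2 i3
    | rw [s3] at i1 i2 i3
  all_goals nlinarith

/-- Here `x` and `x'` are close to `v` and `z` is not between them. If going counterclockwise from
`x` one meets `z` before `x'`, nearly a full turn is made, so `x` is slightly counterclockwise of
`x'`. The identity `i` is the linear relation of `x`, `x'`, `z` paired with `v`. -/
theorem cr_pos_of_ccw_near {v x x' z : ℝ × ℝ} (h1 : 0 < dt v x) (h2 : 0 < dt v x')
    (h3 : 0 < cr x z * cr x' z ∨ dt v z < 0) (h : Ccw x z x') : 0 < cr x' x := by
  have i : cr z x' * dt v x + cr x' x * dt v z + cr x z * dt v x' = 0 := by unfold cr dt; ring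
  rcases h with ⟨h4, h5⟩ | ⟨h4, h5⟩ | ⟨h4, h5⟩
  · rcases h3 with h3 | h3
    · rw [cr_swap z x'] at h3
      nlinarith
    · by_contra h6
      have := mul_pos h5 h1
      have := mul_pos h4 h2
      nlinarith [mul_nonneg (neg_nonneg.2 (not_lt.1 h6)) (neg_nonneg.2 h3.le)]
  · exact h5
  · exact h4

/-! ### Strictly increasing lists of points -/

variable {E : Type*} [NormedAddCommGroup E] [NormedSpace ℝ E]

/-- The union of the segments between successive points of a list. -/
def listSupport (l : List E) : Set E :=
  {x | ∃ u v : E, [u, v] <:+: l ∧ x ∈ segment ℝ u v}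

theorem listSupport_nil : listSupport ([] : List E) = ∅ := by
  ext x
  simp [listSupport]

theorem listSupport_singleton (a : E) : listSupport [a] = ∅ := by
  ext x
  simp [listSupport, List.infix_cons_iff]

theorem listSupport_cons_cons (a b : E) (l : List E) :
    listSupport (a :: b :: l) = segment ℝ a b ∪ listSupport (b :: l) := by
  ext x
  constructor
  · rintro ⟨u, v, h, hx⟩
    rw [List.infix_cons_iff] at h
    rcases h with h | h
    · simp only [List.cons_prefix_cons] at h
      obtain ⟨rfl, rfl, -⟩ := h
      exact Or.inl hx
    · exact Or.inr ⟨u, v, h, hx⟩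
  · rintro (h | ⟨u, v, h, hx⟩)
    · exact ⟨a, b, by rw [List.infix_cons_iff]; left; simp, h⟩
    · exact ⟨u, v, List.infix_cons h, hx⟩

theorem listSupport_mono {l l' : List E} (h : l <:+: l') : listSupport l ⊆ listSupport l' :=
  fun _ ⟨u, v, huv, hx⟩ => ⟨u, v, huv.trans h, hx⟩

theorem isCompact_listSupport (l : List E) : IsCompact (listSupport l) := by
  induction l with
  | nil => rw [listSupport_nil]; exact isCompact_empty
  | cons a l ih =>
    cases l with
    | nil => rw [listSupport_singleton]; exact isCompact_empty
    | cons b l =>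
      rw [listSupport_cons_cons]
      exact (isPolytope_segment a b).isCompact.union ih

theorem functional_mem_Icc_of_mem_segment {f : E →ₗ[ℝ] ℝ} {u v x : E} (h : f u ≤ f v)
    (hx : x ∈ segment ℝ u v) : f u ≤ f x ∧ f x ≤ f v := by
  rw [segment_eq_image'] at hx
  obtain ⟨a, ⟨h0, h1⟩, rfl⟩ := hx
  simp only [map_add, map_smul, map_sub, smul_eq_mul]
  constructor <;> nlinarith

theorem injOn_segment {f : E →ₗ[ℝ] ℝ} {u v x y : E} (h : f u < f v) (hx : x ∈ segment ℝ u v)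
    (hy : y ∈ segment ℝ u v) (hxy : f x = f y) : x = y := by
  rw [segment_eq_image'] at hx hy
  obtain ⟨a, -, rfl⟩ := hx
  obtain ⟨b, -, rfl⟩ := hy
  simp only [map_add, map_smul, map_sub, smul_eq_mul] at hxy
  have : a = b := mul_right_cancel₀ (sub_pos.2 h).ne' (by linarith)
  rw [this]

theorem exists_mem_segment_level {f : E →ₗ[ℝ] ℝ} {u v : E} {t : ℝ} (h1 : f u ≤ t) (h2 : t ≤ f v) :
    ∃ x ∈ segment ℝ u v, f x = t := by
  rcases (h1.trans h2).eq_or_lt with h | h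
  · exact ⟨u, left_mem_segment ℝ u v, le_antisymm h1 (h ▸ h2)⟩
  · have h0 : 0 < f v - f u := sub_pos.2 h
    refine ⟨u + ((t - f u) / (f v - f u)) • (v - u), ?_, ?_⟩
    · rw [segment_eq_image']
      exact ⟨_, ⟨div_nonneg (by linarith) h0.le, (div_le_one h0).2 (by linarith)⟩, rfl⟩
    · simp only [map_add, map_smul, map_sub, smul_eq_mul]
      field_simp
      ring

section IncreasingList

variable {f : E →ₗ[ℝ] ℝ}

theorem increasing_pairwise {l : List E} (h : l.IsChain (fun u v => f u < f v)) :
    l.Pairwise (fun u v => f u < f v) := by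
  have : IsTrans E (fun u v => f u < f v) := ⟨fun _ _ _ => lt_trans⟩
  exact List.isChain_iff_pairwise.1 h

theorem le_of_mem_listSupport {b : E} {l : List E} (h : (b :: l).IsChain (fun u v => f u < f v))
    {x : E} (hx : x ∈ listSupport (b :: l)) : f b ≤ f x ∧ (f x = f b → x = b) := by
  induction l generalizing b with
  | nil => rw [listSupport_singleton] at hx; exact hx.elim
  | cons c l ih =>
    rw [List.isChain_cons_cons] at h
    rw [listSupport_cons_cons] at hx
    rcases hx with hx | hx
    · exact ⟨(functional_mem_Icc_of_mem_segment h.1.le hx).1,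
        fun e => injOn_segment h.1 hx (left_mem_segment ℝ b c) e⟩
    · have := (ih h.2 hx).1
      exact ⟨h.1.le.trans this, fun e => by linarith [h.1]⟩

theorem listSupport_injOn {l : List E} (h : l.IsChain (fun u v => f u < f v)) {x y : E}
    (hx : x ∈ listSupport l) (hy : y ∈ listSupport l) (hxy : f x = f y) : x = y := by
  induction l with
  | nil => rw [listSupport_nil] at hx; exact hx.elim
  | cons a l ih =>
    cases l with
    | nil => rw [listSupport_singleton] at hx; exact hx.elim
    | cons b l =>
      rw [List.isChain_cons_cons] at h
      rw [listSupport_cons_cons] at hx hy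
      have key : ∀ x y, x ∈ segment ℝ a b → y ∈ listSupport (b :: l) → f x = f y → x = y := by
        intro x y hx hy hxy
        have h1 := (functional_mem_Icc_of_mem_segment h.1.le hx).2
        have h2 := le_of_mem_listSupport h.2 hy
        rw [h2.2 (by linarith)]
        exact injOn_segment h.1 hx (right_mem_segment ℝ a b) (by linarith)
      rcases hx with hx | hx <;> rcases hy with hy | hy
      · exact injOn_segment h.1 hx hy hxy
      · exact key x y hx hy hxy
      · exact (key y x hy hx hxy.symm).symm
      · exact ih h.2 hx hy

theorem exists_pair_of_level {l : List E} (hne : l ≠ []) {t : ℝ} (h1 : f (l.head hne) ≤ t)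
    (h2 : t < f (l.getLast hne)) : ∃ u v, [u, v] <:+: l ∧ f u ≤ t ∧ t < f v := by
  induction l with
  | nil => exact absurd rfl hne
  | cons a l ih =>
    cases l with
    | nil => simp at h1 h2; linarith
    | cons b l =>
      by_cases hb : f b ≤ t
      · obtain ⟨u, v, h, h'⟩ := ih (by simp) (by simpa using hb) (by simpa using h2)
        exact ⟨u, v, List.infix_cons h, h'⟩
      · exact ⟨a, b, by rw [List.infix_cons_iff]; left; simp, by simpa using h1, not_le.1 hb⟩

theorem mem_listSupport_of_mem {l : List E} (h : 2 ≤ l.length) {v : E} (hv : v ∈ l) :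
    v ∈ listSupport l := by
  induction l with
  | nil => simp at hv
  | cons a l ih =>
    cases l with
    | nil => simp at h
    | cons b l =>
      rw [listSupport_cons_cons]
      rcases List.mem_cons.1 hv with rfl | hv
      · exact Or.inl (left_mem_segment ℝ v b)
      · cases l with
        | nil =>
          rw [List.mem_singleton] at hv
          rw [hv]
          exact Or.inl (right_mem_segment ℝ a b)
        | cons c l => exact Or.inr (ih (by simp) hv)

theorem eq_of_increasing_of_mem_iff {l l' : List E} (h : l.Pairwise (fun u v => f u < f v))
    (h' : l'.Pairwise (fun u v => f u < f v)) (hm : ∀ x, x ∈ l ↔ x ∈ l') : l = l' := by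
  have nd : ∀ {l : List E}, l.Pairwise (fun u v => f u < f v) → l.Nodup := fun h =>
    h.imp (fun {a b} hab he => by rw [he] at hab; exact hab.false)
  have hp : l.Perm l' := (List.perm_ext_iff_of_nodup (nd h) (nd h')).2 hm
  exact hp.eq_of_pairwise (fun a b _ _ h1 h2 => absurd h1 h2.asymm) h h'

end IncreasingList

end MonotoneFlip

/-! ### Horizontal coordinates and an interior axis. -/

namespace MonotoneFlip

open Set

variable {E : Type*} [NormedAddCommGroup E] [NormedSpace ℝ E]

/-- Coordinates adapted to a three-dimensional polytope `P` and a functional `f`: plane coordinates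
`X`, `Y` on the horizontal directions, the lowest and highest vertex, and an axis `c` through the
interior of `P`. -/
structure Frame (P : Set E) (f : E →ₗ[ℝ] ℝ) where
  poly : IsPolytope P
  gen : IsGeneric P f
  dim_eq : dim P = 3
  X : E →ₗ[ℝ] ℝ
  Y : E →ₗ[ℝ] ℝ
  lo : E
  hi : E
  c : ℝ → E
  lo_mem : lo ∈ P
  hi_mem : hi ∈ P
  lo_le : ∀ y ∈ P, f lo ≤ f y
  le_hi : ∀ y ∈ P, f y ≤ f hi
  eq_lo : ∀ y ∈ P, f y = f lo → y = lo
  eq_hi : ∀ y ∈ P, f y = f hi → y = hi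
  lo_lt_hi : f lo < f hi
  inj : ∀ w ∈ vectorSpan ℝ P, f w = 0 → X w = 0 → Y w = 0 → w = 0
  surj : ∀ p q : ℝ, ∃ w ∈ vectorSpan ℝ P, f w = 0 ∧ X w = p ∧ Y w = q
  c_cont : Continuous c
  c_mem : ∀ t ∈ Icc (f lo) (f hi), c t ∈ P
  f_c : ∀ t ∈ Icc (f lo) (f hi), f (c t) = t
  c_int : ∀ (l : E →ₗ[ℝ] ℝ) (k : ℝ), (∀ y ∈ P, l y ≤ k) → (∃ y ∈ P, l y < k) →
    ∀ t ∈ Ioo (f lo) (f hi), l (c t) < k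

/-- The kernel of `f` on the three-dimensional space `W` is a plane. Its coordinates are extended
from the kernel to `W` and from `W` to `E`. -/
theorem exists_horizontal_coordinates [FiniteDimensional ℝ E] (W : Submodule ℝ E)
    (hW : Module.finrank ℝ W = 3) (f : E →ₗ[ℝ] ℝ) (hf : ∃ w ∈ W, f w ≠ 0) :
    ∃ X Y : E →ₗ[ℝ] ℝ, (∀ w ∈ W, f w = 0 → X w = 0 → Y w = 0 → w = 0) ∧
      ∀ p q : ℝ, ∃ w ∈ W, f w = 0 ∧ X w = p ∧ Y w = q := by
  set g : W →ₗ[ℝ] ℝ := f.comp W.subtype with hg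
  have hrange : LinearMap.range g = ⊤ := by
    rw [LinearMap.range_eq_top]
    apply LinearMap.surjective
    obtain ⟨w, hw, h⟩ := hf
    intro h0
    exact h (by simpa [hg] using congrArg (fun φ => φ ⟨w, hw⟩) h0)
  have hker : Module.finrank ℝ (LinearMap.ker g) = 2 := by
    have := LinearMap.finrank_range_add_finrank_ker g
    rw [hrange, finrank_top, Module.finrank_self, hW] at this
    omega
  let e : LinearMap.ker g ≃ₗ[ℝ] (Fin 2 → ℝ) :=
    LinearEquiv.ofFinrankEq _ _ (by rw [hker]; simp)
  obtain ⟨Φ, hΦ⟩ := LinearMap.exists_extend e.toLinearMap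
  obtain ⟨Ψ, hΨ⟩ := LinearMap.exists_extend Φ
  have hval : ∀ (w : E) (hw : w ∈ W) (h0 : f w = 0), Ψ w = e ⟨⟨w, hw⟩, h0⟩ := by
    intro w hw h0
    have h1 := congrArg (fun φ => φ ⟨w, hw⟩) hΨ
    have h2 := congrArg (fun φ => φ ⟨⟨w, hw⟩, h0⟩) hΦ
    simp only [LinearMap.comp_apply, Submodule.subtype_apply, LinearEquiv.coe_coe] at h1 h2
    rw [h1, h2]
  refine ⟨(LinearMap.proj 0).comp Ψ, (LinearMap.proj 1).comp Ψ, ?_, ?_⟩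
  · intro w hw h0 hx hy
    simp only [LinearMap.comp_apply, LinearMap.proj_apply] at hx hy
    rw [hval w hw h0] at hx hy
    have : e ⟨⟨w, hw⟩, h0⟩ = 0 := by
      ext i
      fin_cases i
      · exact hx
      · exact hy
    rw [LinearEquiv.map_eq_zero_iff] at this
    simpa using congrArg (fun z : LinearMap.ker g => ((z : W) : E)) this
  · intro p q
    obtain ⟨⟨⟨w, hw⟩, h0⟩, hz⟩ := e.surjective ![p, q]
    have h0' : f w = 0 := h0
    refine ⟨w, hw, h0', ?_, ?_⟩ <;>
    · simp only [LinearMap.comp_apply, LinearMap.proj_apply]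
      rw [hval w hw h0', hz]
      simp

/-- The barycenter of the generating points: an inequality valid on `P` and strict somewhere is
strict at some generator, hence at the average. -/
theorem IsPolytope.exists_center {P : Set E} (hP : IsPolytope P) (hne : P.Nonempty) :
    ∃ c ∈ P, ∀ (l : E →ₗ[ℝ] ℝ) (k : ℝ), (∀ y ∈ P, l y ≤ k) → (∃ y ∈ P, l y < k) → l c < k := by
  obtain ⟨V, hV, rfl⟩ := hP
  lift V to Finset E using hV
  have hVne : V.Nonempty := by simpa using hne
  have hcard : (0 : ℝ) < V.card := by exact_mod_cast hVne.card_pos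
  refine ⟨∑ v ∈ V, (V.card : ℝ)⁻¹ • v, ?_, ?_⟩
  · apply (convex_convexHull ℝ (V : Set E)).sum_mem
    · intro v _
      positivity
    · rw [Finset.sum_const, nsmul_eq_mul, mul_inv_cancel₀ hcard.ne']
    · intro v hv
      exact subset_convexHull ℝ _ hv
  · intro l k hl hlt
    have hlV : ∀ v ∈ V, l v ≤ k := fun v hv => hl v (subset_convexHull ℝ _ hv)
    obtain ⟨v, hv, hvk⟩ : ∃ v ∈ V, l v < k := by
      by_contra! h
      obtain ⟨y, hy, hyk⟩ := hlt
      have := functional_le_of_convexHull (-l) (k := -k) (V := (V : Set E))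
        (fun v hv => by simpa using h v hv) y hy
      simp only [LinearMap.neg_apply] at this
      linarith
    rw [map_sum]
    calc ∑ v ∈ V, l ((V.card : ℝ)⁻¹ • v) < ∑ v ∈ V, (V.card : ℝ)⁻¹ * k := by
          apply Finset.sum_lt_sum
          · intro i hi
            rw [map_smul, smul_eq_mul]
            exact mul_le_mul_of_nonneg_left (hlV i hi) (by positivity)
          · refine ⟨v, hv, ?_⟩
            rw [map_smul, smul_eq_mul]
            exact mul_lt_mul_of_pos_left hvk (by positivity)
      _ = k := by
          rw [Finset.sum_const, nsmul_eq_mul, ← mul_assoc, mul_inv_cancel₀ hcard.ne', one_mul]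

theorem exists_frame [FiniteDimensional ℝ E] {P : Set E} (hP : IsPolytope P) (hdim : dim P = 3)
    {f : E →ₗ[ℝ] ℝ} (hf : IsGeneric P f) : Nonempty (Frame P f) := by
  obtain ⟨x, hx, y, hy, hxy⟩ : P.Nontrivial := by
    by_contra h
    rw [Set.not_nontrivial_iff] at h
    have : dim P = 0 := by
      rw [dim, vectorSpan_of_subsingleton ℝ h, finrank_bot]
    omega
  obtain ⟨lo, hlo, -, hlo1, hlo2⟩ := hP.exists_source hf (IsExposed.refl P) ⟨x, hx⟩
  obtain ⟨hi, hhi, -, hhi1, hhi2⟩ := hP.exists_sink hf (IsExposed.refl P) ⟨x, hx⟩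
  obtain ⟨u, hu, v, hv, huv⟩ := hP.exists_lt_of_face hf (IsExposed.refl P) hx hy hxy
  have hlt : f lo < f hi := (hlo1 u hu).trans_lt (huv.trans_le (hhi1 v hv))
  obtain ⟨X, Y, hinj, hsurj⟩ := exists_horizontal_coordinates (vectorSpan ℝ P) hdim f
    ⟨v - u, vsub_mem_vectorSpan ℝ hv hu, by rw [map_sub]; linarith⟩
  obtain ⟨c₀, hc₀, hc⟩ := hP.exists_center ⟨x, hx⟩
  have h1 : f c₀ < f hi := hc f _ hhi1 ⟨lo, hlo, hlt⟩
  have h2 : f lo < f c₀ := by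
    have := hc (-f) (-f lo) (fun y hy => by simpa using hlo1 y hy) ⟨hi, hhi, by simpa using hlt⟩
    simpa using this
  -- The axis is the broken line from `lo` through the center `c₀` to `hi`, parametrized by level.
  -- Each inner point has positive weight at `c₀`, so it inherits the strict inequalities.
  set c : ℝ → E := fun t => if t ≤ f c₀ then lo + ((t - f lo) / (f c₀ - f lo)) • (c₀ - lo)
    else hi + ((f hi - t) / (f hi - f c₀)) • (c₀ - hi) with hcdef
  have d1 : 0 < f c₀ - f lo := sub_pos.2 h2
  have d2 : 0 < f hi - f c₀ := sub_pos.2 h1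
  have key : ∀ t ∈ Icc (f lo) (f hi), ∃ p ∈ P, ∃ θ : ℝ, 0 ≤ θ ∧ θ ≤ 1 ∧
      (t ∈ Ioo (f lo) (f hi) → 0 < θ) ∧ c t = p + θ • (c₀ - p) ∧ f p + θ * (f c₀ - f p) = t := by
    rintro t ⟨ht1, ht2⟩
    by_cases ht : t ≤ f c₀
    · refine ⟨lo, hlo, (t - f lo) / (f c₀ - f lo), div_nonneg (by linarith) d1.le,
        (div_le_one d1).2 (by linarith), fun h => div_pos (by linarith [h.1]) d1, ?_, ?_⟩
      · simp only [hcdef, ht, if_true]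
      · field_simp; ring
    · refine ⟨hi, hhi, (f hi - t) / (f hi - f c₀), div_nonneg (by linarith) d2.le,
        (div_le_one d2).2 (by linarith), fun h => div_pos (by linarith [h.2]) d2, ?_, ?_⟩
      · simp only [hcdef, ht, if_false]
      · field_simp; ring
  refine ⟨⟨hP, hf, hdim, X, Y, lo, hi, c, hlo, hhi, hlo1, hhi1, hlo2, hhi2, hlt, hinj, hsurj, ?_, ?_, ?_, ?_⟩⟩
  · apply Continuous.if_le
    · fun_prop
    · fun_prop
    · exact continuous_id
    · exact continuous_const
    · intro t ht
      rw [ht, div_self d1.ne', div_self d2.ne']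
      simp
  · intro t ht
    obtain ⟨p, hp, θ, h0, h1, -, h, -⟩ := key t ht
    rw [h]
    exact hP.convex.add_smul_sub_mem hp hc₀ ⟨h0, h1⟩
  · intro t ht
    obtain ⟨p, hp, θ, h0, h1, -, h, h'⟩ := key t ht
    rw [h, map_add, map_smul, map_sub, smul_eq_mul, h']
  · intro l k hl hlt t ht
    obtain ⟨p, hp, θ, h0, h1, h2, h, -⟩ := key t (Ioo_subset_Icc_self ht)
    rw [h, map_add, map_smul, map_sub, smul_eq_mul]
    nlinarith [hc l k hl hlt, hl p hp, h2 ht]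

namespace Frame

variable {P : Set E} {f : E →ₗ[ℝ] ℝ} (A : Frame P f)

/-- The plane coordinates of `x` relative to the axis. -/
noncomputable def dir (x : E) : ℝ × ℝ := (A.X (x - A.c (f x)), A.Y (x - A.c (f x)))

theorem inj_points {x y : E} (hx : x ∈ P) (hy : y ∈ P) (h : f x = f y) (h1 : A.X x = A.X y)
    (h2 : A.Y x = A.Y y) : x = y := by
  have := A.inj (x - y) (vsub_mem_vectorSpan ℝ hx hy) (by simp [h]) (by simp [h1]) (by simp [h2])
  exact sub_eq_zero.1 this

theorem rep (l : E →ₗ[ℝ] ℝ) : ∃ α β : ℝ, ∀ w ∈ vectorSpan ℝ P, f w = 0 →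
    l w = α * A.X w + β * A.Y w := by
  obtain ⟨k₁, h₁, h₁f, h₁X, h₁Y⟩ := A.surj 1 0
  obtain ⟨k₂, h₂, h₂f, h₂X, h₂Y⟩ := A.surj 0 1
  refine ⟨l k₁, l k₂, fun w hw hwf => ?_⟩
  have := A.inj (w - (A.X w • k₁ + A.Y w • k₂)) (Submodule.sub_mem _ hw
    (Submodule.add_mem _ (Submodule.smul_mem _ _ h₁) (Submodule.smul_mem _ _ h₂)))
    (by simp [hwf, h₁f, h₂f]) (by simp [h₁X, h₂X]) (by simp [h₁Y, h₂Y])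
  rw [sub_eq_zero] at this
  conv_lhs => rw [this]
  simp only [map_add, map_smul, smul_eq_mul]
  ring

theorem continuous_dir [FiniteDimensional ℝ E] : Continuous A.dir := by
  have hf : Continuous f := LinearMap.continuous_of_finiteDimensional f
  have hX : Continuous A.X := LinearMap.continuous_of_finiteDimensional _
  have hY : Continuous A.Y := LinearMap.continuous_of_finiteDimensional _
  have hc := A.c_cont
  unfold dir
  fun_prop

end Frame

end MonotoneFlip

/-! ### Boundary points and horizontal slices of facets, seen from the axis. -/

namespace MonotoneFlip

open Set

variable {E : Type*} [NormedAddCommGroup E] [NormedSpace ℝ E]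

/-- The face `F` has points strictly below and strictly above the level `t`. -/
def Alive (f : E →ₗ[ℝ] ℝ) (F : Set E) (t : ℝ) : Prop := (∃ y ∈ F, f y < t) ∧ ∃ y ∈ F, t < f y

/-- `x` lies on a proper exposed face of `P`. -/
def OnBoundary (P : Set E) (x : E) : Prop :=
  x ∈ P ∧ ∃ (l : E →ₗ[ℝ] ℝ) (k : ℝ), (∀ y ∈ P, l y ≤ k) ∧ (∃ y ∈ P, l y < k) ∧ l x = k

theorem exists_functional_of_dim_lt {P F : Set E} {k : ℕ} (hF : IsFaceOfDim P k F)
    (hk : k < dim P) : ∃ (l : E →ₗ[ℝ] ℝ) (a : ℝ), (∀ y ∈ P, l y ≤ a) ∧ (∃ y ∈ P, l y < a) ∧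
      F = {x ∈ P | l x = a} := by
  obtain ⟨l, a, hl, hlF⟩ := exists_functional_of_isExposed hF.2.1 hF.1
  refine ⟨l, a, hl, ?_, hlF⟩
  by_contra! h
  have : F = P := by
    rw [hlF]
    ext x
    exact ⟨fun h => h.1, fun hx => ⟨hx, le_antisymm (hl x hx) (h x hx)⟩⟩
  rw [← this, hF.2.2] at hk
  exact hk.false

theorem IsFaceOfDim.onBoundary {P F : Set E} {k : ℕ} (hF : IsFaceOfDim P k F) (hk : k < dim P)
    {x : E} (hx : x ∈ F) : OnBoundary P x := by
  obtain ⟨l, a, h1, h2, h3⟩ := exists_functional_of_dim_lt hF hk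
  exact ⟨hF.subset hx, l, a, h1, h2, by rw [h3] at hx; exact hx.2⟩

/-- A functional equal to its maximum over `P` inside a segment is constant on the segment. -/
theorem functional_eq_of_mem_segment {P : Set E} {l : E →ₗ[ℝ] ℝ} {k : ℝ} (hl : ∀ y ∈ P, l y ≤ k)
    {x y z : E} (hx : x ∈ P) (hy : y ∈ P) {a b : ℝ} (ha : 0 < a) (hb : 0 < b) (hab : a + b = 1)
    (hz : z = a • x + b • y) (hzk : l z = k) : l x = k ∧ l y = k := by
  rw [hz, map_add, map_smul, map_smul, smul_eq_mul, smul_eq_mul] at hzk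
  have h1 := hl x hx
  have h2 := hl y hy
  have e : k = a * k + b * k := by rw [← add_mul, hab, one_mul]
  constructor
  · by_contra h
    have := mul_lt_mul_of_pos_left (lt_of_le_of_ne h1 h) ha
    have := mul_le_mul_of_nonneg_left h2 hb.le
    linarith
  · by_contra h
    have := mul_lt_mul_of_pos_left (lt_of_le_of_ne h2 h) hb
    have := mul_le_mul_of_nonneg_left h1 ha.le
    linarith

namespace Frame

variable {P : Set E} {f : E →ₗ[ℝ] ℝ} (A : Frame P f)

/-- `x` is the right end of the slice of `F` at its level, seen from the axis. -/
def Rt (F : Set E) (x : E) : Prop := x ∈ F ∧ ∀ y ∈ F, f y = f x → 0 ≤ cr (A.dir x) (A.dir y)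

/-- `x` is the left end of the slice of `F` at its level, seen from the axis. -/
def Lt (F : Set E) (x : E) : Prop := x ∈ F ∧ ∀ y ∈ F, f y = f x → 0 ≤ cr (A.dir y) (A.dir x)

/-- `x` is an interior point of the slice of `F` at its level. -/
def OS (F : Set E) (x : E) : Prop := x ∈ F ∧ ∃ y₁ ∈ F, ∃ y₂ ∈ F, f y₁ = f x ∧ f y₂ = f x ∧
  0 < cr (A.dir y₁) (A.dir x) ∧ 0 < cr (A.dir x) (A.dir y₂)

theorem level_mem {x : E} (hx : x ∈ P) : f x ∈ Icc (f A.lo) (f A.hi) := ⟨A.lo_le x hx, A.le_hi x hx⟩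

theorem alive_level {F : Set E} (hF : F ⊆ P) {t : ℝ} (h : Alive f F t) :
    t ∈ Ioo (f A.lo) (f A.hi) := by
  obtain ⟨⟨y, hy, h1⟩, z, hz, h2⟩ := h
  exact ⟨(A.lo_le y (hF hy)).trans_lt h1, h2.trans_le (A.le_hi z (hF hz))⟩

theorem rt_or_lt_or_os {F : Set E} {x : E} (hx : x ∈ F) : A.Rt F x ∨ A.Lt F x ∨ A.OS F x := by
  by_cases h1 : A.Rt F x
  · exact Or.inl h1
  by_cases h2 : A.Lt F x
  · exact Or.inr (Or.inl h2)
  simp only [Rt, Lt, hx, true_and, not_forall, not_le] at h1 h2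
  obtain ⟨y₁, hy₁, e₁, h1⟩ := h1
  obtain ⟨y₂, hy₂, e₂, h2⟩ := h2
  rw [cr_swap] at h1 h2
  exact Or.inr (Or.inr ⟨hx, y₁, hy₁, y₂, hy₂, e₁, e₂, by linarith, by linarith⟩)

theorem sub_c_mem {x : E} (hx : x ∈ P) : x - A.c (f x) ∈ vectorSpan ℝ P :=
  vsub_mem_vectorSpan ℝ hx (A.c_mem _ (A.level_mem hx))

theorem f_sub_c {x : E} (hx : x ∈ P) : f (x - A.c (f x)) = 0 := by
  rw [map_sub, A.f_c _ (A.level_mem hx), sub_self]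

/-- Points of `P` on a common level are determined by their plane coordinates. -/
theorem eq_smul_add_smul {x p q : E} (hx : x ∈ P) (hp : p ∈ P) (hq : q ∈ P) (hpx : f p = f x)
    (hqx : f q = f x) {a b : ℝ} (h1 : (A.dir x).1 = a * (A.dir p).1 + b * (A.dir q).1)
    (h2 : (A.dir x).2 = a * (A.dir p).2 + b * (A.dir q).2) :
    x - A.c (f x) = a • (p - A.c (f x)) + b • (q - A.c (f x)) := by
  have mp : p - A.c (f x) ∈ vectorSpan ℝ P := hpx ▸ A.sub_c_mem hp
  have mq : q - A.c (f x) ∈ vectorSpan ℝ P := hqx ▸ A.sub_c_mem hq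
  have fp : f (p - A.c (f x)) = 0 := hpx ▸ A.f_sub_c hp
  have fq : f (q - A.c (f x)) = 0 := hqx ▸ A.f_sub_c hq
  have fx := A.f_sub_c hx
  simp only [dir, hpx, hqx] at h1 h2
  rw [← sub_eq_zero]
  apply A.inj _ (Submodule.sub_mem _ (A.sub_c_mem hx)
    (Submodule.add_mem _ (Submodule.smul_mem _ _ mp) (Submodule.smul_mem _ _ mq)))
  · rw [map_sub f, map_add f, map_smul f, map_smul f, fp, fq, fx]
    simp
  · rw [map_sub A.X, map_add A.X, map_smul A.X, map_smul A.X, h1]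
    simp
  · rw [map_sub A.Y, map_add A.Y, map_smul A.Y, map_smul A.Y, h2]
    simp

theorem dir_ne_zero {x : E} (hx : OnBoundary P x) (hl : f x ∈ Ioo (f A.lo) (f A.hi)) :
    0 < dt (A.dir x) (A.dir x) := by
  obtain ⟨hxP, l, k, h1, h2, h3⟩ := hx
  have hc := A.c_int l k h1 h2 _ hl
  have hnn : 0 ≤ dt (A.dir x) (A.dir x) := add_nonneg (mul_self_nonneg _) (mul_self_nonneg _)
  refine lt_of_le_of_ne hnn fun h0 => ?_
  unfold dt at h0
  have e1 : (A.dir x).1 = 0 := by nlinarith [mul_self_nonneg (A.dir x).1, mul_self_nonneg (A.dir x).2]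
  have e2 : (A.dir x).2 = 0 := by nlinarith [mul_self_nonneg (A.dir x).1, mul_self_nonneg (A.dir x).2]
  have := A.inj _ (A.sub_c_mem hxP) (A.f_sub_c hxP) e1 e2
  rw [sub_eq_zero] at this
  rw [← this] at hc
  linarith

/-- On a common ray, the nearer point would lie strictly between the axis and the farther point. A
functional supporting `P` at the nearer point is strictly smaller on the axis, so it could not reach
its maximum there. -/
theorem distinctRays {x y : E} (hx : OnBoundary P x) (hy : OnBoundary P y) (hxy : f x = f y)
    (hl : f x ∈ Ioo (f A.lo) (f A.hi)) (hne : x ≠ y) : DistinctRays (A.dir x) (A.dir y) := by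
  -- This makes `y` the nearer point once the rays coincide. One of the two orders holds since the
  -- squared length of the difference is nonnegative.
  wlog hle : dt (A.dir x) (A.dir y) ≤ dt (A.dir x) (A.dir x) generalizing x y
  · refine (this hy hx hxy.symm (hxy ▸ hl) hne.symm ?_).symm
    by_contra h
    have hnn : 0 ≤ dt (A.dir x - A.dir y) (A.dir x - A.dir y) :=
      add_nonneg (mul_self_nonneg _) (mul_self_nonneg _)
    have : dt (A.dir x - A.dir y) (A.dir x - A.dir y) = dt (A.dir x) (A.dir x)
      + dt (A.dir y) (A.dir y) - 2 * dt (A.dir x) (A.dir y) := by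
      simp only [dt, Prod.fst_sub, Prod.snd_sub]; ring
    rw [dt_swap (A.dir x)] at h
    push Not at h hle
    linarith
  by_contra h
  simp only [DistinctRays, not_or, not_not, not_lt] at h
  obtain ⟨h1, h2⟩ := h
  have d1 := A.dir_ne_zero hx hl
  set r := dt (A.dir x) (A.dir y) / dt (A.dir x) (A.dir x) with hr
  have hr0 : 0 ≤ r := div_nonneg h2 d1.le
  have hr1 : r ≤ 1 := (div_le_one d1).2 hle
  have hrd : r * dt (A.dir x) (A.dir x) = dt (A.dir x) (A.dir y) := div_mul_cancel₀ _ d1.ne'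
  have e := A.eq_smul_add_smul hy.1 hx.1 hx.1 hxy hxy (a := r) (b := 0) (by
      rw [zero_mul, add_zero]
      apply mul_right_cancel₀ d1.ne'
      rw [mul_right_comm, hrd]
      unfold cr at h1
      unfold dt
      linear_combination (-(A.dir x).2) * h1) (by
      rw [zero_mul, add_zero]
      apply mul_right_cancel₀ d1.ne'
      rw [mul_right_comm, hrd]
      unfold cr at h1
      unfold dt
      linear_combination ((A.dir x).1) * h1)
  rw [zero_smul, add_zero] at e
  rcases hr1.lt_or_eq with h | h
  · obtain ⟨hyP, l, k, hl1, hl2, hl3⟩ := hy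
    have hc := A.c_int l k hl1 hl2 _ hl
    have := congrArg l e
    rw [map_sub, map_smul, map_sub, smul_eq_mul, hl3, ← hxy] at this
    nlinarith [hl1 x hx.1]
  · rw [h, one_smul] at e
    exact hne (sub_left_injective e).symm

/-- On horizontal vectors the functional `n` of the facet is `α X + β Y`. A slice of the facet
therefore lies on a line perpendicular to `(α, β)` that misses the axis, and angles along it
increase with the tangential coordinate `-β X + α Y`. -/
theorem exists_slice_coordinate [FiniteDimensional ℝ E] {F : Set E}
    (hF : IsFaceOfDim P 2 F) : ∃ h : E →ₗ[ℝ] ℝ,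
    (∀ w ∈ vectorSpan ℝ F, f w = 0 → h w = 0 → w = 0) ∧
    ∀ x ∈ F, ∀ y ∈ F, f x = f y → f x ∈ Ioo (f A.lo) (f A.hi) →
      (0 < cr (A.dir x) (A.dir y) ↔ h x < h y) := by
  obtain ⟨n, k, hn1, hn2, hnF⟩ := exists_functional_of_dim_lt hF (by rw [A.dim_eq]; omega)
  obtain ⟨α, β, hαβ⟩ := A.rep n
  have hFP := hF.subset
  have hν : ∀ x ∈ F, f x ∈ Ioo (f A.lo) (f A.hi) →
      0 < α * (A.dir x).1 + β * (A.dir x).2 := by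
    intro x hx hl
    have h1 := A.c_int n k hn1 hn2 _ hl
    have h2 := hαβ _ (A.sub_c_mem (hFP hx)) (A.f_sub_c (hFP hx))
    have h3 : n x = k := by rw [hnF] at hx; exact hx.2
    rw [map_sub n, h3] at h2
    simp only [dir]
    linarith
  have hspan : ∀ w ∈ vectorSpan ℝ F, n w = 0 := by
    intro w hw
    obtain ⟨p, hp⟩ := hF.1
    rw [vectorSpan_eq_span_vsub_set_right ℝ hp] at hw
    have : Submodule.span ℝ ((fun x => x -ᵥ p) '' F) ≤ LinearMap.ker n := by
      rw [Submodule.span_le]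
      rintro _ ⟨y, hy, rfl⟩
      rw [hnF] at hy hp
      simp [hy.2, hp.2]
    exact this hw
  -- `F` has a point on an inner level, where `hν` shows that `α` and `β` cannot both vanish.
  have hpos : 0 < α ^ 2 + β ^ 2 := by
    obtain ⟨x, hx, y, hy, hxy⟩ : F.Nontrivial := by
      by_contra h
      rw [Set.not_nontrivial_iff] at h
      have : dim F = 0 := by rw [dim, vectorSpan_of_subsingleton ℝ h, finrank_bot]
      have := hF.2.2
      omega
    obtain ⟨u, hu, v, hv, huv⟩ := A.poly.exists_lt_of_face A.gen hF.2.1 hx hy hxy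
    obtain ⟨z, hz, hzl⟩ := exists_mem_segment_level (f := f) (u := u) (v := v)
      (t := (f u + f v) / 2) (by linarith) (by linarith)
    have hzF : z ∈ F := (A.poly.of_isExposed hF.2.1).convex.segment_subset hu hv hz
    have := hν z hzF (by
      rw [hzl]
      constructor <;> linarith [A.lo_le u (hFP hu), A.le_hi v (hFP hv)])
    by_contra h
    have e1 : α = 0 := by nlinarith [sq_nonneg α, sq_nonneg β]
    have e2 : β = 0 := by nlinarith [sq_nonneg α, sq_nonneg β]
    simp [e1, e2] at this
  refine ⟨(-β) • A.X + α • A.Y, ?_, ?_⟩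
  · intro w hw hw0 hwh
    have hwP : w ∈ vectorSpan ℝ P := vectorSpan_mono ℝ hFP hw
    have h1 := hαβ w hwP hw0
    rw [hspan w hw] at h1
    simp only [LinearMap.add_apply, LinearMap.smul_apply, smul_eq_mul] at hwh
    apply A.inj w hwP hw0
    · apply mul_left_cancel₀ hpos.ne'
      linear_combination (-α) * h1 - β * hwh
    · apply mul_left_cancel₀ hpos.ne'
      linear_combination (-β) * h1 + α * hwh
  · intro x hx y hy hxy hl
    have hν' := hν x hx hl
    have h0 : α * (A.dir y).1 + β * (A.dir y).2 = α * (A.dir x).1 + β * (A.dir x).2 := by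
      have h1 := hαβ (y - x) (vsub_mem_vectorSpan ℝ (hFP hy) (hFP hx)) (by simp [hxy])
      rw [hspan (y - x) (vsub_mem_vectorSpan ℝ hy hx)] at h1
      simp only [dir, hxy, map_sub] at h1 ⊢
      linarith
    have key : (α ^ 2 + β ^ 2) * cr (A.dir x) (A.dir y) =
        (α * (A.dir x).1 + β * (A.dir x).2) *
          (((-β) • A.X + α • A.Y) y - ((-β) • A.X + α • A.Y) x) := by
      have e1 : A.X y - A.X x = (A.dir y).1 - (A.dir x).1 := by simp [dir, hxy]
      have e2 : A.Y y - A.Y x = (A.dir y).2 - (A.dir x).2 := by simp [dir, hxy]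
      have e3 : ((-β) • A.X + α • A.Y) y - ((-β) • A.X + α • A.Y) x =
          -β * (A.X y - A.X x) + α * (A.Y y - A.Y x) := by
        simp only [LinearMap.add_apply, LinearMap.smul_apply, smul_eq_mul]; ring
      rw [e3, e1, e2]
      unfold cr
      linear_combination (β * (A.dir x).1 - α * (A.dir x).2) * h0
    constructor
    · intro h
      have := mul_pos hpos h
      rw [key] at this
      exact sub_pos.1 ((mul_pos_iff_of_pos_left hν').1 this)
    · intro h
      have := mul_pos hν' (sub_pos.2 h)
      rw [← key] at this
      exact (mul_pos_iff_of_pos_left hpos).1 this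

end Frame

end MonotoneFlip

/-! ### End points and interiors of slices of facets. -/

namespace MonotoneFlip

open Set

variable {E : Type*} [NormedAddCommGroup E] [NormedSpace ℝ E]

theorem IsFaceOfDim.nontrivial {P F : Set E} {k : ℕ} (hF : IsFaceOfDim P k F) (hk : k ≠ 0) :
    F.Nontrivial := by
  by_contra h
  rw [Set.not_nontrivial_iff] at h
  have : dim F = 0 := by rw [dim, vectorSpan_of_subsingleton ℝ h, finrank_bot]
  exact hk (hF.2.2.symm.trans this)

/-- A two-dimensional convex set has two points on every level strictly between its extremes. -/
theorem exists_ne_of_alive {P F : Set E} {f : E →ₗ[ℝ] ℝ} (hF : IsFaceOfDim P 2 F)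
    (hconv : Convex ℝ F) {t : ℝ} (h : Alive f F t) : ∃ x ∈ F, ∃ y ∈ F, f x = t ∧ f y = t ∧ x ≠ y := by
  by_contra! hsub
  obtain ⟨⟨a, ha, hat⟩, b, hb, hbt⟩ := h
  obtain ⟨x, hx, hxt⟩ := exists_mem_segment_level hat.le hbt.le
  have hxF := hconv.segment_subset ha hb hx
  -- If the slice is the single point `x`, each segment of `F` crossing the level passes through
  -- `x`. Hence `F` lies on the line through `a` and `x` and has dimension at most one.
  have cross : ∀ u ∈ F, ∀ v ∈ F, f u < t → t < f v → ∃ s : ℝ, 0 < s ∧ v - x = s • (x - u) := by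
    intro u hu v hv hut hvt
    obtain ⟨w, hw, hwt⟩ := exists_mem_segment_level hut.le hvt.le
    have hwx := hsub w (hconv.segment_subset hu hv hw) x hxF hwt hxt
    rw [hwx, segment_eq_image'] at hw
    obtain ⟨s, ⟨h0, h1⟩, hs⟩ := hw
    have e1 := congrArg f hs
    simp only [map_add, map_smul, map_sub, smul_eq_mul] at e1
    have hs0 : 0 < s := by
      rcases h0.eq_or_lt with h | h
      · rw [← h] at e1; linarith
      · exact h
    have hs1 : s < 1 := by
      rcases h1.eq_or_lt with h | h
      · rw [h] at e1; linarith
      · exact h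
    refine ⟨(1 - s) / s, div_pos (by linarith) hs0, ?_⟩
    have e2 : x - u = s • (v - u) := by rw [← hs]; exact add_sub_cancel_left _ _
    rw [e2, smul_smul, div_mul_cancel₀ _ hs0.ne', ← hs]
    module
  obtain ⟨r, hr, hrb⟩ := cross a ha b hb hat hbt
  have hline : ∀ y ∈ F, y - x ∈ Submodule.span ℝ {x - a} := by
    intro y hy
    rcases lt_trichotomy (f y) t with h | h | h
    · obtain ⟨s, hs, hsb⟩ := cross y hy b hb h hbt
      rw [Submodule.mem_span_singleton]
      refine ⟨-(r / s), ?_⟩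
      have : x - y = (r / s) • (x - a) := by
        rw [div_eq_inv_mul, mul_smul, ← hrb, hsb, smul_smul, inv_mul_cancel₀ hs.ne', one_smul]
      rw [neg_smul, ← this]
      abel
    · rw [hsub y hy x hxF h hxt, sub_self]
      exact Submodule.zero_mem _
    · obtain ⟨s, -, hs⟩ := cross a ha y hy hat h
      rw [hs]
      exact Submodule.smul_mem _ _ (Submodule.mem_span_singleton_self _)
  have hle : vectorSpan ℝ F ≤ Submodule.span ℝ {x - a} := by
    rw [vectorSpan_eq_span_vsub_set_right ℝ hxF, Submodule.span_le]
    rintro _ ⟨y, hy, rfl⟩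
    exact hline y hy
  have h2 := hF.2.2
  have hxa : x - a ≠ 0 := by
    intro h
    rw [sub_eq_zero] at h
    rw [← h, hxt] at hat
    exact hat.false
  have hfin : FiniteDimensional ℝ (Submodule.span ℝ {x - a}) := inferInstance
  have := Submodule.finrank_mono hle
  rw [finrank_span_singleton hxa] at this
  unfold dim at h2
  omega

namespace Frame

variable {P : Set E} {f : E →ₗ[ℝ] ℝ} (A : Frame P f)

theorem facet_functional (A : Frame P f) {F : Set E} (hF : IsFaceOfDim P 2 F) :
    ∃ (l : E →ₗ[ℝ] ℝ) (a : ℝ), (∀ y ∈ P, l y ≤ a) ∧ (∃ y ∈ P, l y < a) ∧ F = {x ∈ P | l x = a} :=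
  exists_functional_of_dim_lt hF (by rw [A.dim_eq]; omega)

theorem facet_onBoundary (A : Frame P f) {F : Set E} (hF : IsFaceOfDim P 2 F) {x : E} (hx : x ∈ F) :
    OnBoundary P x := hF.onBoundary (by rw [A.dim_eq]; omega) hx

theorem facet_convex (A : Frame P f) {F : Set E} (hF : IsFaceOfDim P 2 F) : Convex ℝ F :=
  (A.poly.of_isExposed hF.2.1).convex

/-- A boundary point outside a facet lies on the far side of the facet's slice. -/
theorem ccw_lt_rt {F : Set E} (hF : IsFaceOfDim P 2 F) {p q x : E} (hp : A.Rt F p) (hq : A.Lt F q)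
    (hpx : f p = f x) (hqx : f q = f x) (hpq : 0 < cr (A.dir p) (A.dir q)) (hx : OnBoundary P x)
    (hl : f x ∈ Ioo (f A.lo) (f A.hi)) (hxF : x ∉ F) : Ccw (A.dir q) (A.dir x) (A.dir p) := by
  by_contra hcon
  have c1 : ¬ 0 < cr (A.dir q) (A.dir x) := fun h => hcon (Or.inr (Or.inr ⟨hpq, h⟩))
  have c2 : ¬ 0 < cr (A.dir x) (A.dir p) := fun h => hcon (Or.inr (Or.inl ⟨h, hpq⟩))
  have hFP := hF.subset
  -- If the claim fails, `x` lies in the cone over the slice, and `a`, `b` are its nonnegative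
  -- Cramer coefficients. The facet functional gives `a + b < 1`; then a functional supporting `P`
  -- at `x` is too small there.
  set a := cr (A.dir x) (A.dir q) / cr (A.dir p) (A.dir q) with ha
  set b := cr (A.dir p) (A.dir x) / cr (A.dir p) (A.dir q) with hb
  have ha0 : 0 ≤ a := div_nonneg (by rw [cr_swap]; linarith) hpq.le
  have hb0 : 0 ≤ b := div_nonneg (by rw [cr_swap]; linarith) hpq.le
  have ea : a * cr (A.dir p) (A.dir q) = cr (A.dir x) (A.dir q) := div_mul_cancel₀ _ hpq.ne'
  have eb : b * cr (A.dir p) (A.dir q) = cr (A.dir p) (A.dir x) := div_mul_cancel₀ _ hpq.ne'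
  have e := A.eq_smul_add_smul hx.1 (hFP hp.1) (hFP hq.1) hpx hqx (a := a) (b := b) (by
      apply mul_right_cancel₀ hpq.ne'
      rw [add_mul, mul_right_comm, ea, mul_right_comm, eb]
      unfold cr; ring) (by
      apply mul_right_cancel₀ hpq.ne'
      rw [add_mul, mul_right_comm, ea, mul_right_comm, eb]
      unfold cr; ring)
  obtain ⟨n, k, hn1, hn2, hnF⟩ := A.facet_functional hF
  have hnc := A.c_int n k hn1 hn2 _ hl
  have hp1 := hp.1
  have hq1 := hq.1
  rw [hnF] at hp1 hq1
  have en := congrArg n e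
  rw [map_sub, map_add, map_smul, map_smul, map_sub, map_sub, hp1.2, hq1.2, smul_eq_mul,
    smul_eq_mul] at en
  have hnx : n x < k := lt_of_le_of_ne (hn1 x hx.1) fun h => hxF (by rw [hnF]; exact ⟨hx.1, h⟩)
  have hab : a + b < 1 := by nlinarith
  obtain ⟨hxP, l, m, hl1, hl2, hl3⟩ := hx
  have hlc := A.c_int l m hl1 hl2 _ hl
  have el := congrArg l e
  rw [map_sub, map_add, map_smul, map_smul, map_sub, map_sub, smul_eq_mul, smul_eq_mul, hl3] at el
  have i1 := mul_le_mul_of_nonneg_left (hl1 p (hFP hp.1)) ha0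
  have i2 := mul_le_mul_of_nonneg_left (hl1 q (hFP hq.1)) hb0
  nlinarith

variable [FiniteDimensional ℝ E]

/-- The slice of a facet is contained in a line. -/
theorem slice_collinear (A : Frame P f) {F : Set E} (hF : IsFaceOfDim P 2 F) {x y w : E}
    (hx : x ∈ F) (hy : y ∈ F)
    (hw : w ∈ F) (hxy : f x = f y) (hxw : f x = f w) (hne : x ≠ y) :
    ∃ s : ℝ, w - x = s • (y - x) := by
  obtain ⟨h, h1, -⟩ := A.exists_slice_coordinate hF
  have m1 : y - x ∈ vectorSpan ℝ F := vsub_mem_vectorSpan ℝ hy hx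
  have m2 : w - x ∈ vectorSpan ℝ F := vsub_mem_vectorSpan ℝ hw hx
  have h0 : h (y - x) ≠ 0 := fun e => hne (sub_eq_zero.1 (h1 _ m1 (by simp [hxy]) e)).symm
  refine ⟨h (w - x) / h (y - x), ?_⟩
  rw [← sub_eq_zero]
  apply h1 _ (Submodule.sub_mem _ m2 (Submodule.smul_mem _ _ m1))
  · simp [hxy, ← hxw]
  · rw [map_sub h, map_smul h, smul_eq_mul, div_mul_cancel₀ _ h0, sub_self]

theorem slice_eq_of_cr {F : Set E} (hF : IsFaceOfDim P 2 F) {x y : E} (hx : x ∈ F) (hy : y ∈ F)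
    (hxy : f x = f y) (hl : f x ∈ Ioo (f A.lo) (f A.hi)) (h0 : cr (A.dir x) (A.dir y) = 0) :
    x = y := by
  obtain ⟨h, h1, h2⟩ := A.exists_slice_coordinate hF
  have e1 : ¬ h x < h y := fun hh => by
    have := (h2 x hx y hy hxy hl).2 hh
    linarith
  have e2 : ¬ h y < h x := fun hh => by
    have := (h2 y hy x hx hxy.symm (hxy ▸ hl)).2 hh
    rw [cr_swap] at this
    linarith
  have := h1 (x - y) (vsub_mem_vectorSpan ℝ hx hy) (by simp [hxy])
    (by rw [map_sub]; linarith [not_lt.1 e1, not_lt.1 e2])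
  exact sub_eq_zero.1 this

theorem Rt.unique {F : Set E} (hF : IsFaceOfDim P 2 F) {x y : E} (hx : A.Rt F x) (hy : A.Rt F y)
    (hxy : f x = f y) (hl : f x ∈ Ioo (f A.lo) (f A.hi)) : x = y := by
  apply A.slice_eq_of_cr hF hx.1 hy.1 hxy hl
  have h1 := hx.2 y hy.1 hxy.symm
  have h2 := hy.2 x hx.1 hxy
  rw [cr_swap] at h2
  linarith

theorem Lt.unique {F : Set E} (hF : IsFaceOfDim P 2 F) {x y : E} (hx : A.Lt F x) (hy : A.Lt F y)
    (hxy : f x = f y) (hl : f x ∈ Ioo (f A.lo) (f A.hi)) : x = y := by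
  apply A.slice_eq_of_cr hF hx.1 hy.1 hxy hl
  have h1 := hx.2 y hy.1 hxy.symm
  have h2 := hy.2 x hx.1 hxy
  rw [cr_swap] at h1
  linarith

theorem exists_rt_lt {F : Set E} (hF : IsFaceOfDim P 2 F) {x : E} (hx : x ∈ F)
    (hl : f x ∈ Ioo (f A.lo) (f A.hi)) :
    ∃ p q, A.Rt F p ∧ A.Lt F q ∧ f p = f x ∧ f q = f x := by
  obtain ⟨h, -, h2⟩ := A.exists_slice_coordinate hF
  have hcomp : IsCompact (F ∩ f ⁻¹' {f x}) :=
    (A.poly.of_isExposed hF.2.1).isCompact.inter_right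
      (isClosed_singleton.preimage (LinearMap.continuous_of_finiteDimensional f))
  have hcont : ContinuousOn h (F ∩ f ⁻¹' {f x}) :=
    (LinearMap.continuous_of_finiteDimensional h).continuousOn
  obtain ⟨p, ⟨hp, hpx⟩, hpmin⟩ := hcomp.exists_isMinOn ⟨x, hx, rfl⟩ hcont
  obtain ⟨q, ⟨hq, hqx⟩, hqmax⟩ := hcomp.exists_isMaxOn ⟨x, hx, rfl⟩ hcont
  have hpx' : f p = f x := hpx
  have hqx' : f q = f x := hqx
  refine ⟨p, q, ⟨hp, fun y hy hyp => ?_⟩, ⟨hq, fun y hy hyq => ?_⟩, hpx, hqx⟩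
  · by_contra hneg
    rw [not_le, ← neg_pos, ← cr_swap] at hneg
    have h3 := (h2 y hy p hp hyp (by rw [hyp, hpx']; exact hl)).1 hneg
    have h4 : h p ≤ h y := hpmin ⟨hy, hyp.trans hpx'⟩
    linarith
  · by_contra hneg
    rw [not_le, ← neg_pos, ← cr_swap] at hneg
    have h3 := (h2 q hq y hy hyq.symm (by rw [hqx']; exact hl)).1 hneg
    have h4 : h y ≤ h q := hqmax ⟨hy, hyq.trans hqx'⟩
    linarith

/-- On a level where the facet is alive its slice is a nondegenerate segment. -/
theorem exists_ends {F : Set E} (hF : IsFaceOfDim P 2 F) {t : ℝ} (h : Alive f F t) :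
    ∃ p q z, A.Rt F p ∧ A.Lt F q ∧ A.OS F z ∧ f p = t ∧ f q = t ∧ f z = t ∧
      0 < cr (A.dir p) (A.dir q) := by
  have hl := A.alive_level hF.subset h
  obtain ⟨x, hx, y, hy, hxt, hyt, hne⟩ := exists_ne_of_alive hF (A.facet_convex hF) h
  obtain ⟨p, q, hp, hq, hpt, hqt⟩ := A.exists_rt_lt hF hx (hxt ▸ hl)
  rw [hxt] at hpt hqt
  have hpq : 0 < cr (A.dir p) (A.dir q) := by
    refine lt_of_le_of_ne (hp.2 q hq.1 (hqt.trans hpt.symm)) fun h0 => hne ?_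
    have e := A.slice_eq_of_cr hF hp.1 hq.1 (hpt.trans hqt.symm) (hpt ▸ hl) h0.symm
    rw [← e] at hq
    have : ∀ z ∈ F, f z = t → p = z := fun z hz hzt => by
      apply A.slice_eq_of_cr hF hp.1 hz (hpt.trans hzt.symm) (hpt ▸ hl)
      have h1 := hp.2 z hz (hzt.trans hpt.symm)
      have h2 := hq.2 z hz (hzt.trans hpt.symm)
      rw [cr_swap] at h2
      linarith
    rw [← this x hx hxt, ← this y hy hyt]
  obtain ⟨h, -, h2⟩ := A.exists_slice_coordinate hF
  have hh := (h2 p hp.1 q hq.1 (hpt.trans hqt.symm) (hpt ▸ hl)).1 hpq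
  have hz : (1 / 2 : ℝ) • p + (1 / 2 : ℝ) • q ∈ F :=
    A.facet_convex hF hp.1 hq.1 (by norm_num) (by norm_num) (by norm_num)
  have hzt : f ((1 / 2 : ℝ) • p + (1 / 2 : ℝ) • q) = t := by
    simp only [map_add, map_smul, smul_eq_mul, hpt, hqt]; ring
  have hzh : h ((1 / 2 : ℝ) • p + (1 / 2 : ℝ) • q) = 1 / 2 * h p + 1 / 2 * h q := by
    simp only [map_add, map_smul, smul_eq_mul]
  refine ⟨p, q, _, hp, hq, ⟨hz, p, hp.1, q, hq.1, hpt.trans hzt.symm, hqt.trans hzt.symm, ?_, ?_⟩,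
    hpt, hqt, hzt, hpq⟩
  · rw [h2 p hp.1 _ hz (hpt.trans hzt.symm) (hpt ▸ hl), hzh]
    linarith
  · rw [h2 _ hz q hq.1 (hzt.trans hqt.symm) (hzt ▸ hl), hzh]
    linarith

/-- An exposed face that meets the interior of a slice of `F` contains the ends of a subsegment. -/
theorem OS.exists_between {F : Set E} (hF : IsFaceOfDim P 2 F) {z : E} (hz : A.OS F z)
    (hl : f z ∈ Ioo (f A.lo) (f A.hi)) : ∃ y₁ ∈ F, ∃ y₂ ∈ F, f y₁ = f z ∧ f y₂ = f z ∧ y₁ ≠ y₂ ∧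
      z ∈ openSegment ℝ y₁ y₂ := by
  obtain ⟨hzF, y₁, hy₁, y₂, hy₂, e₁, e₂, c₁, c₂⟩ := hz
  obtain ⟨h, h1, h2⟩ := A.exists_slice_coordinate hF
  have i₁ := (h2 y₁ hy₁ z hzF e₁ (e₁ ▸ hl)).1 c₁
  have i₂ := (h2 z hzF y₂ hy₂ e₂.symm hl).1 c₂
  have hne : y₁ ≠ y₂ := by
    rintro rfl
    linarith
  obtain ⟨s, hs⟩ := A.slice_collinear hF hy₁ hy₂ hzF (e₁.trans e₂.symm) e₁ hne
  refine ⟨y₁, hy₁, y₂, hy₂, e₁, e₂, hne, ?_⟩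
  have := congrArg h hs
  simp only [map_sub, map_smul, smul_eq_mul] at this
  rw [openSegment_eq_image']
  refine ⟨s, ⟨?_, ?_⟩, ?_⟩
  · by_contra hneg
    nlinarith
  · by_contra hneg
    nlinarith
  · simp only [← hs]; abel

/-- An edge is an extreme set, so together with `z` it would contain two distinct points of the same
level, while `f` is injective on edges. -/
theorem OS.not_mem_edge {F : Set E} (hF : IsFaceOfDim P 2 F) {z : E} (hz : A.OS F z)
    (hl : f z ∈ Ioo (f A.lo) (f A.hi)) {u v : E} (he : IsEdge P u v) : z ∉ segment ℝ u v := by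
  intro hzs
  obtain ⟨y₁, hy₁, y₂, hy₂, e₁, e₂, hne, hmem⟩ := hz.exists_between A hF hl
  have h1 := he.2.1.isExtreme.left_mem_of_mem_openSegment (hF.subset hy₁) (hF.subset hy₂) hzs hmem
  have h2 := he.2.1.isExtreme.right_mem_of_mem_openSegment (hF.subset hy₁) (hF.subset hy₂) hzs hmem
  exact hne (IsPolytope.injOn_edge A.gen he h1 h2 (e₁.trans e₂.symm))

/-- Two facets sharing an interior point of a slice on which one is alive are equal. -/
theorem OS.facet_eq {F H : Set E} (hF : IsFaceOfDim P 2 F) (hH : IsFaceOfDim P 2 H) {z : E}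
    (hz : A.OS H z) (hal : Alive f H (f z)) (hzF : z ∈ F) : H = F := by
  have hl := A.alive_level hH.subset hal
  obtain ⟨y₁, hy₁, y₂, hy₂, e₁, e₂, hne, hmem⟩ := hz.exists_between A hH hl
  have i₁ := hF.2.1.isExtreme.left_mem_of_mem_openSegment (hH.subset hy₁) (hH.subset hy₂) hzF hmem
  have i₂ := hF.2.1.isExtreme.right_mem_of_mem_openSegment (hH.subset hy₁) (hH.subset hy₂) hzF hmem
  obtain ⟨n, k, hn1, -, hnF⟩ := A.facet_functional hF
  have n₁ : n y₁ = k := by rw [hnF] at i₁; exact i₁.2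
  have n₂ : n y₂ = k := by rw [hnF] at i₂; exact i₂.2
  have hlev : ∀ w ∈ H, f w = f z → n w = k := by
    intro w hw hwz
    obtain ⟨s, hs⟩ := A.slice_collinear hH hy₁ hy₂ hw (e₁.trans e₂.symm) (e₁.trans hwz.symm) hne
    have := congrArg n hs
    rw [map_sub, map_smul, map_sub, n₁, n₂] at this
    simp only [sub_self, smul_zero] at this
    linarith
  -- A segment of `H` crossing the level of `z` meets the slice at an inner point. There `n` is
  -- maximal over `P`, so it is maximal at both ends.
  have cross : ∀ u ∈ H, ∀ v ∈ H, f u < f z → f z < f v → n u = k ∧ n v = k := by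
    intro u hu v hv huz hvz
    obtain ⟨w, hw, hwz⟩ := exists_mem_segment_level huz.le hvz.le
    have hwH := (A.facet_convex hH).segment_subset hu hv hw
    have hwo : w ∈ openSegment ℝ u v := by
      apply mem_openSegment_of_ne_left_right _ _ hw
      · rintro rfl; linarith
      · rintro rfl; linarith
    obtain ⟨a, b, ha, hb, hab, he⟩ := hwo
    exact functional_eq_of_mem_segment hn1 (hH.subset hu) (hH.subset hv) ha hb hab he.symm
      (hlev w hwH hwz)
  have hsub : H ⊆ F := by
    intro w hw
    rw [hnF]
    refine ⟨hH.subset hw, ?_⟩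
    obtain ⟨⟨a, ha, haz⟩, b, hb, hbz⟩ := hal
    rcases lt_trichotomy (f w) (f z) with h | h | h
    · exact (cross w hw b hb h hbz).1
    · exact hlev w hw h
    · exact (cross a ha w hw haz h).2
  obtain ⟨m, c, hm1, -, hmH⟩ := A.facet_functional hH
  -- Equal dimensions turn the inclusion of directions into an equality, so the functional `m` of
  -- `H` is constant on `F` as well.
  have hspan : vectorSpan ℝ H = vectorSpan ℝ F :=
    Submodule.eq_of_le_of_finrank_eq (vectorSpan_mono ℝ hsub)
      (hH.2.2.trans hF.2.2.symm)
  apply Subset.antisymm hsub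
  intro w hw
  have hker : vectorSpan ℝ H ≤ LinearMap.ker m := by
    rw [vectorSpan_eq_span_vsub_set_right ℝ hz.1, Submodule.span_le]
    rintro _ ⟨y, hy, rfl⟩
    have hz1 := hz.1
    rw [hmH] at hy hz1
    simp [hy.2, hz1.2]
  have hwz : w - z ∈ vectorSpan ℝ H := hspan ▸ vsub_mem_vectorSpan ℝ hw (hsub hz.1)
  have h0 : m (w - z) = 0 := hker hwz
  have hz1 := hz.1
  rw [hmH] at hz1 ⊢
  refine ⟨hF.subset hw, ?_⟩
  rw [map_sub, hz1.2] at h0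
  linarith

theorem ccw_rt_os_lt {F : Set E} (hF : IsFaceOfDim P 2 F) {p q z : E} (hp : A.Rt F p)
    (hq : A.Lt F q) (hz : A.OS F z) (hpz : f p = f z) (hqz : f q = f z)
    (hl : f z ∈ Ioo (f A.lo) (f A.hi)) : Ccw (A.dir p) (A.dir z) (A.dir q) := by
  obtain ⟨hzF, y₁, hy₁, y₂, hy₂, e₁, e₂, c₁, c₂⟩ := hz
  left
  constructor
  · refine lt_of_le_of_ne (hp.2 z hzF hpz.symm) fun h0 => ?_
    have := A.slice_eq_of_cr hF hp.1 hzF hpz (hpz ▸ hl) h0.symm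
    rw [← this, cr_swap] at c₁
    have := hp.2 y₁ hy₁ (e₁.trans hpz.symm)
    linarith
  · refine lt_of_le_of_ne (hq.2 z hzF hqz.symm) fun h0 => ?_
    have := A.slice_eq_of_cr hF hzF hq.1 hqz.symm hl h0.symm
    rw [this, cr_swap] at c₂
    have := hq.2 y₂ hy₂ (e₂.trans hqz.symm)
    linarith

/-- From the right end of an alive facet, its interior comes before every other boundary point. -/
theorem ccw_rt_os {F : Set E} (hF : IsFaceOfDim P 2 F) {p z x : E} (hp : A.Rt F p)
    (hz : A.OS F z) (hal : Alive f F (f z)) (hpz : f p = f z) (hxz : f x = f z)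
    (hx : OnBoundary P x) (hxp : x ≠ p) (hxo : ¬ A.OS F x) :
    Ccw (A.dir p) (A.dir z) (A.dir x) := by
  have hl := A.alive_level hF.subset hal
  obtain ⟨p', q, z', hp', hq, -, hpt, hqt, -, hpq⟩ := A.exists_ends hF hal
  obtain rfl := hp'.unique A hF hp (hpt.trans hpz.symm) (hpt ▸ hl)
  have h1 := A.ccw_rt_os_lt hF hp hq hz hpz hqt hl
  by_cases hxF : x ∈ F
  · rcases A.rt_or_lt_or_os hxF with h | h | h
    · exact absurd (h.unique A hF hp (hxz.trans hpz.symm) (hxz ▸ hl)) hxp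
    · rwa [h.unique A hF hq (hxz.trans hqt.symm) (hxz ▸ hl)]
    · exact absurd h hxo
  · have h2 := A.ccw_lt_rt hF hp hq (hpz.trans hxz.symm) (hqt.trans hxz.symm) hpq hx (hxz ▸ hl) hxF
    exact h1.trans h2.rotate.rotate

/-- If the facets were distinct, then counterclockwise from the common right end the interior of
each slice would come before that of the other. -/
theorem Rt.facet_eq {F G : Set E} (hF : IsFaceOfDim P 2 F) (hG : IsFaceOfDim P 2 G) {x : E}
    (hFx : A.Rt F x) (hGx : A.Rt G x) (hFa : Alive f F (f x)) (hGa : Alive f G (f x)) : F = G := by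
  by_contra hne
  obtain ⟨-, -, z, -, -, hz, -, -, hzx, -⟩ := A.exists_ends hF hFa
  obtain ⟨-, -, w, -, -, hw, -, -, hwx, -⟩ := A.exists_ends hG hGa
  have hzG : z ∉ G := fun h => hne (hz.facet_eq A hG hF (hzx ▸ hFa) h)
  have hwF : w ∉ F := fun h => hne (hw.facet_eq A hF hG (hwx ▸ hGa) h).symm
  have hwb := A.facet_onBoundary hG hw.1
  have hzb := A.facet_onBoundary hF hz.1
  have h1 := A.ccw_rt_os hF hFx hz (hzx ▸ hFa) hzx.symm (hwx.trans hzx.symm) hwb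
    (fun h => hwF (h ▸ hFx.1)) (fun h => hwF h.1)
  have h2 := A.ccw_rt_os hG hGx hw (hwx ▸ hGa) hwx.symm (hzx.trans hwx.symm) hzb
    (fun h => hzG (h ▸ hGx.1)) (fun h => hzG h.1)
  exact h1.asymm h2

end Frame

end MonotoneFlip

/-! ### The facet to the left of an edge. -/

namespace MonotoneFlip

open Set

variable {E : Type*} [NormedAddCommGroup E] [NormedSpace ℝ E] [FiniteDimensional ℝ E]

namespace Frame

variable {P : Set E} {f : E →ₗ[ℝ] ℝ}

set_option maxHeartbeats 1000000 in
/-- Every edge bounds a facet on its left. -/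
theorem exists_left_facet (A : Frame P f) {u v : E} (he : IsEdge P u v) (huv : f u < f v) :
    ∃ F, IsFaceOfDim P 2 F ∧ ∀ z ∈ segment ℝ u v, A.Rt F z := by
  obtain ⟨V, hV, hPV⟩ := A.poly
  have hVP : V ⊆ P := hPV ▸ subset_convexHull ℝ V
  obtain ⟨l, k, hl1, hl2, hlE⟩ := exists_functional_of_dim_lt he (by rw [A.dim_eq]; omega)
  have huP := he.left_mem
  have hvP := he.right_mem
  have hlu : l u = k := by
    have : u ∈ segment ℝ u v := left_mem_segment ℝ u v
    rw [hlE] at this; exact this.2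
  have hlv : l v = k := by
    have : v ∈ segment ℝ u v := right_mem_segment ℝ u v
    rw [hlE] at this; exact this.2
  have hfpos : 0 < f v - f u := sub_pos.2 huv
  set δ : E := (f v - f u)⁻¹ • (v - u) with hδ
  have hδm : δ ∈ vectorSpan ℝ P := Submodule.smul_mem _ _ (vsub_mem_vectorSpan ℝ hvP huP)
  have hfδ : f δ = 1 := by
    rw [hδ, map_smul, map_sub, smul_eq_mul, inv_mul_cancel₀ hfpos.ne']
  have hlδ : l δ = 0 := by rw [hδ, map_smul, map_sub, hlv, hlu, sub_self, smul_zero]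
  -- Projection along the edge onto the horizontal plane: `(px, py)` sends the edge to the origin,
  -- and `l - k` becomes the linear form `α px + β py`, negative on `P` off the edge.
  set px : E → ℝ := fun y => A.X (y - u) - (f y - f u) * A.X δ with hpx
  set py : E → ℝ := fun y => A.Y (y - u) - (f y - f u) * A.Y δ with hpy
  obtain ⟨α, β, hαβ⟩ := A.rep l
  have hlp : ∀ y ∈ P, l y - k = α * px y + β * py y := by
    intro y hy
    have := hαβ (y - u - (f y - f u) • δ) (Submodule.sub_mem _ (vsub_mem_vectorSpan ℝ hy huP)
      (Submodule.smul_mem _ _ hδm)) (by simp [hfδ])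
    rw [map_sub l, map_sub l, map_smul l, hlδ, hlu, smul_zero, sub_zero, map_sub A.X, map_sub A.Y,
      map_smul A.X, map_smul A.Y, smul_eq_mul, smul_eq_mul] at this
    exact this
  have hseg : ∀ z ∈ segment ℝ u v, px z = 0 ∧ py z = 0 := by
    intro z hz
    rw [segment_eq_image'] at hz
    obtain ⟨s, -, rfl⟩ := hz
    simp only [hpx, hpy, hδ, map_add, map_smul, map_sub, smul_eq_mul]
    constructor <;> field_simp <;> ring
  have hVlt : ∃ y ∈ V, l y < k := by
    by_contra! hcon
    obtain ⟨y, hy, hyk⟩ := hl2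
    rw [hPV] at hy
    have := functional_le_of_convexHull (-l) (k := -k) (fun v hv => by simpa using hcon v hv) y hy
    simp only [LinearMap.neg_apply] at this
    linarith
  -- The projected generators off the edge lie in an open half-plane. The maximal ratio of
  -- tangential coordinate to depth picks the clockwise-most ray among them; the facet is spanned by
  -- the edge and `y₀`.
  obtain ⟨y₀, ⟨hy₀V, hy₀⟩, hmax⟩ := Set.exists_max_image {y ∈ V | l y < k}
    (fun y => (-β * px y + α * py y) / (k - l y)) (hV.subset fun _ h => h.1)
    (by obtain ⟨y, hy, h⟩ := hVlt; exact ⟨y, hy, h⟩)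
  have hy₀P := hVP hy₀V
  have hl₀ := hlp y₀ hy₀P
  have hpos : 0 < α ^ 2 + β ^ 2 := by
    by_contra h
    have e1 : α = 0 := by nlinarith [sq_nonneg α, sq_nonneg β]
    have e2 : β = 0 := by nlinarith [sq_nonneg α, sq_nonneg β]
    rw [e1, e2] at hl₀
    linarith
  have hω : ∀ y ∈ V, 0 ≤ px y₀ * py y - py y₀ * px y := by
    intro y hy
    have hly := hlp y (hVP hy)
    rcases (hl1 y (hVP hy)).eq_or_lt with h | h
    · have : y ∈ segment ℝ u v := by rw [hlE]; exact ⟨hVP hy, h⟩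
      rw [(hseg y this).1, (hseg y this).2]
      simp
    · have h1 := hmax y ⟨hy, h⟩
      rw [div_le_div_iff₀ (by linarith) (by linarith)] at h1
      have key : (α ^ 2 + β ^ 2) * (px y₀ * py y - py y₀ * px y) =
          (-β * px y₀ + α * py y₀) * (k - l y) - (-β * px y + α * py y) * (k - l y₀) := by
        have i1 : k - l y = -(α * px y + β * py y) := by linarith
        have i2 : k - l y₀ = -(α * px y₀ + β * py y₀) := by linarith
        rw [i1, i2]
        ring
      by_contra hneg
      have := mul_neg_of_pos_of_neg hpos (not_le.1 hneg)
      linarith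
  set d₁ := px y₀ with hd₁
  set d₂ := py y₀ with hd₂
  set n : E →ₗ[ℝ] ℝ := d₂ • (A.X - A.X δ • f) - d₁ • (A.Y - A.Y δ • f) with hn
  have hnval : ∀ y, n y - n u = d₂ * px y - d₁ * py y := by
    intro y
    simp only [hn, hpx, hpy, LinearMap.sub_apply, LinearMap.smul_apply, smul_eq_mul, map_sub]
    ring
  have hnle : ∀ y ∈ P, n y ≤ n u := by
    intro y hy
    rw [hPV] at hy
    refine functional_le_of_convexHull n (fun v hv => ?_) y hy
    have := hω v hv
    have := hnval v
    linarith
  have hd : 0 < d₁ ^ 2 + d₂ ^ 2 := by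
    by_contra h
    have e1 : d₁ = 0 := by nlinarith [sq_nonneg d₁, sq_nonneg d₂]
    have e2 : d₂ = 0 := by nlinarith [sq_nonneg d₁, sq_nonneg d₂]
    rw [e1, e2] at hl₀
    linarith
  set F : Set E := {x ∈ P | n x = n u} with hFdef
  have hsegF : ∀ z ∈ segment ℝ u v, z ∈ F := by
    intro z hz
    refine ⟨he.subset hz, ?_⟩
    have := hnval z
    rw [(hseg z hz).1, (hseg z hz).2] at this
    linarith
  have huF := hsegF u (left_mem_segment ℝ u v)
  have hvF := hsegF v (right_mem_segment ℝ u v)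
  have hy₀F : y₀ ∈ F := ⟨hy₀P, by
    have := hnval y₀
    rw [← hd₁, ← hd₂] at this
    linarith⟩
  have hdimF : dim F = 2 := by
    apply le_antisymm
    · have hker : vectorSpan ℝ F ≤ LinearMap.ker n := by
        rw [vectorSpan_eq_span_vsub_set_right ℝ huF, Submodule.span_le]
        rintro _ ⟨y, hy, rfl⟩
        simp [hy.2]
      have hlt : vectorSpan ℝ F < vectorSpan ℝ P := by
        refine lt_of_le_of_ne (vectorSpan_mono ℝ fun x hx => hx.1) fun heq => ?_
        obtain ⟨w, hw, hw1, hw2, hw3⟩ := A.surj d₂ (-d₁)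
        rw [← heq] at hw
        have : n w = 0 := hker hw
        simp only [hn, LinearMap.sub_apply, LinearMap.smul_apply, smul_eq_mul, hw1, hw2, hw3]
          at this
        linarith
      have h3 := Submodule.finrank_lt_finrank_of_lt hlt
      have h4 := A.dim_eq
      unfold dim at h4 ⊢
      omega
    · have hli : LinearIndependent ℝ ![v - u, y₀ - u] := by
        rw [LinearIndependent.pair_iff]
        intro s t hst
        have h1 := congrArg l hst
        rw [map_add, map_smul, map_smul, map_sub, map_sub, hlv, hlu, sub_self, smul_zero, zero_add,
          map_zero, smul_eq_mul] at h1
        have ht : t = 0 := (mul_eq_zero.1 h1).resolve_right (by linarith)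
        rw [ht, zero_smul, add_zero] at hst
        exact ⟨(smul_eq_zero.1 hst).resolve_right (sub_ne_zero.2 he.ne.symm), ht⟩
      have hc := finrank_span_eq_card hli
      have hle : Submodule.span ℝ (Set.range ![v - u, y₀ - u]) ≤ vectorSpan ℝ F := by
        rw [Submodule.span_le]
        rintro _ ⟨i, rfl⟩
        fin_cases i
        · exact vsub_mem_vectorSpan ℝ hvF huF
        · exact vsub_mem_vectorSpan ℝ hy₀F huF
      have := Submodule.finrank_mono hle
      rw [hc] at this
      simpa [dim] using this
  refine ⟨F, ⟨⟨u, huF⟩, isExposed_of_functional n _ hnle, hdimF⟩, fun z hz => ⟨hsegF z hz, ?_⟩⟩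
  intro y hy hyz
  obtain ⟨z1, z2⟩ := hseg z hz
  have hzP := he.subset hz
  have hcP := A.c_mem _ (A.level_mem hzP)
  have hfc := A.f_c _ (A.level_mem hzP)
  have hnc := hnle _ hcP
  have hnc' := hnval (A.c (f z))
  have hny := hnval y
  rw [hy.2, sub_self] at hny
  have hly := hlp y hy.1
  -- On `F` the projection takes values on the ray of `y₀`, and `r` is the factor. The sign of the
  -- determinant then follows from `n` being at most `n u` on the axis.
  set r := (k - l y) / (k - l y₀) with hr
  have hr0 : 0 ≤ r := div_nonneg (by linarith [hl1 y hy.1]) (by linarith)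
  have hrm : r * (k - l y₀) = k - l y := div_mul_cancel₀ _ (by linarith)
  have hne : k - l y₀ ≠ 0 := by linarith
  have ex : px y = r * d₁ := by
    apply mul_right_cancel₀ hne
    rw [mul_right_comm, hrm]
    have i1 : k - l y = -(α * px y + β * py y) := by linarith
    have i2 : k - l y₀ = -(α * d₁ + β * d₂) := by linarith
    rw [i1, i2]
    linear_combination β * hny
  have ey : py y = r * d₂ := by
    apply mul_right_cancel₀ hne
    rw [mul_right_comm, hrm]
    have i1 : k - l y = -(α * px y + β * py y) := by linarith
    have i2 : k - l y₀ = -(α * d₁ + β * d₂) := by linarith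
    rw [i1, i2]
    linear_combination -α * hny
  have hcr : cr (A.dir z) (A.dir y) = -(r * (d₂ * px (A.c (f z)) - d₁ * py (A.c (f z)))) := by
    have a1 : (A.dir z).1 = -px (A.c (f z)) := by
      simp only [hpx, map_sub, hfc] at z1 ⊢
      simp only [dir, map_sub]
      linarith
    have a2 : (A.dir z).2 = -py (A.c (f z)) := by
      simp only [hpy, map_sub, hfc] at z2 ⊢
      simp only [dir, map_sub]
      linarith
    have b1 : (A.dir y).1 = (A.dir z).1 + px y := by
      simp only [hpx, map_sub] at z1 ⊢
      simp only [dir, map_sub, hyz]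
      linarith
    have b2 : (A.dir y).2 = (A.dir z).2 + py y := by
      simp only [hpy, map_sub] at z2 ⊢
      simp only [dir, map_sub, hyz]
      linarith
    unfold cr
    rw [b1, b2, a1, a2, ex, ey]
    ring
  rw [hcr, ← hnc']
  nlinarith

end Frame

/-! ### Boundary chains of a polygon. -/

section Polygon

variable {F : Set E} {f h : E →ₗ[ℝ] ℝ}

/-- One step along the graph of the lower boundary, with `f` as abscissa and `h` as ordinate: from
`v` choose the least slope `σ`, and among the generators on that line the farthest one. -/
theorem exists_min_step (hF : IsPolytope F)
    (hinj : ∀ w ∈ vectorSpan ℝ F, f w = 0 → h w = 0 → w = 0) {v : E} (hv : IsFaceOfDim F 0 {v})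
    (hmin : ∀ y ∈ F, f y = f v → h v ≤ h y) (habove : ∃ y ∈ F, f v < f y) :
    ∃ w, IsEdge F v w ∧ f v < f w ∧ ∀ z ∈ segment ℝ v w, ∀ y ∈ F, f y = f z → h z ≤ h y := by
  obtain ⟨V, hV, hFV⟩ := hF
  have hVF : V ⊆ F := hFV ▸ subset_convexHull ℝ V
  have hvF : v ∈ F := hv.subset rfl
  have hconv : Convex ℝ F := hFV ▸ convex_convexHull ℝ V
  have hvV : v ∈ V := by
    have h1 : v ∈ F.extremePoints ℝ := hv.2.1.isExtreme.mem_extremePoints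
    rw [hFV] at h1
    exact extremePoints_convexHull_subset h1
  have hVlt : ∃ y ∈ V, f v < f y := by
    by_contra! hcon
    obtain ⟨y, hy, hyk⟩ := habove
    rw [hFV] at hy
    have := functional_le_of_convexHull f hcon y hy
    linarith
  obtain ⟨w₀, ⟨hw₀V, hw₀⟩, hsl⟩ := Set.exists_min_image {y ∈ V | f v < f y}
    (fun y => (h y - h v) / (f y - f v)) (hV.subset fun _ h => h.1)
    (by obtain ⟨y, hy, h⟩ := hVlt; exact ⟨y, hy, h⟩)
  set σ := (h w₀ - h v) / (f w₀ - f v) with hσ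
  have hσ₀ : h w₀ - h v = σ * (f w₀ - f v) := (div_mul_cancel₀ _ (by linarith)).symm
  obtain ⟨w, ⟨hwV, hw, hwσ⟩, hwmax⟩ := Set.exists_max_image
    {y ∈ V | f v < f y ∧ h y - h v = σ * (f y - f v)} f (hV.subset fun _ h => h.1)
    ⟨w₀, hw₀V, hw₀, hσ₀⟩
  have hge : ∀ y ∈ V, 0 ≤ (h y - h v) - σ * (f y - f v) := by
    intro y hy
    rcases lt_trichotomy (f v) (f y) with hlt | heq | hgt
    · have : σ ≤ (h y - h v) / (f y - f v) := hsl y ⟨hy, hlt⟩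
      rw [le_div_iff₀ (by linarith)] at this
      linarith
    · have := hmin y (hVF hy) heq.symm
      rw [heq, sub_self, mul_zero]
      linarith
    -- For `y` below the level of `v`, the segment from `y` to `w` crosses that level at a point of
    -- `F`, where `h` is at least `h v`. As `w` is on the line of slope `σ`, `y` cannot be under it.
    · obtain ⟨x, hx, hxv⟩ := exists_mem_segment_level hgt.le hw.le
      have hxF := hconv.segment_subset (hVF hy) (hVF hwV) hx
      have h1 := hmin x hxF hxv
      rw [segment_eq_image'] at hx
      obtain ⟨s, ⟨h0, h1'⟩, rfl⟩ := hx
      simp only [map_add, map_smul, map_sub, smul_eq_mul] at h1 hxv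
      have hs1 : s < 1 := by
        rcases h1'.eq_or_lt with h | h
        · rw [h] at hxv; linarith
        · exact h
      have : 0 ≤ (1 - s) * ((h y - h v) - σ * (f y - f v)) := by
        have e1 : s * (f w - f y) = f v - f y := by linarith
        have e2 : h w = h v + σ * (f w - f v) := by linarith
        rw [e2] at h1
        have e3 : s * (f w - f v) = (1 - s) * (f v - f y) := by linarith
        have e4 : σ * (s * (f w - f v)) = σ * ((1 - s) * (f v - f y)) := by rw [e3]
        linarith
      exact nonneg_of_mul_nonneg_right this (by linarith)
  have hgeF : ∀ y ∈ F, (σ • f - h) y ≤ σ * f v - h v := by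
    rw [hFV]
    apply functional_le_of_convexHull
    intro y hy
    have := hge y hy
    simp only [LinearMap.sub_apply, LinearMap.smul_apply, smul_eq_mul]
    linarith
  have hwF := hVF hwV
  have hline : ∀ y ∈ F, (σ • f - h) y = σ * f v - h v →
      y - v = ((f y - f v) / (f w - f v)) • (w - v) := by
    intro y hy hyl
    simp only [LinearMap.sub_apply, LinearMap.smul_apply, smul_eq_mul] at hyl
    have hpos : f w - f v ≠ 0 := by linarith
    rw [← sub_eq_zero]
    have m₁ : y - v ∈ vectorSpan ℝ F := vsub_mem_vectorSpan ℝ hy hvF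
    have m₂ : w - v ∈ vectorSpan ℝ F := vsub_mem_vectorSpan ℝ hwF hvF
    apply hinj _ (Submodule.sub_mem _ m₁ (Submodule.smul_mem _ _ m₂))
    · simp only [map_sub, map_smul, smul_eq_mul]
      field_simp
      ring
    · simp only [map_sub, map_smul, smul_eq_mul]
      rw [hwσ]
      field_simp
      linarith
  have hface : {x ∈ F | (σ • f - h) x = σ * f v - h v} = segment ℝ v w := by
    have hle : ∀ y ∈ V, (σ • f - h) y ≤ σ * f v - h v := fun y hy => hgeF y (hVF hy)
    rw [hFV, face_convexHull _ hle]
    refine eq_segment_of_line f ⟨hwV, ?_⟩ ⟨hvV, ?_⟩ hw ?_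
    · simp only [LinearMap.sub_apply, LinearMap.smul_apply, smul_eq_mul]
      linarith
    · simp
    · rintro y ⟨hy, hyl⟩
      have hl := hline y (hVF hy) hyl
      refine ⟨?_, ?_, _, hl⟩
      · by_contra hlt
        rw [not_le] at hlt
        -- A point of the face below `v` would place the vertex `v` inside a segment of `F`.
        have hseg : v ∈ segment ℝ y w := by
          rw [segment_eq_image']
          refine ⟨(f v - f y) / (f w - f y), ⟨div_nonneg (by linarith) (by linarith),
            (div_le_one (by linarith)).2 (by linarith)⟩, ?_⟩
          have h1 : f w - f v ≠ 0 := by linarith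
          have h2 : f w - f y ≠ 0 := by linarith
          have e : y = v + ((f y - f v) / (f w - f v)) • (w - v) := by rw [← hl]; abel
          set a := (f y - f v) / (f w - f v) with ha
          set b := (f v - f y) / (f w - f y) with hb
          have hab : a + b * (1 - a) = 0 := by
            rw [ha, hb]; field_simp; ring
          change y + b • (w - y) = v
          rw [e]
          have : v + a • (w - v) + b • (w - (v + a • (w - v))) = v + (a + b * (1 - a)) • (w - v) := by
            module
          rw [this, hab, zero_smul, add_zero]
        rcases hv.eq_or_eq_of_mem_segment (hVF hy) hwF hseg with h | h
        · rw [h] at hlt; exact hlt.false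
        · rw [h] at hw; exact hw.false
      · by_cases hy' : f v < f y
        · refine hwmax y ⟨hy, hy', ?_⟩
          simp only [LinearMap.sub_apply, LinearMap.smul_apply, smul_eq_mul] at hyl
          linarith
        · linarith
  refine ⟨w, ⟨⟨v, left_mem_segment ℝ v w⟩, ?_, dim_segment fun h => hw.ne (congrArg f h)⟩, hw, ?_⟩
  · rw [← hface]
    exact isExposed_of_functional _ _ hgeF
  · intro z hz y hy hyz
    rw [← hface] at hz
    have h1 := hz.2
    have h2 := hgeF y hy
    simp only [LinearMap.sub_apply, LinearMap.smul_apply, smul_eq_mul] at h1 h2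
    rw [hyz] at h2
    linarith

/-- Minimality of `h` on its level carries over to the upper end of each step, so steps can be
iterated; the number of vertices above the current one decreases. -/
theorem exists_min_chain (hF : IsPolytope F)
    (hinj : ∀ w ∈ vectorSpan ℝ F, f w = 0 → h w = 0 → w = 0) {v : E} (hv : IsFaceOfDim F 0 {v})
    (hmin : ∀ y ∈ F, f y = f v → h v ≤ h y) :
    ∃ L : List E, (∀ x ∈ v :: L, IsFaceOfDim F 0 {x}) ∧
      (∀ x ∈ F, f x ≤ f ((v :: L).getLast (List.cons_ne_nil v L))) ∧
      (v :: L).IsChain (fun u v => IsEdge F u v ∧ f u < f v) ∧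
      ∀ z ∈ listSupport (v :: L), ∀ y ∈ F, f y = f z → h z ≤ h y := by
  induction hn : {s : Set E | IsFaceOfDim F 0 s ∧ ∃ x ∈ s, f v < f x}.ncard using
    Nat.strong_induction_on generalizing v with
  | _ n ih =>
  by_cases habove : ∃ y ∈ F, f v < f y
  · obtain ⟨w, he, hvw, hw⟩ := exists_min_step hF hinj hv hmin habove
    have hwv := hF.isVertex_right he
    have hlt : {s : Set E | IsFaceOfDim F 0 s ∧ ∃ x ∈ s, f w < f x}.ncard < n := by
      rw [← hn]
      apply Set.ncard_lt_ncard _ ((hF.finite_faces 0).subset fun _ h => h.1)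
      refine ⟨fun s hs => ⟨hs.1, ?_⟩, fun hsub => ?_⟩
      · obtain ⟨x, hx, hwx⟩ := hs.2
        exact ⟨x, hx, hvw.trans hwx⟩
      · have : ({w} : Set E) ∈ {s : Set E | IsFaceOfDim F 0 s ∧ ∃ x ∈ s, f w < f x} :=
          hsub ⟨hwv, w, rfl, hvw⟩
        obtain ⟨-, x, hx, hwx⟩ := this
        rw [Set.mem_singleton_iff.1 hx] at hwx
        exact hwx.false
    obtain ⟨L, h1, h2, h3, h4⟩ := ih _ hlt hwv (hw w (right_mem_segment ℝ v w)) rfl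
    refine ⟨w :: L, ?_, ?_, ?_, ?_⟩
    · intro x hx
      rcases List.mem_cons.1 hx with rfl | hx
      · exact hv
      · exact h1 x hx
    · intro x hx
      rw [List.getLast_cons (List.cons_ne_nil w L)]
      exact h2 x hx
    · exact List.isChain_cons_cons.2 ⟨⟨he, hvw⟩, h3⟩
    · intro z hz
      rw [listSupport_cons_cons] at hz
      rcases hz with hz | hz
      · exact hw z hz
      · exact h4 z hz
  · push Not at habove
    refine ⟨[], ?_, ?_, ?_, ?_⟩
    · intro x hx
      rw [List.mem_singleton] at hx
      rwa [hx]
    · simpa using habove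
    · simp
    · intro z hz
      rw [listSupport_singleton] at hz
      exact hz.elim

theorem exists_min_path (hF : IsPolytope F) (hgen : IsGeneric F f) (hne : F.Nonempty)
    (hinj : ∀ w ∈ vectorSpan ℝ F, f w = 0 → h w = 0 → w = 0) :
    ∃ p : MonotonePath F f, ∀ z ∈ p.support, ∀ y ∈ F, f y = f z → h z ≤ h y := by
  obtain ⟨s, hs, hv, hle, hu⟩ := hF.exists_source hgen (IsExposed.refl F) hne
  obtain ⟨L, h1, h2, h3, h4⟩ := exists_min_chain hF hinj hv fun y hy hys => by rw [hu y hy hys]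
  exact ⟨⟨s :: L, List.cons_ne_nil s L, h1, hle, h2, h3⟩, h4⟩

end Polygon

end MonotoneFlip

/-! ### Monotone paths as functions of the level. -/

namespace MonotoneFlip

open Set

variable {E : Type*} [NormedAddCommGroup E] [NormedSpace ℝ E]

theorem exists_mem_listSupport_level {f : E →ₗ[ℝ] ℝ} {l : List E} (hl : 2 ≤ l.length)
    (hne : l ≠ []) {t : ℝ} (h1 : f (l.head hne) ≤ t) (h2 : t ≤ f (l.getLast hne)) :
    ∃ x ∈ listSupport l, f x = t := by
  rcases h2.lt_or_eq with h | h
  · obtain ⟨u, v, huv, hu, hv⟩ := exists_pair_of_level hne h1 h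
    obtain ⟨x, hx, hxt⟩ := exists_mem_segment_level hu hv.le
    exact ⟨x, ⟨u, v, huv, hx⟩, hxt⟩
  · exact ⟨_, mem_listSupport_of_mem hl (List.getLast_mem hne), h.symm⟩

namespace MonotonePath

variable {P : Set E} {f : E →ₗ[ℝ] ℝ}

theorem increasing (γ : MonotonePath P f) : γ.vertices.IsChain (fun u v => f u < f v) :=
  γ.chain.imp fun _ _ h => h.2

theorem pairwise (γ : MonotonePath P f) : γ.vertices.Pairwise (fun u v => f u < f v) :=
  increasing_pairwise γ.increasing

theorem mem_of_mem_vertices (γ : MonotonePath P f) {v : E} (h : v ∈ γ.vertices) : v ∈ P :=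
  (γ.isVertex v h).subset rfl

theorem edge (γ : MonotonePath P f) {u v : E} (h : [u, v] <:+: γ.vertices) :
    IsEdge P u v ∧ f u < f v :=
  (List.isChain_pair (R := fun u v => IsEdge P u v ∧ f u < f v)).1 (γ.chain.infix h)

theorem exists_edge (γ : MonotonePath P f) {x : E} (h : x ∈ γ.support) :
    ∃ u v, [u, v] <:+: γ.vertices ∧ IsEdge P u v ∧ f u < f v ∧ x ∈ segment ℝ u v := by
  obtain ⟨u, v, huv, hx⟩ := h
  exact ⟨u, v, huv, (γ.edge huv).1, (γ.edge huv).2, hx⟩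

theorem support_subset (γ : MonotonePath P f) : γ.support ⊆ P := by
  intro x hx
  obtain ⟨u, v, -, he, -, hx⟩ := γ.exists_edge hx
  exact he.subset hx

theorem eq_of_mem_support (γ : MonotonePath P f) {x y : E} (hx : x ∈ γ.support)
    (hy : y ∈ γ.support) (h : f x = f y) : x = y :=
  listSupport_injOn γ.increasing hx hy h

theorem two_le_length (γ : MonotonePath P f) {x y : E} (hx : x ∈ P) (hy : y ∈ P)
    (hxy : f x < f y) : 2 ≤ γ.vertices.length := by
  have key : ∀ (l : List E) (hne : l ≠ []), f (l.head hne) ≤ f x → f y ≤ f (l.getLast hne) →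
      2 ≤ l.length := by
    rintro (_ | ⟨a, _ | ⟨b, l⟩⟩) hne h1 h2
    · exact absurd rfl hne
    · simp only [List.head_cons, List.getLast_singleton] at h1 h2
      linarith
    · simp
  exact key _ γ.ne_nil (γ.source x hx) (γ.sink y hy)

theorem mem_vertices_of_mem_support (γ : MonotonePath P f) {v : E} (hv : IsFaceOfDim P 0 {v})
    (h : v ∈ γ.support) : v ∈ γ.vertices := by
  obtain ⟨a, b, hab, he, -, hx⟩ := γ.exists_edge h
  rcases hv.eq_or_eq_of_mem_segment he.left_mem he.right_mem hx with rfl | rfl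
  · exact hab.subset (by simp)
  · exact hab.subset (by simp)

end MonotonePath

namespace Frame

variable {P : Set E} {f : E →ₗ[ℝ] ℝ} (A : Frame P f)

theorem head_eq (γ : MonotonePath P f) : γ.vertices.head γ.ne_nil = A.lo :=
  A.eq_lo _ (γ.mem_of_mem_vertices (List.head_mem _))
    (le_antisymm (γ.source _ A.lo_mem) (A.lo_le _ (γ.mem_of_mem_vertices (List.head_mem _))))

theorem getLast_eq (γ : MonotonePath P f) : γ.vertices.getLast γ.ne_nil = A.hi :=
  A.eq_hi _ (γ.mem_of_mem_vertices (List.getLast_mem _))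
    (le_antisymm (A.le_hi _ (γ.mem_of_mem_vertices (List.getLast_mem _))) (γ.sink _ A.hi_mem))

theorem two_le_length (A : Frame P f) (γ : MonotonePath P f) : 2 ≤ γ.vertices.length :=
  γ.two_le_length A.lo_mem A.hi_mem A.lo_lt_hi

theorem exists_mem_support (γ : MonotonePath P f) {t : ℝ} (ht : t ∈ Icc (f A.lo) (f A.hi)) :
    ∃ x ∈ γ.support, f x = t :=
  exists_mem_listSupport_level (A.two_le_length γ) γ.ne_nil (by rw [A.head_eq]; exact ht.1)
    (by rw [A.getLast_eq]; exact ht.2)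

theorem clamp_mem (t : ℝ) : max (f A.lo) (min t (f A.hi)) ∈ Icc (f A.lo) (f A.hi) :=
  ⟨le_max_left _ _, max_le A.lo_lt_hi.le (min_le_right _ _)⟩

theorem clamp_eq {t : ℝ} (ht : t ∈ Icc (f A.lo) (f A.hi)) : max (f A.lo) (min t (f A.hi)) = t := by
  rw [min_eq_left ht.2, max_eq_right ht.1]

/-- The point of a monotone path on the level `t` (clamped to the levels of `P`). -/
noncomputable def pt (γ : MonotonePath P f) (t : ℝ) : E :=
  (A.exists_mem_support γ (A.clamp_mem t)).choose

theorem pt_mem (γ : MonotonePath P f) (t : ℝ) : A.pt γ t ∈ γ.support :=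
  (A.exists_mem_support γ (A.clamp_mem t)).choose_spec.1

theorem f_pt_clamp (γ : MonotonePath P f) (t : ℝ) :
    f (A.pt γ t) = max (f A.lo) (min t (f A.hi)) :=
  (A.exists_mem_support γ (A.clamp_mem t)).choose_spec.2

theorem f_pt (γ : MonotonePath P f) {t : ℝ} (ht : t ∈ Icc (f A.lo) (f A.hi)) :
    f (A.pt γ t) = t := by
  rw [f_pt_clamp, A.clamp_eq ht]

theorem pt_mem_poly (γ : MonotonePath P f) (t : ℝ) : A.pt γ t ∈ P := γ.support_subset (A.pt_mem γ t)

theorem pt_eq (γ : MonotonePath P f) {x : E} (hx : x ∈ γ.support) {t : ℝ} (h : f x = t) :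
    A.pt γ t = x := by
  apply γ.eq_of_mem_support (A.pt_mem γ t) hx
  rw [A.f_pt γ (h ▸ A.level_mem (γ.support_subset hx)), h]

/-- The support is compact and `f` is injective on it, so the preimage of a closed `K` is the
preimage, under clamping, of the compact set `f '' (γ.support ∩ K)`. -/
theorem continuous_pt [FiniteDimensional ℝ E] (γ : MonotonePath P f) : Continuous (A.pt γ) := by
  rw [continuous_iff_isClosed]
  intro K hK
  have hcomp : IsCompact (f '' (γ.support ∩ K)) :=
    ((isCompact_listSupport γ.vertices).inter_right hK).image
      (LinearMap.continuous_of_finiteDimensional f)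
  have e : A.pt γ ⁻¹' K = (fun t => max (f A.lo) (min t (f A.hi))) ⁻¹' (f '' (γ.support ∩ K)) := by
    ext t
    constructor
    · intro h
      exact ⟨A.pt γ t, ⟨A.pt_mem γ t, h⟩, A.f_pt_clamp γ t⟩
    · rintro ⟨x, ⟨hx, hxK⟩, hxt⟩
      have : A.pt γ t = x := γ.eq_of_mem_support (A.pt_mem γ t) hx ((A.f_pt_clamp γ t).trans hxt.symm)
      rwa [mem_preimage, this]
  rw [e]
  exact hcomp.isClosed.preimage (by fun_prop)

theorem onBoundary_of_mem_support (A : Frame P f) (γ : MonotonePath P f) {x : E}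
    (hx : x ∈ γ.support) :
    OnBoundary P x := by
  obtain ⟨u, v, -, he, -, hx⟩ := γ.exists_edge hx
  exact he.onBoundary (by rw [A.dim_eq]; omega) hx

theorem pt_onBoundary (γ : MonotonePath P f) (t : ℝ) : OnBoundary P (A.pt γ t) :=
  A.onBoundary_of_mem_support γ (A.pt_mem γ t)

theorem pt_not_os [FiniteDimensional ℝ E] (γ : MonotonePath P f) {F : Set E}
    (hF : IsFaceOfDim P 2 F) {t : ℝ} (ht : t ∈ Ioo (f A.lo) (f A.hi)) : ¬ A.OS F (A.pt γ t) := by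
  intro h
  obtain ⟨u, v, -, he, -, hx⟩ := γ.exists_edge (A.pt_mem γ t)
  exact h.not_mem_edge A hF (by rwa [A.f_pt γ (Ioo_subset_Icc_self ht)]) he hx

theorem mem_support_of_mem_vertices (A : Frame P f) (γ : MonotonePath P f) {v : E}
    (h : v ∈ γ.vertices) :
    v ∈ γ.support := mem_listSupport_of_mem (A.two_le_length γ) h

/-- A monotone path is determined by its points on the inner levels. -/
theorem path_ext {γ γ' : MonotonePath P f}
    (h : ∀ t ∈ Ioo (f A.lo) (f A.hi), A.pt γ t = A.pt γ' t) : γ = γ' := by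
  apply MonotonePath.ext
  have key : ∀ {γ γ' : MonotonePath P f}, (∀ t ∈ Ioo (f A.lo) (f A.hi), A.pt γ t = A.pt γ' t) →
      ∀ v, v ∈ γ.vertices → v ∈ γ'.vertices := by
    intro γ γ' h v hv
    have hvP := γ.mem_of_mem_vertices hv
    rcases (A.lo_le v hvP).eq_or_lt with h1 | h1
    · rw [A.eq_lo v hvP h1.symm, ← A.head_eq γ']
      exact List.head_mem _
    rcases (A.le_hi v hvP).eq_or_lt with h2 | h2
    · rw [A.eq_hi v hvP h2, ← A.getLast_eq γ']
      exact List.getLast_mem _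
    · have := h (f v) ⟨h1, h2⟩
      rw [A.pt_eq γ (A.mem_support_of_mem_vertices γ hv) rfl] at this
      exact γ'.mem_vertices_of_mem_support (γ.isVertex v hv) (this ▸ A.pt_mem γ' _)
  exact eq_of_increasing_of_mem_iff γ.pairwise γ'.pairwise fun v =>
    ⟨key h v, key (fun t ht => (h t ht).symm) v⟩

/-- Two paths agree on the levels of a common sublist of consecutive vertices. -/
theorem pt_eq_of_common_infix {γ γ' : MonotonePath P f} {l : List E} (h : l <:+: γ.vertices)
    (h' : l <:+: γ'.vertices) (hl : 2 ≤ l.length) (hne : l ≠ []) {t : ℝ} (h1 : f (l.head hne) ≤ t)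
    (h2 : t ≤ f (l.getLast hne)) : A.pt γ t = A.pt γ' t := by
  obtain ⟨x, hx, hxt⟩ := exists_mem_listSupport_level hl hne h1 h2
  rw [A.pt_eq γ (listSupport_mono h hx) hxt, A.pt_eq γ' (listSupport_mono h' hx) hxt]

end Frame

end MonotoneFlip

/-! ### Swept sets of facets and the search for a flippable facet. -/

namespace MonotoneFlip

open Set

variable {E : Type*} [NormedAddCommGroup E] [NormedSpace ℝ E]

theorem pair_infix_of_lt {α : Type*} {l : List α} {i : ℕ} (h : i + 1 < l.length) :
    [l[i], l[i + 1]] <:+: l := by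
  refine ⟨l.take i, l.drop (i + 2), ?_⟩
  rw [List.append_assoc]
  conv_rhs => rw [← List.take_append_drop i l, List.drop_eq_getElem_cons (by omega : i < l.length),
    List.drop_eq_getElem_cons h]
  simp

theorem isChain_replace {α : Type*} {R : α → α → Prop} {a b p q : List α}
    (h : (a ++ p ++ b).IsChain R)
    (hq : q.IsChain R) (h1 : q.head? = p.head?) (h2 : q.getLast? = p.getLast?) :
    (a ++ q ++ b).IsChain R := by
  rw [List.append_assoc, List.isChain_append, List.isChain_append] at *
  obtain ⟨ha, ⟨-, hb, hpb⟩, hap⟩ := h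
  refine ⟨ha, ⟨hq, hb, by rwa [h2]⟩, ?_⟩
  rw [List.head?_append] at *
  rwa [h1]

namespace Frame

variable {P : Set E} {f : E →ₗ[ℝ] ℝ}

/-- The set `S` of facets is the part of the boundary swept from `γ` leftwards to `γ'`. -/
def Inv (A : Frame P f) (γ γ' : MonotonePath P f) (S : Set (Set E)) : Prop :=
  ∀ t ∈ Ioo (f A.lo) (f A.hi),
    (A.pt γ t ≠ A.pt γ' t → ∀ H, IsFaceOfDim P 2 H → Alive f H t → ∀ z, A.OS H z → f z = t →
      (H ∈ S ↔ Ccw (A.dir (A.pt γ t)) (A.dir z) (A.dir (A.pt γ' t)))) ∧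
    -- Where the paths meet, the arc swept between them is either empty or the full circle, so the
    -- facets alive there are all inside or all outside.
    (A.pt γ t = A.pt γ' t → ∀ H H', IsFaceOfDim P 2 H → IsFaceOfDim P 2 H' → Alive f H t →
      Alive f H' t → (H ∈ S ↔ H' ∈ S))

theorem not_ccw_iff (A : Frame P f) {x y z : E} (hx : OnBoundary P x) (hy : OnBoundary P y)
    (hz : OnBoundary P z) (hl : f z ∈ Ioo (f A.lo) (f A.hi)) (hxz : f x = f z) (hyz : f y = f z)
    (h1 : x ≠ y) (h2 : x ≠ z) (h3 : y ≠ z) :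
    ¬ Ccw (A.dir x) (A.dir z) (A.dir y) ↔ Ccw (A.dir y) (A.dir z) (A.dir x) := by
  constructor
  · intro h
    exact ((ccw_total (A.distinctRays hx hz hxz (hxz ▸ hl) h2) (A.distinctRays hz hy hyz.symm hl
      h3.symm) (A.distinctRays hy hx (hyz.trans hxz.symm) (hyz ▸ hl) h1.symm)).resolve_left h).rotate
  · intro h h'
    exact h'.asymm h.rotate.rotate

theorem exists_edge_above (A : Frame P f) (γ : MonotonePath P f) {t : ℝ} (h1 : f A.lo ≤ t)
    (h2 : t < f A.hi) : ∃ u v, [u, v] <:+: γ.vertices ∧ f u ≤ t ∧ t < f v :=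
  exists_pair_of_level γ.ne_nil (by rwa [A.head_eq]) (by rwa [A.getLast_eq])

theorem pt_mem_segment (A : Frame P f) (γ : MonotonePath P f) {u v : E}
    (h : [u, v] <:+: γ.vertices) {t : ℝ} (h1 : f u ≤ t) (h2 : t ≤ f v) :
    A.pt γ t ∈ segment ℝ u v := by
  obtain ⟨x, hx, hxt⟩ := exists_mem_segment_level h1 h2
  rwa [A.pt_eq γ ⟨u, v, h, hx⟩ hxt]

variable [FiniteDimensional ℝ E]

/-- The counterclockwise arcs from `γ` to `γ'` and from `γ'` to `γ` are complementary, and the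
interior of a slice never contains a point of either path. -/
theorem Inv.swap {A : Frame P f} {γ γ' : MonotonePath P f} {S : Set (Set E)} (h : A.Inv γ γ' S) :
    A.Inv γ' γ ({F | IsFaceOfDim P 2 F} \ S) := by
  intro t ht
  obtain ⟨h1, h2⟩ := h t ht
  have htc := Ioo_subset_Icc_self ht
  constructor
  · intro hne H hH hal z hz hzt
    have e1 := A.f_pt γ htc
    have e2 := A.f_pt γ' htc
    have hzl : f z ∈ Ioo (f A.lo) (f A.hi) := hzt.symm ▸ ht
    have := h1 hne.symm H hH hal z hz hzt
    rw [mem_sdiff, mem_ofPred_eq, this, ← A.not_ccw_iff (A.pt_onBoundary γ t)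
      (A.pt_onBoundary γ' t) (A.facet_onBoundary hH hz.1) hzl (e1.trans hzt.symm)
      (e2.trans hzt.symm) hne.symm]
    · exact ⟨fun h => h.2, fun h => ⟨hH, h⟩⟩
    · intro h
      exact A.pt_not_os γ hH ht (h ▸ hz)
    · intro h
      exact A.pt_not_os γ' hH ht (h ▸ hz)
  · intro he H H' hH hH' hal hal'
    have := h2 he.symm H H' hH hH' hal hal'
    simp only [mem_sdiff, mem_ofPred_eq, hH, hH', true_and, this]

/-- If some alive facet lies in the swept region, then so does the facet left of the path. -/
theorem Inv.left_mem {A : Frame P f} {γ γ' : MonotonePath P f} {S : Set (Set E)}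
    (h : A.Inv γ γ' S) {F G : Set E} (hF : IsFaceOfDim P 2 F) (hG : IsFaceOfDim P 2 G)
    (hFS : F ∈ S) {t : ℝ} (hFt : Alive f F t) (hGt : Alive f G t) (hr : A.Rt G (A.pt γ t)) :
    G ∈ S := by
  have ht := A.alive_level hF.subset hFt
  have htc := Ioo_subset_Icc_self ht
  by_cases he : A.pt γ t = A.pt γ' t
  · exact ((h t ht).2 he F G hF hG hFt hGt).1 hFS
  · obtain ⟨-, -, z, -, -, hz, -, -, hzt, -⟩ := A.exists_ends hG hGt
    rw [(h t ht).1 he G hG hGt z hz hzt]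
    exact A.ccw_rt_os hG hr hz (hzt.symm ▸ hGt) ((A.f_pt γ htc).trans hzt.symm)
      ((A.f_pt γ' htc).trans hzt.symm) (A.pt_onBoundary γ' t) (Ne.symm he) (A.pt_not_os γ' hG ht)

/-- Just above any inner level, the facet to the left of the current edge of `γ` would be swept
wherever the paths differ. So they agree there, and by continuity also on the level itself. -/
theorem Inv.eq_of_empty {A : Frame P f} {γ γ' : MonotonePath P f} (h : A.Inv γ γ' ∅) :
    γ = γ' := by
  apply A.path_ext
  intro t ht
  obtain ⟨u, v, huv, hu, hv⟩ := A.exists_edge_above γ ht.1.le ht.2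
  obtain ⟨he, hlt⟩ := γ.edge huv
  obtain ⟨G, hG, hGr⟩ := A.exists_left_facet he hlt
  have hsub : Ioo t (f v) ⊆ {s | A.pt γ s = A.pt γ' s} := by
    intro s hs
    by_contra hne
    have hGs : Alive f G s := ⟨⟨u, (hGr u (left_mem_segment ℝ u v)).1, hu.trans_lt hs.1⟩,
      v, (hGr v (right_mem_segment ℝ u v)).1, hs.2⟩
    have hsl := A.alive_level hG.subset hGs
    have hsc := Ioo_subset_Icc_self hsl
    have hr := hGr _ (A.pt_mem_segment γ huv (hu.trans hs.1.le) hs.2.le)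
    obtain ⟨-, -, z, -, -, hz, -, -, hzt, -⟩ := A.exists_ends hG hGs
    have := ((h s hsl).1 hne G hG hGs z hz hzt).2
      (A.ccw_rt_os hG hr hz (hzt.symm ▸ hGs) ((A.f_pt γ hsc).trans hzt.symm)
        ((A.f_pt γ' hsc).trans hzt.symm) (A.pt_onBoundary γ' s) (Ne.symm hne)
        (A.pt_not_os γ' hG hsl))
    exact this
  have hcl := closure_minimal hsub (isClosed_eq (A.continuous_pt γ) (A.continuous_pt γ'))
  rw [closure_Ioo hv.ne] at hcl
  exact hcl ⟨le_rfl, hv.le⟩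

/-- Some facet of a nonempty swept region has its whole right boundary on the path. -/
theorem exists_flippable (A : Frame P f) (γ : MonotonePath P f) {S : Set (Set E)}
    (hS : ∀ F ∈ S, IsFaceOfDim P 2 F) (hne : S.Nonempty)
    (hC : ∀ F ∈ S, ∀ G, IsFaceOfDim P 2 G → ∀ t, Alive f F t → Alive f G t →
      A.Rt G (A.pt γ t) → G ∈ S) :
    ∃ F ∈ S, ∀ t, (∃ y ∈ F, f y < t) → (∃ y ∈ F, t ≤ f y) → A.Rt F (A.pt γ t) := by
  set n := γ.vertices.length with hn
  have hn2 : 2 ≤ n := A.two_le_length γ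
  set v : ℕ → E := fun i => γ.vertices.getD i A.lo with hv
  have hvi : ∀ i (h : i < n), v i = γ.vertices[i] := fun i h =>
    List.getD_eq_getElem _ _ h
  have hv0 : v 0 = A.lo := by
    rw [hvi 0 (by omega), ← A.head_eq γ, List.head_eq_getElem]
  have hvn : v (n - 1) = A.hi := by
    rw [hvi _ (by omega), ← A.getLast_eq γ, List.getLast_eq_getElem]
  have hinf : ∀ i, i + 1 < n → [v i, v (i + 1)] <:+: γ.vertices := by
    intro i hi
    rw [hvi i (by omega), hvi (i + 1) hi]
    exact pair_infix_of_lt hi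
  have hlt : ∀ i, i + 1 < n → f (v i) < f (v (i + 1)) := fun i hi => (γ.edge (hinf i hi)).2
  -- `L i` will be the facet to the left of the `i`-th edge of `γ`; the empty set is a filler for
  -- indices without an edge.
  have hex : ∀ i, ∃ F, i + 1 < n → IsFaceOfDim P 2 F ∧
      ∀ z ∈ segment ℝ (v i) (v (i + 1)), A.Rt F z := by
    intro i
    by_cases hi : i + 1 < n
    · obtain ⟨F, h⟩ := A.exists_left_facet (γ.edge (hinf i hi)).1 (hlt i hi)
      exact ⟨F, fun _ => h⟩
    · exact ⟨∅, fun h => absurd h hi⟩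
  choose L hL using hex
  have hLl : ∀ i, i + 1 < n → v i ∈ L i := fun i hi =>
    ((hL i hi).2 _ (left_mem_segment ℝ _ _)).1
  have hLr : ∀ i, i + 1 < n → v (i + 1) ∈ L i := fun i hi =>
    ((hL i hi).2 _ (right_mem_segment ℝ _ _)).1
  have hLt : ∀ i, i + 1 < n → ∀ t, f (v i) ≤ t → t ≤ f (v (i + 1)) → A.Rt (L i) (A.pt γ t) :=
    fun i hi t h1 h2 => (hL i hi).2 _ (A.pt_mem_segment γ (hinf i hi) h1 h2)
  have hC' : ∀ i, i + 1 < n → ∀ F ∈ S, ∀ t, Alive f F t → f (v i) < t → t < f (v (i + 1)) →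
      L i ∈ S := fun i hi F hF t hal h1 h2 =>
    hC F hF (L i) (hL i hi).1 t hal ⟨⟨_, hLl i hi, h1⟩, _, hLr i hi, h2⟩ (hLt i hi t h1.le h2.le)
  have hindex : ∀ t, f A.lo ≤ t → t < f A.hi → ∃ i, i + 1 < n ∧ f (v i) ≤ t ∧
      t < f (v (i + 1)) := by
    intro t h1 h2
    have hP : ∃ j, j < n ∧ t < f (v j) := ⟨n - 1, by omega, by rwa [hvn]⟩
    classical
    have hs := Nat.find_spec hP
    have hmin : ∀ m, m < Nat.find hP → ¬ (m < n ∧ t < f (v m)) := fun m hm => Nat.find_min hP hm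
    rcases hj : Nat.find hP with _ | j
    · rw [hj, hv0] at hs
      linarith [hs.2]
    · rw [hj] at hs hmin
      refine ⟨j, hs.1, ?_, hs.2⟩
      have := hmin j (by omega)
      push Not at this
      exact this (by omega)
  have hstart : ∃ i, i + 1 < n ∧ L i ∈ S := by
    obtain ⟨F, hF⟩ := hne
    have hFf := hS F hF
    obtain ⟨x, hx, y, hy, hxy⟩ := hFf.nontrivial (by norm_num)
    obtain ⟨a, ha, b, hb, hab⟩ := A.poly.exists_lt_of_face A.gen hFf.2.1 hx hy hxy
    obtain ⟨i, hi, h1, h2⟩ := hindex (f a) (A.lo_le a (hFf.subset ha))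
      (hab.trans_le (A.le_hi b (hFf.subset hb)))
    obtain ⟨t, ht1, ht2⟩ := exists_between (lt_min hab h2)
    exact ⟨i, hi, hC' i hi F hF t ⟨⟨a, ha, ht1⟩, b, hb, ht2.trans_le (min_le_left _ _)⟩
      (h1.trans_lt ht1) (ht2.trans_le (min_le_right _ _))⟩
  -- Take the least `i` with `L i ∈ S`. If `L i` reached below `v i`, it would be alive beside the
  -- preceding edge, whose left facet would then belong to `S` too.
  have hgood : ∃ i, i + 1 < n ∧ L i ∈ S ∧ ∀ t, (∃ y ∈ L i, f y < t) → t ≤ f (v (i + 1)) →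
      A.Rt (L i) (A.pt γ t) := by
    classical
    obtain ⟨hi, hiS⟩ := Nat.find_spec hstart
    have hmin : ∀ m, m < Nat.find hstart → ¬ (m + 1 < n ∧ L m ∈ S) :=
      fun m hm => Nat.find_min hstart hm
    set i := Nat.find hstart with hidef
    refine ⟨i, hi, hiS, fun t ⟨y, hy, hyt⟩ ht => ?_⟩
    apply hLt i hi t _ ht
    by_contra hcon
    push Not at hcon
    rcases hi0 : i with _ | j
    · rw [hi0, hv0] at hcon
      rw [hi0] at hy hi
      linarith [A.lo_le y ((hL 0 hi).1.subset hy)]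
    · rw [hi0] at hy hi hcon hiS hmin
      obtain ⟨r, hr1, hr2⟩ := exists_between (max_lt (hyt.trans hcon) (hlt j (by omega)))
      refine hmin j (by omega) ⟨by omega, hC' j (by omega) (L (j + 1)) hiS r
        ⟨⟨y, hy, (le_max_left _ _).trans_lt hr1⟩, v (j + 2), hLr (j + 1) hi,
          hr2.trans (hlt (j + 1) hi)⟩ ((le_max_right _ _).trans_lt hr1) hr2⟩
  by_contra hnone
  push Not at hnone
  -- If `L i` cannot be flipped, it is still alive at `v (i + 1)`, so `L (i + 1) ∈ S`. If `L (i +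
  -- 1)` reaches below that vertex, both facets are alive there with the same right end, hence they
  -- are equal.
  have hstep : ∀ i, (i + 1 < n ∧ L i ∈ S ∧ ∀ t, (∃ y ∈ L i, f y < t) → t ≤ f (v (i + 1)) →
      A.Rt (L i) (A.pt γ t)) → (i + 1 + 1 < n ∧ L (i + 1) ∈ S ∧
        ∀ t, (∃ y ∈ L (i + 1), f y < t) → t ≤ f (v (i + 1 + 1)) → A.Rt (L (i + 1)) (A.pt γ t)) := by
    rintro i ⟨hi, hiS, hgi⟩
    obtain ⟨t, hy1, ⟨y, hy, hyt⟩, hnr⟩ := hnone (L i) hiS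
    have hyv : f (v (i + 1)) < f y := by
      by_contra h
      exact hnr (hgi t hy1 (hyt.trans (not_lt.1 h)))
    have hi2 : i + 1 + 1 < n := by
      by_contra h
      have : i + 1 = n - 1 := by omega
      rw [this, hvn] at hyv
      linarith [A.le_hi y ((hL i hi).1.subset hy)]
    have hLi : Alive f (L i) (f (v (i + 1))) := ⟨⟨v i, hLl i hi, hlt i hi⟩, y, hy, hyv⟩
    obtain ⟨r, hr1, hr2⟩ := exists_between (lt_min hyv (hlt (i + 1) hi2))
    have hS' : L (i + 1) ∈ S := hC' (i + 1) hi2 (L i) hiS r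
      ⟨⟨v i, hLl i hi, (hlt i hi).trans hr1⟩, y, hy, hr2.trans_le (min_le_left _ _)⟩ hr1
      (hr2.trans_le (min_le_right _ _))
    refine ⟨hi2, hS', fun s ⟨x, hx, hxs⟩ hs => ?_⟩
    by_cases hsv : f (v (i + 1)) ≤ s
    · exact hLt (i + 1) hi2 s hsv hs
    · push Not at hsv
      have heq : L i = L (i + 1) := Rt.facet_eq A (hL i hi).1 (hL (i + 1) hi2).1
        ((hL i hi).2 _ (right_mem_segment ℝ _ _)) ((hL (i + 1) hi2).2 _ (left_mem_segment ℝ _ _))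
        hLi ⟨⟨x, hx, hxs.trans hsv⟩, v (i + 1 + 1), hLr (i + 1) hi2, hlt (i + 1) hi2⟩
      rw [← heq] at hx ⊢
      exact hgi s ⟨x, hx, hxs⟩ hsv.le
  obtain ⟨i, hi⟩ := hgood
  -- Without a flippable facet the climb would outrun the finitely many edges of `γ`.
  have hall : ∀ k, (i + k + 1 < n ∧ L (i + k) ∈ S ∧ ∀ t, (∃ y ∈ L (i + k), f y < t) →
      t ≤ f (v (i + k + 1)) → A.Rt (L (i + k)) (A.pt γ t)) := by
    intro k
    induction k with
    | zero => exact hi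
    | succ k ih => exact hstep (i + k) ih
  have := (hall n).1
  omega

end Frame

end MonotoneFlip

/-! ### Flipping across a facet and counting flips. -/

namespace MonotoneFlip

open Set

variable {E : Type*} [NormedAddCommGroup E] [NormedSpace ℝ E] [FiniteDimensional ℝ E]

namespace Frame

variable {P : Set E} {f : E →ₗ[ℝ] ℝ}

/-- Minimizing the slice coordinate on each level traces the right chain of `F`, maximizing it the
left chain. The extreme levels are left out because the axis ends on the boundary. -/
theorem exists_boundary_path (A : Frame P f) {F : Set E} (hF : IsFaceOfDim P 2 F) :
    ∃ p q : MonotonePath F f,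
      (∀ z ∈ p.support, f z ∈ Ioo (f A.lo) (f A.hi) → A.Rt F z) ∧
      (∀ z ∈ q.support, f z ∈ Ioo (f A.lo) (f A.hi) → A.Lt F z) ∧
      ∀ z ∈ p.support, z ∈ F := by
  obtain ⟨h, h1, h2⟩ := A.exists_slice_coordinate hF
  have hpoly := A.poly.of_isExposed hF.2.1
  have hgen := A.gen.of_isExposed A.poly hF.2.1
  obtain ⟨p, hp⟩ := exists_min_path hpoly hgen hF.1 h1
  obtain ⟨q, hq⟩ := exists_min_path (h := -h) hpoly hgen hF.1
    (fun w hw hw0 hwh => h1 w hw hw0 (by simpa using hwh))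
  refine ⟨p, q, fun z hz hl => ⟨p.support_subset hz, fun y hy hyz => ?_⟩,
    fun z hz hl => ⟨q.support_subset hz, fun y hy hyz => ?_⟩, p.support_subset⟩
  · by_contra hneg
    rw [not_le, ← neg_pos, ← cr_swap] at hneg
    have i1 := (h2 y hy z (p.support_subset hz) hyz (hyz.symm ▸ hl)).1 hneg
    have i2 := hp z hz y hy hyz
    linarith
  · by_contra hneg
    rw [not_le, ← neg_pos, ← cr_swap] at hneg
    have i1 := (h2 z (q.support_subset hz) y hy hyz.symm hl).1 hneg
    have i2 := hq z hz y hy hyz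
    simp only [LinearMap.neg_apply] at i2
    linarith

/-- A path following the right boundary of a facet can be flipped to follow the left boundary. -/
theorem exists_flip (A : Frame P f) (γ : MonotonePath P f) {F : Set E} (hF : IsFaceOfDim P 2 F)
    (hfl : ∀ t, (∃ y ∈ F, f y < t) → (∃ y ∈ F, t ≤ f y) → A.Rt F (A.pt γ t)) :
    ∃ γ₁ : MonotonePath P f, DifferByFlip γ γ₁ F ∧
      (∀ t ∈ Ioo (f A.lo) (f A.hi), ¬ Alive f F t → A.pt γ₁ t = A.pt γ t) ∧
      ∀ t, Alive f F t → A.Lt F (A.pt γ₁ t) := by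
  obtain ⟨p, q, hp, hq, hpF⟩ := A.exists_boundary_path hF
  have hFP := hF.subset
  obtain ⟨s, hs, hsv, hsle, hsu⟩ := A.poly.exists_source A.gen hF.2.1 hF.1
  obtain ⟨k, hk, hkv, hkle, hku⟩ := A.poly.exists_sink A.gen hF.2.1 hF.1
  have hsk : f s < f k := by
    obtain ⟨x, hx, y, hy, hxy⟩ := hF.nontrivial (by norm_num)
    obtain ⟨a, ha, b, hb, hab⟩ := A.poly.exists_lt_of_face A.gen hF.2.1 hx hy hxy
    exact (hsle a ha).trans_lt (hab.trans_le (hkle b hb))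
  have hhead : ∀ r : MonotonePath F f, r.vertices.head r.ne_nil = s := fun r =>
    hsu _ (r.mem_of_mem_vertices (List.head_mem _))
      (le_antisymm (r.source s hs) (hsle _ (r.mem_of_mem_vertices (List.head_mem _))))
  have hlast : ∀ r : MonotonePath F f, r.vertices.getLast r.ne_nil = k := fun r =>
    hku _ (r.mem_of_mem_vertices (List.getLast_mem _))
      (le_antisymm (hkle _ (r.mem_of_mem_vertices (List.getLast_mem _))) (r.sink k hk))
  have hhead? : ∀ r : MonotonePath F f, r.vertices.head? = some s := fun r => by
    rw [List.head?_eq_some_head r.ne_nil, hhead]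
  have hlast? : ∀ r : MonotonePath F f, r.vertices.getLast? = some k := fun r => by
    rw [List.getLast?_eq_some_getLast r.ne_nil, hlast]
  have hlen : ∀ r : MonotonePath F f, 2 ≤ r.vertices.length := fun r =>
    r.two_le_length hs hk hsk
  have hlevel : ∀ r : MonotonePath F f, ∀ t, f s ≤ t → t ≤ f k → ∃ z ∈ r.support, f z = t :=
    fun r t h1 h2 => exists_mem_listSupport_level (hlen r) r.ne_nil (by rwa [hhead])
      (by rwa [hlast])
  have hscl : f s ∈ Icc (f A.lo) (f A.hi) := A.level_mem (hFP hs)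
  have hkcl : f k ∈ Icc (f A.lo) (f A.hi) := A.level_mem (hFP hk)
  have hclosed : IsClosed F := (A.poly.of_isExposed hF.2.1).isCompact.isClosed
  -- The hypothesis does not cover the level of the source; it is reached by closedness of `F` and
  -- continuity.
  have hin : ∀ t, f s ≤ t → t ≤ f k → A.pt γ t ∈ F := by
    have hsub : Ioc (f s) (f k) ⊆ A.pt γ ⁻¹' F := fun t ht =>
      (hfl t ⟨s, hs, ht.1⟩ ⟨k, hk, ht.2⟩).1
    have hcl := closure_minimal hsub (hclosed.preimage (A.continuous_pt γ))
    rw [closure_Ioc hsk.ne] at hcl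
    exact fun t h1 h2 => hcl ⟨h1, h2⟩
  have hon : ∀ t, f s ≤ t → t ≤ f k → A.pt γ t ∈ p.support := by
    intro t h1 h2
    obtain ⟨z, hz, hzt⟩ := hlevel p t h1 h2
    have hpt : f (A.pt γ t) = t := A.f_pt γ ⟨hscl.1.trans h1, h2.trans hkcl.2⟩
    suffices A.pt γ t = z by rwa [this]
    have hPF := hin t h1 h2
    have hzF := hpF z hz
    rcases h1.eq_or_lt with h | h
    · rw [hsu _ hPF (hpt.trans h.symm), hsu _ hzF (hzt.trans h.symm)]
    rcases h2.eq_or_lt with h' | h'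
    · rw [hku _ hPF (hpt.trans h'), hku _ hzF (hzt.trans h')]
    have hl : t ∈ Ioo (f A.lo) (f A.hi) := ⟨hscl.1.trans_lt h, h'.trans_le hkcl.2⟩
    exact (hfl t ⟨s, hs, h⟩ ⟨k, hk, h2⟩).unique A hF (hp z hz (hzt.symm ▸ hl))
      (hpt.trans hzt.symm) (hpt.symm ▸ hl)
  set a := γ.vertices.filter (fun v => decide (f v < f s)) with ha
  set b := γ.vertices.filter (fun v => decide (f k < f v)) with hb
  have hpv : ∀ x ∈ p.vertices, f s ≤ f x ∧ f x ≤ f k := fun x hx =>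
    ⟨hsle x (p.mem_of_mem_vertices hx), hkle x (p.mem_of_mem_vertices hx)⟩
  -- Both lists are strictly increasing for `f`, so it suffices that they have the same members;
  -- between source and sink `γ` runs along `p`.
  have hγ : γ.vertices = a ++ p.vertices ++ b := by
    apply eq_of_increasing_of_mem_iff γ.pairwise
    · rw [List.append_assoc, List.pairwise_append, List.pairwise_append]
      refine ⟨γ.pairwise.filter _, ⟨p.pairwise, γ.pairwise.filter _, ?_⟩, ?_⟩
      · intro x hx y hy
        simp only [hb, List.mem_filter, decide_eq_true_eq] at hy
        exact (hpv x hx).2.trans_lt hy.2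
      · intro x hx y hy
        simp only [ha, List.mem_filter, decide_eq_true_eq] at hx
        rcases List.mem_append.1 hy with hy | hy
        · exact hx.2.trans_le (hpv y hy).1
        · simp only [hb, List.mem_filter, decide_eq_true_eq] at hy
          exact hx.2.trans (hsk.trans hy.2)
    · intro x
      simp only [List.mem_append, ha, hb, List.mem_filter, decide_eq_true_eq]
      constructor
      · intro hx
        by_cases h1 : f x < f s
        · exact Or.inl (Or.inl ⟨hx, h1⟩)
        by_cases h2 : f k < f x
        · exact Or.inr ⟨hx, h2⟩
        push Not at h1 h2
        left; right
        have hxp := hon (f x) h1 h2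
        rw [A.pt_eq γ (A.mem_support_of_mem_vertices γ hx) rfl] at hxp
        refine p.mem_vertices_of_mem_support ⟨singleton_nonempty x, ?_, dim_singleton x⟩ hxp
        exact (γ.isVertex x hx).2.1.mono hFP (singleton_subset_iff.2 (hpF x hxp))
      · rintro ((h | h) | h)
        · exact h.1
        · have hxp : x ∈ p.support := mem_listSupport_of_mem (hlen p) h
          have := hon (f x) (hpv x h).1 (hpv x h).2
          have hxl : f x ∈ Icc (f A.lo) (f A.hi) := A.level_mem (hFP (hpF x hxp))
          have e := p.eq_of_mem_support this hxp (A.f_pt γ hxl)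
          exact γ.mem_vertices_of_mem_support (A.poly.isFaceOfDim_trans hF.2.1 (p.isVertex x h))
            (e ▸ A.pt_mem γ _)
        · exact h.1
  have hqP : q.vertices.IsChain (fun u v => IsEdge P u v ∧ f u < f v) :=
    q.chain.imp fun u v h => ⟨A.poly.isFaceOfDim_trans hF.2.1 h.1, h.2⟩
  have hne₁ : a ++ q.vertices ++ b ≠ [] := by
    have := q.ne_nil
    simp [this]
  have hhd : (a ++ q.vertices ++ b).head hne₁ = A.lo := by
    have e : (a ++ q.vertices ++ b).head? = γ.vertices.head? := by
      rw [hγ, List.append_assoc, List.append_assoc, List.head?_append, List.head?_append,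
        List.head?_append, List.head?_append, hhead? p, hhead? q]
    rw [List.head?_eq_some_head hne₁, List.head?_eq_some_head γ.ne_nil, A.head_eq] at e
    exact Option.some.inj e
  have hls : (a ++ q.vertices ++ b).getLast hne₁ = A.hi := by
    have e : (a ++ q.vertices ++ b).getLast? = γ.vertices.getLast? := by
      rw [hγ, List.getLast?_append, List.getLast?_append,
        List.getLast?_append, List.getLast?_append, hlast? p, hlast? q]
    rw [List.getLast?_eq_some_getLast hne₁, List.getLast?_eq_some_getLast γ.ne_nil,
      A.getLast_eq] at e
    exact Option.some.inj e
  let γ₁ : MonotonePath P f :=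
    { vertices := a ++ q.vertices ++ b
      ne_nil := hne₁
      isVertex := by
        intro x hx
        rcases List.mem_append.1 hx with hx | hx
        · rcases List.mem_append.1 hx with hx | hx
          · exact γ.isVertex x (List.mem_of_mem_filter hx)
          · exact A.poly.isFaceOfDim_trans hF.2.1 (q.isVertex x hx)
        · exact γ.isVertex x (List.mem_of_mem_filter hx)
      source := by rw [hhd]; exact A.lo_le
      sink := by rw [hls]; exact A.le_hi
      chain := isChain_replace (hγ ▸ γ.chain) hqP ((hhead? q).trans (hhead? p).symm)
        ((hlast? q).trans (hlast? p).symm) }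
  have hγ₁ : γ₁.vertices = a ++ q.vertices ++ b := rfl
  have hleft : ∀ t, Alive f F t → A.Lt F (A.pt γ₁ t) := by
    intro t ht
    have hl := A.alive_level hFP ht
    obtain ⟨⟨x, hx, hxt⟩, y, hy, hyt⟩ := ht
    obtain ⟨z, hz, hzt⟩ := hlevel q t ((hsle x hx).trans hxt.le) (hyt.le.trans (hkle y hy))
    have hz₁ : z ∈ γ₁.support := listSupport_mono ⟨a, b, rfl⟩ hz
    rw [A.pt_eq γ₁ hz₁ hzt]
    exact hq z hz (hzt.symm ▸ hl)
  have hsplit_head : ∀ r : MonotonePath F f, r.vertices = s :: r.vertices.tail := fun r => by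
    conv_lhs => rw [← List.cons_head_tail r.ne_nil, hhead]
  have hsplit_last : ∀ r : MonotonePath F f, r.vertices = r.vertices.dropLast ++ [k] := fun r => by
    conv_lhs => rw [← List.dropLast_append_getLast r.ne_nil, hlast]
  -- The lists `a ++ [s]` and `[k] ++ b` occur in both paths and cover all levels on which `F` is
  -- not alive.
  have hprefix : ∀ r : MonotonePath F f, (a ++ [s]) <:+: a ++ r.vertices ++ b := fun r => by
    conv_rhs => rw [hsplit_head r]
    exact ⟨[], r.vertices.tail ++ b, by simp⟩
  have hsuffix : ∀ r : MonotonePath F f, ([k] ++ b) <:+: a ++ r.vertices ++ b := fun r => by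
    conv_rhs => rw [hsplit_last r]
    exact ⟨a ++ r.vertices.dropLast, [], by simp⟩
  have haway : ∀ t ∈ Ioo (f A.lo) (f A.hi), ¬ Alive f F t → A.pt γ₁ t = A.pt γ t := by
    intro t ht hdead
    have hcases : t ≤ f s ∨ f k ≤ t := by
      by_contra! h
      exact hdead ⟨⟨s, hs, h.1⟩, k, hk, h.2⟩
    rcases hcases with h | h
    · have hane : a ≠ [] := by
        intro h0
        have e := A.head_eq γ
        have : γ.vertices.head? = some s := by rw [hγ, h0, List.nil_append, List.head?_append,
          hhead? p, Option.some_or]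
        rw [List.head?_eq_some_head γ.ne_nil, e] at this
        have := Option.some.inj this
        rw [this] at ht
        linarith [ht.1]
      apply A.pt_eq_of_common_infix (l := a ++ [s]) (hprefix q) (by rw [hγ]; exact hprefix p)
      · have := List.length_pos_iff.2 hane
        simp only [List.length_append, List.length_singleton]
        omega
      · have e : (a ++ [s]).head (by simp) = A.lo := by
          rw [← A.head_eq γ]
          simp only [hγ, List.append_assoc]
          rw [List.head_append_of_ne_nil hane, List.head_append_of_ne_nil hane]
        rw [e]
        exact ht.1.le
      · rw [List.getLast_append_of_ne_nil _ (by simp)]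
        simpa using h
    · have hbne : b ≠ [] := by
        intro h0
        have e := A.getLast_eq γ
        have : γ.vertices.getLast? = some k := by rw [hγ, h0, List.append_nil, List.getLast?_append,
          hlast? p, Option.some_or]
        rw [List.getLast?_eq_some_getLast γ.ne_nil, e] at this
        have := Option.some.inj this
        rw [this] at ht
        linarith [ht.2]
      apply A.pt_eq_of_common_infix (l := [k] ++ b) (hsuffix q) (by rw [hγ]; exact hsuffix p)
      · have := List.length_pos_iff.2 hbne
        simp only [List.length_append, List.length_singleton]
        omega
      · simpa using h
      · have e : ([k] ++ b).getLast (by simp) = A.hi := by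
          rw [← A.getLast_eq γ]
          simp only [hγ]
          rw [List.getLast_append_of_ne_nil _ hbne, List.getLast_append_of_ne_nil _ hbne]
        rw [e]
        exact ht.2.le
  refine ⟨γ₁, ⟨hF, p, q, ?_, a, b, hγ, rfl⟩, haway, hleft⟩
  rintro rfl
  -- Equal chains would make the two ends of a slice coincide at a level where `F` is alive.
  obtain ⟨t, ht1, ht2⟩ := exists_between hsk
  have hal : Alive f F t := ⟨⟨s, hs, ht1⟩, k, hk, ht2⟩
  have hl := A.alive_level hFP hal
  obtain ⟨u, w, -, hu, hw, -, hut, hwt, -, huw⟩ := A.exists_ends hF hal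
  obtain ⟨z, hz, hzt⟩ := hlevel p t ht1.le ht2.le
  rw [← (hp z hz (hzt.symm ▸ hl)).unique A hF hu (hzt.trans hut.symm) (hzt.symm ▸ hl),
    ← (hq z hz (hzt.symm ▸ hl)).unique A hF hw (hzt.trans hwt.symm) (hzt.symm ▸ hl), cr_self] at huw
  exact huw.false

/-- On a level where `F` is alive, the start of the swept arc moves from the right end to the left
end of the slice of `F`, so exactly `F` leaves the arc. On other levels neither the path nor the set
of swept alive facets changes. -/
theorem Inv.flip {A : Frame P f} {γ γ' γ₁ : MonotonePath P f} {S : Set (Set E)} (h : A.Inv γ γ' S)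
    {F : Set E} (hF : IsFaceOfDim P 2 F) (hFS : F ∈ S)
    (hr : ∀ t, Alive f F t → A.Rt F (A.pt γ t)) (hl : ∀ t, Alive f F t → A.Lt F (A.pt γ₁ t))
    (haway : ∀ t ∈ Ioo (f A.lo) (f A.hi), ¬ Alive f F t → A.pt γ₁ t = A.pt γ t) :
    A.Inv γ₁ γ' (S \ {F}) := by
  intro t ht
  obtain ⟨h1, h2⟩ := h t ht
  have htc := Ioo_subset_Icc_self ht
  by_cases hal : Alive f F t
  swap
  · rw [haway t ht hal]
    have hiff : ∀ H, Alive f H t → (H ∈ S \ {F} ↔ H ∈ S) := fun H hH => by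
      have : H ≠ F := fun e => hal (e ▸ hH)
      simp [this]
    exact ⟨fun hne H hH hHa z hz hzt => (hiff H hHa).trans (h1 hne H hH hHa z hz hzt),
      fun he H H' hH hH' hHa hHa' => (hiff H hHa).trans
        ((h2 he H H' hH hH' hHa hHa').trans (hiff H' hHa').symm)⟩
  have hR := hr t hal
  have hL := hl t hal
  set p := A.pt γ t with hp
  set q := A.pt γ₁ t with hq
  set x := A.pt γ' t with hx
  have hpt : f p = t := A.f_pt γ htc
  have hqt : f q = t := A.f_pt γ₁ htc
  have hxt : f x = t := A.f_pt γ' htc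
  have hxb : OnBoundary P x := A.pt_onBoundary γ' t
  obtain ⟨p', q', zF, hp', hq', hzF, hpt', hqt', hzFt, hpq⟩ := A.exists_ends hF hal
  rw [hp'.unique A hF hR (hpt'.trans hpt.symm) (hpt'.symm ▸ ht),
    hq'.unique A hF hL (hqt'.trans hqt.symm) (hqt'.symm ▸ ht)] at hpq
  have hother : ∀ H, IsFaceOfDim P 2 H → Alive f H t → ∀ z, A.OS H z → f z = t → H ≠ F →
      Ccw (A.dir q) (A.dir z) (A.dir p) := by
    intro H hH hHa z hz hzt hne
    refine A.ccw_lt_rt hF hR hL (hpt.trans hzt.symm) (hqt.trans hzt.symm) hpq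
      (A.facet_onBoundary hH hz.1) (hzt.symm ▸ ht) fun hzF' => hne ?_
    exact hz.facet_eq A hF hH (hzt.symm ▸ hHa) hzF'
  have hself : ∀ z, A.OS F z → f z = t → Ccw (A.dir p) (A.dir z) (A.dir q) := fun z hz hzt =>
    A.ccw_rt_os_lt hF hR hL hz (hpt.trans hzt.symm) (hqt.trans hzt.symm) (hzt.symm ▸ ht)
  constructor
  · intro hqx H hH hHa z hz hzt
    by_cases hHF : H = F
    · subst hHF
      simp only [mem_sdiff, mem_singleton_iff, not_true_eq_false, and_false, false_iff]
      intro hc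
      have h3 := hself z hz hzt
      by_cases hpx : p = x
      · rw [← hpx] at hc
        exact h3.asymm hc.rotate.rotate
      · have hxF : x ∉ H := by
          intro hxF
          rcases A.rt_or_lt_or_os hxF with h | h | h
          · exact hpx (hR.unique A hF h (hpt.trans hxt.symm) (hpt.symm ▸ ht))
          · exact hqx (hL.unique A hF h (hqt.trans hxt.symm) (hqt.symm ▸ ht))
          · exact A.pt_not_os γ' hF ht h
        have h4 := A.ccw_lt_rt hF hR hL (hpt.trans hxt.symm) (hqt.trans hxt.symm) hpq hxb
          (hxt.symm ▸ ht) hxF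
        have h5 := h4.trans h3.rotate.rotate
        exact h5.asymm hc
    · have h3 := hother H hH hHa z hz hzt hHF
      simp only [mem_sdiff, mem_singleton_iff, hHF, not_false_eq_true, and_true]
      by_cases hpx : p = x
      · rw [← hpx]
        -- Here `γ` and `γ'` meet, and `F ∈ S` says that the full circle is swept.
        exact ⟨fun _ => h3, fun _ => (h2 hpx F H hF hH hal hHa).1 hFS⟩
      · rw [h1 hpx H hH hHa z hz hzt]
        have hxF : x ∉ F := by
          intro hxF
          rcases A.rt_or_lt_or_os hxF with h | h | h
          · exact hpx (hR.unique A hF h (hpt.trans hxt.symm) (hpt.symm ▸ ht))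
          · exact hqx (hL.unique A hF h (hqt.trans hxt.symm) (hqt.symm ▸ ht))
          · exact A.pt_not_os γ' hF ht h
        have h4 := A.ccw_lt_rt hF hR hL (hpt.trans hxt.symm) (hqt.trans hxt.symm) hpq hxb
          (hxt.symm ▸ ht) hxF
        constructor
        · intro hc
          exact h3.rotate.rotate.trans_right hc
        · intro hc
          exact (hc.trans_right h4).rotate.rotate
  · intro hqx H H' hH hH' hHa hHa'
    have hpx : p ≠ x := by
      intro e
      rw [hqx, ← e, cr_self] at hpq
      exact hpq.false
    -- After the flip the paths meet: the arc consisted of the slice of `F` alone, so no alive facet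
    -- is left.
    have hnone : ∀ H, IsFaceOfDim P 2 H → Alive f H t → H ∉ S \ {F} := by
      intro H hH hHa hHS
      obtain ⟨-, -, z, -, -, hz, -, -, hzt, -⟩ := A.exists_ends hH hHa
      have h3 := hother H hH hHa z hz hzt hHS.2
      have h4 := (h1 hpx H hH hHa z hz hzt).1 hHS.1
      rw [← hqx] at h4
      exact h4.asymm h3.rotate.rotate
    exact ⟨fun hh => absurd hh (hnone H hH hHa), fun hh => absurd hh (hnone H' hH' hHa')⟩

/-- The number of flips between two paths is at most the number of facets swept between them. -/
theorem Inv.dist_le {A : Frame P f} {γ γ' : MonotonePath P f} {S : Set (Set E)} (h : A.Inv γ γ' S)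
    (hS : ∀ F ∈ S, IsFaceOfDim P 2 F) :
    (flipGraph P f).Reachable γ γ' ∧ (flipGraph P f).dist γ γ' ≤ S.ncard := by
  have hfin : S.Finite := (A.poly.finite_faces 2).subset hS
  induction hn : S.ncard generalizing S γ with
  | zero =>
    rw [Set.ncard_eq_zero hfin] at hn
    subst hn
    rw [h.eq_of_empty]
    simp
  | succ n ih =>
    have hne : S.Nonempty := by
      rw [Set.nonempty_iff_ne_empty]
      rintro rfl
      simp at hn
    obtain ⟨F, hFS, hfl⟩ := A.exists_flippable γ hS hne fun F hF G hG t h1 h2 h3 =>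
      h.left_mem (hS F hF) hG hF h1 h2 h3
    obtain ⟨γ₁, hd, h1, h2⟩ := A.exists_flip γ (hS F hFS) hfl
    have hinv := h.flip (hS F hFS) hFS (fun t ht => hfl t ht.1
      (by obtain ⟨y, hy, h⟩ := ht.2; exact ⟨y, hy, h.le⟩)) h2 h1
    have hcard : (S \ {F}).ncard = n := by
      rw [Set.ncard_sdiff_singleton_of_mem hFS, hn]
      omega
    obtain ⟨hre, hdist⟩ := ih hinv (fun G hG => hS G hG.1) (hfin.subset sdiff_subset) hcard
    have hadj : (flipGraph P f).Adj γ γ₁ := ⟨F, hd⟩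
    refine ⟨hadj.reachable.trans hre, ?_⟩
    obtain ⟨w, hw⟩ := hre.exists_walk_length_eq_dist
    have := SimpleGraph.dist_le (SimpleGraph.Walk.cons hadj w)
    rw [SimpleGraph.Walk.length_cons] at this
    omega

end Frame

end MonotoneFlip

/-! ### The swept set of two paths that differ on one interval. -/

namespace MonotoneFlip

open Set Filter Topology

variable {E : Type*} [NormedAddCommGroup E] [NormedSpace ℝ E] [FiniteDimensional ℝ E]

theorem continuous_cr {α : Type*} [TopologicalSpace α] {g g' : α → ℝ × ℝ} (h : Continuous g)
    (h' : Continuous g') : Continuous fun y => cr (g y) (g' y) := by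
  unfold cr
  fun_prop

theorem continuous_dt {α : Type*} [TopologicalSpace α] {g g' : α → ℝ × ℝ} (h : Continuous g)
    (h' : Continuous g') : Continuous fun y => dt (g y) (g' y) := by
  unfold dt
  fun_prop

theorem isOpen_ccw {α : Type*} [TopologicalSpace α] {g₁ g₂ g₃ : α → ℝ × ℝ} (h₁ : Continuous g₁)
    (h₂ : Continuous g₂) (h₃ : Continuous g₃) : IsOpen {y | Ccw (g₁ y) (g₂ y) (g₃ y)} := by
  have hcr : ∀ {g g' : α → ℝ × ℝ}, Continuous g → Continuous g' →
      IsOpen {y | 0 < cr (g y) (g' y)} := fun h h' =>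
    isOpen_lt continuous_const (continuous_cr h h')
  exact ((hcr h₁ h₂).inter (hcr h₂ h₃)).union
    (((hcr h₂ h₃).inter (hcr h₃ h₁)).union ((hcr h₃ h₁).inter (hcr h₁ h₂)))

namespace Frame

variable {P : Set E} {f : E →ₗ[ℝ] ℝ}

/-- Contracting towards `w` carries along the two points of the slice that flank `z`, and they still
flank the image. -/
theorem os_combo (A : Frame P f) {F : Set E} (hF : IsFaceOfDim P 2 F) {z w : E} (hz : A.OS F z)
    (hw : w ∈ F) {r s : ℝ} (hr : 0 < r) (hs : 0 ≤ s) (hrs : r + s = 1)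
    (hlz : f z ∈ Ioo (f A.lo) (f A.hi))
    (hl : f (r • z + s • w) ∈ Ioo (f A.lo) (f A.hi)) : A.OS F (r • z + s • w) := by
  obtain ⟨h, -, h2⟩ := A.exists_slice_coordinate hF
  obtain ⟨hzF, y₁, hy₁, y₂, hy₂, e₁, e₂, c₁, c₂⟩ := hz
  have i₁ := (h2 y₁ hy₁ z hzF e₁ (e₁ ▸ hlz)).1 c₁
  have i₂ := (h2 z hzF y₂ hy₂ e₂.symm hlz).1 c₂
  have hconv := A.facet_convex hF
  have m := hconv hzF hw hr.le hs hrs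
  have m₁ := hconv hy₁ hw hr.le hs hrs
  have m₂ := hconv hy₂ hw hr.le hs hrs
  have f₁ : f (r • y₁ + s • w) = f (r • z + s • w) := by simp [e₁]
  have f₂ : f (r • y₂ + s • w) = f (r • z + s • w) := by simp [e₂]
  refine ⟨m, _, m₁, _, m₂, f₁, f₂, ?_, ?_⟩
  · rw [h2 _ m₁ _ m f₁ (f₁ ▸ hl)]
    simp only [map_add, map_smul, smul_eq_mul]
    nlinarith
  · rw [h2 _ m _ m₂ f₂.symm hl]
    simp only [map_add, map_smul, smul_eq_mul]
    nlinarith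

/-- The points of the open slices of `F` on the levels between `a` and `b`. -/
def strip (A : Frame P f) (F : Set E) (a b : ℝ) : Set E := {y | A.OS F y ∧ f y ∈ Ioo a b}

theorem convex_strip (A : Frame P f) {F : Set E} (hF : IsFaceOfDim P 2 F) {a b : ℝ}
    (ha : f A.lo ≤ a) (hb : b ≤ f A.hi) : Convex ℝ (A.strip F a b) := by
  intro x hx y hy r s hr hs hrs
  have hlev : f (r • x + s • y) ∈ Ioo a b := by
    have := convex_Ioo a b hx.2 hy.2 hr hs hrs
    simpa using this
  have hsub : Ioo a b ⊆ Ioo (f A.lo) (f A.hi) := Ioo_subset_Ioo ha hb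
  refine ⟨?_, hlev⟩
  rcases hr.eq_or_lt with h | h
  · rw [add_comm] at hlev hrs ⊢
    exact A.os_combo hF hy.1 hx.1.1 (by linarith) hr hrs (hsub hy.2) (hsub hlev)
  · exact A.os_combo hF hx.1 hy.1.1 h hs hrs (hsub hx.2) (hsub hlev)

/-- On its level, `y` comes after `γ` and before `γ'` in counterclockwise order. -/
def Between (A : Frame P f) (γ γ' : MonotonePath P f) (y : E) : Prop :=
  Ccw (A.dir (A.pt γ (f y))) (A.dir y) (A.dir (A.pt γ' (f y)))

theorem isOpen_between (A : Frame P f) (γ γ' : MonotonePath P f) :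
    IsOpen {y | A.Between γ γ' y} := by
  have hf : Continuous f := LinearMap.continuous_of_finiteDimensional f
  exact isOpen_ccw (A.continuous_dir.comp ((A.continuous_pt γ).comp hf)) A.continuous_dir
    (A.continuous_dir.comp ((A.continuous_pt γ').comp hf))

theorem not_between_iff (A : Frame P f) {γ γ' : MonotonePath P f} {F : Set E}
    (hF : IsFaceOfDim P 2 F) {y : E} (hy : A.OS F y) (hl : f y ∈ Ioo (f A.lo) (f A.hi))
    (hne : A.pt γ (f y) ≠ A.pt γ' (f y)) : ¬ A.Between γ γ' y ↔ A.Between γ' γ y := by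
  have hc := Ioo_subset_Icc_self hl
  exact A.not_ccw_iff (A.pt_onBoundary γ _) (A.pt_onBoundary γ' _) (A.facet_onBoundary hF hy.1) hl
    (A.f_pt γ hc) (A.f_pt γ' hc) hne (fun e => A.pt_not_os γ hF hl (by rwa [e]))
    (fun e => A.pt_not_os γ' hF hl (by rwa [e]))

/-- The strip is convex, hence connected, and the disjoint open conditions `Between γ γ'` and
`Between γ' γ` cover it. -/
theorem between_iff_of_strip (A : Frame P f) {γ γ' : MonotonePath P f} {a b : ℝ}
    (ha : f A.lo ≤ a) (hb : b ≤ f A.hi) (hab : ∀ t ∈ Ioo a b, A.pt γ t ≠ A.pt γ' t) {F : Set E}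
    (hF : IsFaceOfDim P 2 F) {y z : E} (hy : y ∈ A.strip F a b) (hz : z ∈ A.strip F a b) :
    A.Between γ γ' y ↔ A.Between γ γ' z := by
  have hsub : Ioo a b ⊆ Ioo (f A.lo) (f A.hi) := Ioo_subset_Ioo ha hb
  have hnot : ∀ x ∈ A.strip F a b, (¬ A.Between γ γ' x ↔ A.Between γ' γ x) := fun x hx =>
    A.not_between_iff hF hx.1 (hsub hx.2) (hab _ hx.2)
  have hpre := (A.convex_strip hF ha hb).isPreconnected
  rw [isPreconnected_iff_subset_of_disjoint] at hpre
  have := hpre _ _ (A.isOpen_between γ γ') (A.isOpen_between γ' γ) (by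
    intro x hx
    by_cases h : A.Between γ γ' x
    · exact Or.inl h
    · exact Or.inr ((hnot x hx).1 h)) (by
    rw [Set.eq_empty_iff_forall_notMem]
    rintro x ⟨hx, h1, h2⟩
    exact (hnot x hx).2 h2 h1)
  rcases this with h | h
  · exact ⟨fun _ => h hz, fun _ => h hy⟩
  · exact ⟨fun hh => absurd hh ((hnot y hy).2 (h hy)), fun hh => absurd hh ((hnot z hz).2 (h hz))⟩

/-- Near a level `c` where two paths meet, a facet lies between them exactly when the paths are
clockwise close to each other. -/
theorem exists_between_iff_frequently (A : Frame P f) {γ γ' : MonotonePath P f} {a b : ℝ}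
    (ha : f A.lo ≤ a) (hb : b ≤ f A.hi) (hab : ∀ t ∈ Ioo a b, A.pt γ t ≠ A.pt γ' t) {F : Set E}
    (hF : IsFaceOfDim P 2 F) {c : ℝ} (hal : Alive f F c) (hc : A.pt γ c = A.pt γ' c)
    {l : Filter ℝ} [l.NeBot] (hl : l ≤ 𝓝 c) {w : E} (hw : w ∈ F) (hwc : f w ≠ c)
    (hev : ∀ᶠ t in l, t ∈ Ioo a b ∧ 0 ≤ (t - c) / (f w - c) ∧ (t - c) / (f w - c) < 1) :
    (∃ y ∈ A.strip F a b, A.Between γ γ' y) ↔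
      ∃ᶠ t in l, 0 < cr (A.dir (A.pt γ' t)) (A.dir (A.pt γ t)) := by
  have hcl := A.alive_level hF.subset hal
  have hsub : Ioo a b ⊆ Ioo (f A.lo) (f A.hi) := Ioo_subset_Ioo ha hb
  obtain ⟨-, -, y, -, -, hy, -, -, hyc, -⟩ := A.exists_ends hF hal
  have hw0 : f w - c ≠ 0 := sub_ne_zero.2 hwc
  -- `z t` moves from the slice point `y` on the level `c` towards `w`, with `z t` on the level `t`.
  -- Near `c` it stays away from the common direction `v` of the two paths, so its position relative
  -- to them reflects only their mutual order.
  set z : ℝ → E := fun t => (1 - (t - c) / (f w - c)) • y + ((t - c) / (f w - c)) • w with hz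
  have hfz : ∀ t, f (z t) = t := by
    intro t
    simp only [hz, map_add, map_smul, smul_eq_mul, hyc]
    field_simp
    ring
  have hzc : z c = y := by simp [hz]
  have hzcont : Continuous z := by
    simp only [hz]
    fun_prop
  have hstrip : ∀ᶠ t in l, z t ∈ A.strip F a b := by
    filter_upwards [hev] with t ht
    refine ⟨A.os_combo hF hy hw (by linarith [ht.2.2]) ht.2.1 (by ring) (hyc.symm ▸ hcl) ?_, ?_⟩
    · have := hfz t
      simp only [hz] at this
      rw [this]
      exact hsub ht.1
    · rw [hfz]
      exact ht.1
  set v := A.dir (A.pt γ c) with hv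
  have hvv : 0 < dt v v := A.dir_ne_zero (A.pt_onBoundary γ c)
    (by rwa [A.f_pt γ (Ioo_subset_Icc_self hcl)])
  have hdist : DistinctRays v (A.dir y) := A.distinctRays (A.pt_onBoundary γ c)
    (A.facet_onBoundary hF hy.1) ((A.f_pt γ (Ioo_subset_Icc_self hcl)).trans hyc.symm)
    (by rwa [A.f_pt γ (Ioo_subset_Icc_self hcl)]) (fun e => A.pt_not_os γ hF hcl (e ▸ hy))
  have c1 : Continuous fun t => A.dir (A.pt γ t) := A.continuous_dir.comp (A.continuous_pt γ)
  have c2 : Continuous fun t => A.dir (A.pt γ' t) := A.continuous_dir.comp (A.continuous_pt γ')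
  have c3 : Continuous fun t => A.dir (z t) := A.continuous_dir.comp hzcont
  have ev1 : ∀ᶠ t in 𝓝 c, 0 < dt v (A.dir (A.pt γ t)) := by
    refine Continuous.tendsto (f := fun t => dt v (A.dir (A.pt γ t))) ?_ c |>.eventually
      (lt_mem_nhds hvv)
    exact continuous_dt continuous_const c1
  have ev2 : ∀ᶠ t in 𝓝 c, 0 < dt v (A.dir (A.pt γ' t)) := by
    refine Continuous.tendsto (f := fun t => dt v (A.dir (A.pt γ' t))) ?_ c |>.eventually
      (lt_mem_nhds (by rw [← hc]; exact hvv))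
    exact continuous_dt continuous_const c2
  have ev3 : ∀ᶠ t in 𝓝 c, 0 < cr (A.dir (A.pt γ t)) (A.dir (z t)) *
      cr (A.dir (A.pt γ' t)) (A.dir (z t)) ∨ dt v (A.dir (z t)) < 0 := by
    rcases hdist with h | h
    · have : ∀ᶠ t in 𝓝 c, 0 < cr (A.dir (A.pt γ t)) (A.dir (z t)) *
          cr (A.dir (A.pt γ' t)) (A.dir (z t)) := by
        refine Continuous.tendsto (f := fun t => cr (A.dir (A.pt γ t)) (A.dir (z t)) *
          cr (A.dir (A.pt γ' t)) (A.dir (z t))) ?_ c |>.eventually (lt_mem_nhds ?_)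
        · exact (continuous_cr c1 c3).mul (continuous_cr c2 c3)
        · rw [← hc, hzc]
          exact mul_self_pos.2 h
      filter_upwards [this] with t ht using Or.inl ht
    · have : ∀ᶠ t in 𝓝 c, dt v (A.dir (z t)) < 0 := by
        refine Continuous.tendsto (f := fun t => dt v (A.dir (z t))) ?_ c |>.eventually
          (gt_mem_nhds (by rw [hzc]; exact h))
        exact continuous_dt continuous_const c3
      filter_upwards [this] with t ht using Or.inr ht
  have key : ∀ᶠ t in l, z t ∈ A.strip F a b ∧
      (A.Between γ γ' (z t) ↔ 0 < cr (A.dir (A.pt γ' t)) (A.dir (A.pt γ t))) := by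
    filter_upwards [hstrip, hl ev1, hl ev2, hl ev3] with t hs h1 h2 h3
    refine ⟨hs, fun h => ?_, fun h => ?_⟩
    · rw [Between, hfz] at h
      exact cr_pos_of_ccw_near h1 h2 h3 h
    · by_contra hn
      rw [A.not_between_iff hF hs.1 (hsub hs.2) (hab _ hs.2), Between, hfz] at hn
      have := cr_pos_of_ccw_near h2 h1 (by rwa [mul_comm]) hn
      rw [cr_swap] at this
      linarith
  constructor
  · rintro ⟨y', hy', hb'⟩
    -- By `key` and connectedness of the strip the sign is even eventually constant along `l`.
    apply Eventually.frequently
    filter_upwards [key] with t ht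
    exact ht.2.1 ((A.between_iff_of_strip ha hb hab hF hy' ht.1).1 hb')
  · intro h
    obtain ⟨t, h1, h2⟩ := (h.and_eventually key).exists
    exact ⟨z t, h2.1, h2.2.2 h1⟩

/-- Two paths that differ exactly on the levels between `a` and `b` sweep a set of facets. -/
theorem exists_inv (A : Frame P f) {γ γ' : MonotonePath P f} {a b : ℝ} (hlt : a < b)
    (ha : f A.lo ≤ a) (hb : b ≤ f A.hi) (hab : ∀ t ∈ Ioo a b, A.pt γ t ≠ A.pt γ' t)
    (heq : ∀ t, t ∉ Ioo a b → A.pt γ t = A.pt γ' t) :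
    ∃ S : Set (Set E), (∀ F ∈ S, IsFaceOfDim P 2 F) ∧ A.Inv γ γ' S := by
  -- Just above `a`, having `γ` slightly counterclockwise of `γ'` means that the arc from `γ` to
  -- `γ'` is almost the full circle. So `εa` decides whether everything at and below `a` counts as
  -- swept, and `εb` does the same at and above `b`.
  set εa : Prop := ∃ᶠ t in 𝓝[>] a, 0 < cr (A.dir (A.pt γ' t)) (A.dir (A.pt γ t)) with hεa
  set εb : Prop := ∃ᶠ t in 𝓝[<] b, 0 < cr (A.dir (A.pt γ' t)) (A.dir (A.pt γ t)) with hεb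
  set S : Set (Set E) := {F | IsFaceOfDim P 2 F ∧ ((∃ y ∈ A.strip F a b, A.Between γ γ' y) ∨
    ((∀ y ∈ F, f y ≤ a) ∧ εa) ∨ ((∀ y ∈ F, b ≤ f y) ∧ εb))} with hS
  refine ⟨S, fun F hF => hF.1, ?_⟩
  have hlow : ∀ t ≤ a, ∀ H, IsFaceOfDim P 2 H → Alive f H t → (H ∈ S ↔ εa) := by
    intro t hta H hH hal
    obtain ⟨⟨x, hx, hxt⟩, hal2⟩ := hal
    have hnb : ¬ ∀ y ∈ H, b ≤ f y := fun h => by linarith [h x hx]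
    simp only [hS, mem_ofPred_eq, hH, true_and, hnb, false_and, or_false]
    by_cases hHa : ∀ y ∈ H, f y ≤ a
    · have : ¬ ∃ y ∈ A.strip H a b, A.Between γ γ' y := by
        rintro ⟨y, hy, -⟩
        exact absurd hy.2.1 (not_lt.2 (hHa y hy.1.1))
      exact ⟨fun h => h.elim (fun h => absurd h this) (·.2), fun h => Or.inr ⟨hHa, h⟩⟩
    · simp only [hHa, false_and, or_false]
      push Not at hHa
      obtain ⟨w, hw, hwa⟩ := hHa
      apply A.exists_between_iff_frequently ha hb hab hH (c := a) ⟨⟨x, hx, hxt.trans_le hta⟩, w, hw,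
        hwa⟩ (heq a (by simp)) nhdsWithin_le_nhds hw hwa.ne'
      have : Ioo a (min b (f w)) ∈ 𝓝[>] a := Ioo_mem_nhdsGT (lt_min hlt hwa)
      filter_upwards [this] with s hs
      have h0 : 0 < f w - a := by linarith
      refine ⟨⟨hs.1, hs.2.trans_le (min_le_left _ _)⟩, div_nonneg (by linarith [hs.1]) h0.le,
        (div_lt_one h0).2 ?_⟩
      linarith [hs.2.trans_le (min_le_right b (f w))]
  have hhigh : ∀ t, b ≤ t → ∀ H, IsFaceOfDim P 2 H → Alive f H t → (H ∈ S ↔ εb) := by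
    intro t hta H hH hal
    obtain ⟨hal1, x, hx, hxt⟩ := hal
    have hnb : ¬ ∀ y ∈ H, f y ≤ a := fun h => by linarith [h x hx]
    simp only [hS, mem_ofPred_eq, hH, true_and, hnb, false_and, false_or]
    by_cases hHb : ∀ y ∈ H, b ≤ f y
    · have : ¬ ∃ y ∈ A.strip H a b, A.Between γ γ' y := by
        rintro ⟨y, hy, -⟩
        exact absurd hy.2.2 (not_lt.2 (hHb y hy.1.1))
      exact ⟨fun h => h.elim (fun h => absurd h this) (·.2), fun h => Or.inr ⟨hHb, h⟩⟩
    · simp only [hHb, false_and, or_false]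
      push Not at hHb
      obtain ⟨w, hw, hwb⟩ := hHb
      apply A.exists_between_iff_frequently ha hb hab hH (c := b) ⟨⟨w, hw, hwb⟩, x, hx,
        hta.trans_lt hxt⟩ (heq b (by simp)) nhdsWithin_le_nhds hw hwb.ne
      have : Ioo (max a (f w)) b ∈ 𝓝[<] b := Ioo_mem_nhdsLT (max_lt hlt hwb)
      filter_upwards [this] with s hs
      have h0 : f w - b < 0 := by linarith
      refine ⟨⟨(le_max_left _ _).trans_lt hs.1, hs.2⟩,
        div_nonneg_of_nonpos (by linarith [hs.2]) h0.le, (div_lt_one_of_neg h0).2 ?_⟩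
      linarith [(le_max_right a (f w)).trans_lt hs.1]
  intro t ht
  by_cases htab : t ∈ Ioo a b
  · refine ⟨fun _ H hH hal z hz hzt => ?_, fun he => absurd he (hab t htab)⟩
    have hzs : z ∈ A.strip H a b := ⟨hz, hzt.symm ▸ htab⟩
    obtain ⟨⟨x, hx, hxt⟩, y, hy, hyt⟩ := hal
    have h1 : ¬ ∀ y ∈ H, f y ≤ a := fun h => by linarith [h y hy, htab.1]
    have h2 : ¬ ∀ y ∈ H, b ≤ f y := fun h => by linarith [h x hx, htab.2]
    simp only [hS, mem_ofPred_eq, hH, true_and, h1, h2, false_and, or_false]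
    have e : A.Between γ γ' z ↔
        Ccw (A.dir (A.pt γ t)) (A.dir z) (A.dir (A.pt γ' t)) := by rw [Between, hzt]
    rw [← e]
    exact ⟨fun ⟨y, hy, hby⟩ => (A.between_iff_of_strip ha hb hab hH hy hzs).1 hby,
      fun h => ⟨z, hzs, h⟩⟩
  · refine ⟨fun hne => absurd (heq t htab) hne, fun _ H H' hH hH' hal hal' => ?_⟩
    by_cases hta : t ≤ a
    · rw [hlow t hta H hH hal, hlow t hta H' hH' hal']
    · have htb : b ≤ t := by
        by_contra h
        exact htab ⟨not_le.1 hta, not_le.1 h⟩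
      rw [hhigh t htb H hH hal, hhigh t htb H' hH' hal']

/-- Two paths that differ exactly on the levels between `a` and `b` are at distance at most half
the number of facets. -/
theorem two_mul_dist_le (A : Frame P f) {γ γ' : MonotonePath P f} {a b : ℝ} (hlt : a < b)
    (ha : f A.lo ≤ a) (hb : b ≤ f A.hi) (hab : ∀ t ∈ Ioo a b, A.pt γ t ≠ A.pt γ' t)
    (heq : ∀ t, t ∉ Ioo a b → A.pt γ t = A.pt γ' t) :
    (flipGraph P f).Reachable γ γ' ∧ 2 * (flipGraph P f).dist γ γ' ≤ numFaces 2 P := by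
  obtain ⟨S, hS, hinv⟩ := A.exists_inv hlt ha hb hab heq
  obtain ⟨hr, h1⟩ := hinv.dist_le hS
  -- Sweeping the other way round uses the complementary facets, so the two bounds add up to the
  -- number of all facets.
  obtain ⟨-, h2⟩ := hinv.swap.dist_le fun F hF => hF.1
  rw [SimpleGraph.dist_comm] at h2
  have hfin := A.poly.finite_faces 2
  have := Set.ncard_sdiff_add_ncard_of_subset (s := S) (t := {F | IsFaceOfDim P 2 F}) hS hfin
  refine ⟨hr, ?_⟩
  unfold numFaces
  omega

end Frame

end MonotoneFlip

/-! ### Components of the disagreement set, splicing of paths, and the induction. -/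

namespace MonotoneFlip

open Set

theorem connectedComponents_coe_eq_iff {S : Set ℝ} (x y : S) :
    (x : ConnectedComponents S) = y ↔ uIcc (x : ℝ) y ⊆ S := by
  rw [ConnectedComponents.coe_eq_coe']
  constructor
  · intro h
    have hc : IsPreconnected (Subtype.val '' connectedComponent y) :=
      isPreconnected_connectedComponent.image _ continuous_subtype_val.continuousOn
    exact (hc.ordConnected.uIcc_subset ⟨x, h, rfl⟩ ⟨y, mem_connectedComponent, rfl⟩).trans (by simp)
  · intro h
    have hp : IsPreconnected (Subtype.val ⁻¹' uIcc (x : ℝ) y : Set S) := by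
      rw [← Topology.IsInducing.subtypeVal.isPreconnected_image, Subtype.image_preimage_coe,
        inter_eq_right.2 h]
      exact isPreconnected_uIcc
    exact hp.subset_connectedComponent right_mem_uIcc left_mem_uIcc

/-- A point of `S` is recorded by the elements of `V` below it and those not above it. Equal records
mean that no element of `V` lies in the closed interval between the points, so components inject
into a finite set. -/
theorem finite_connectedComponents_of_signature {S : Set ℝ} {V : Set ℝ} (hV : V.Finite)
    (h : ∀ s ∈ S, ∀ t ∈ S, s < t → (∀ v ∈ V, v ∉ Icc s t) → Icc s t ⊆ S) :
    Finite (ConnectedComponents S) := by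
  have : Finite V := hV
  let φ : S → Set V × Set V := fun s => ({v | (v : ℝ) < s}, {v | (v : ℝ) ≤ s})
  have key : ∀ s t : S, (s : ℝ) < t → φ s = φ t → (s : ConnectedComponents S) = t := by
    intro s t hst e
    rw [connectedComponents_coe_eq_iff, uIcc_of_le hst.le]
    refine h s s.2 t t.2 hst fun v hv hvst => ?_
    have e1 : (v < s ↔ v < t) := by
      simpa [φ] using Set.ext_iff.1 (congrArg Prod.fst e) ⟨v, hv⟩
    have e2 : (v ≤ s ↔ v ≤ t) := by
      simpa [φ] using Set.ext_iff.1 (congrArg Prod.snd e) ⟨v, hv⟩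
    have h1 := e2.2 hvst.2
    exact absurd (e1.2 (h1.trans_lt hst)) (not_lt.2 hvst.1)
  have hsurj : ∀ s t : S, φ s = φ t → (s : ConnectedComponents S) = t := by
    intro s t e
    rcases lt_trichotomy (s : ℝ) t with hst | hst | hst
    · exact key s t hst e
    · rw [Subtype.ext hst]
    · exact (key t s hst e.symm).symm
  let ψ : ConnectedComponents S → Set V × Set V := fun c =>
    φ (ConnectedComponents.surjective_coe c).choose
  refine Finite.of_injective ψ fun c d hcd => ?_
  rw [← (ConnectedComponents.surjective_coe c).choose_spec,
    ← (ConnectedComponents.surjective_coe d).choose_spec]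
  exact hsurj _ _ hcd

/-- Removing a component from a set of reals lowers the number of its components. -/
theorem card_connectedComponents_diff_lt {S : Set ℝ} [Finite (ConnectedComponents S)] {a b t : ℝ}
    (ha : a ∉ S) (hb : b ∉ S) (ht : t ∈ Ioo a b) (htS : t ∈ S) :
    Finite (ConnectedComponents ↥(S \ Ioo a b)) ∧
      Nat.card (ConnectedComponents ↥(S \ Ioo a b)) < Nat.card (ConnectedComponents S) := by
  let ι : ↥(S \ Ioo a b) → S := fun x => ⟨x, x.2.1⟩
  have hι : Continuous ι := by fun_prop
  let φ := hι.connectedComponentsMap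
  have hφ : ∀ x : ↥(S \ Ioo a b), φ x = (ι x : ConnectedComponents S) := fun _ => rfl
  -- An interval with ends outside `Ioo a b` that meets `Ioo a b` contains `a` or `b`, so it is not
  -- inside `S`. For the same reason the component of `t` is not in the range.
  have hinj : Function.Injective φ := by
    intro c d h
    obtain ⟨x, rfl⟩ := ConnectedComponents.surjective_coe c
    obtain ⟨y, rfl⟩ := ConnectedComponents.surjective_coe d
    rw [hφ, hφ, connectedComponents_coe_eq_iff] at h
    rw [connectedComponents_coe_eq_iff]
    refine fun z hz => ⟨h hz, fun hz' => ?_⟩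
    have hx := x.2.2
    have hy := y.2.2
    have h1 : a ∉ uIcc (x : ℝ) y := fun h' => ha (h h')
    have h2 : b ∉ uIcc (x : ℝ) y := fun h' => hb (h h')
    simp only [mem_uIcc, mem_Ioo] at *
    grind
  have hns : (t : ℝ) ∉ S \ Ioo a b := fun h => h.2 ht
  have hnot : ∀ c, φ c ≠ ((⟨t, htS⟩ : S) : ConnectedComponents S) := by
    intro c h
    obtain ⟨x, rfl⟩ := ConnectedComponents.surjective_coe c
    rw [hφ, connectedComponents_coe_eq_iff] at h
    have hx := x.2.2
    have h1 : a ∉ uIcc (x : ℝ) t := fun h' => ha (h h')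
    have h2 : b ∉ uIcc (x : ℝ) t := fun h' => hb (h h')
    simp only [mem_uIcc, mem_Ioo] at *
    grind
  refine ⟨Finite.of_injective φ hinj, ?_⟩
  have := Fintype.ofFinite (ConnectedComponents S)
  have := Finite.of_injective φ hinj
  have := Fintype.ofFinite (ConnectedComponents ↥(S \ Ioo a b))
  rw [Nat.card_eq_fintype_card, Nat.card_eq_fintype_card]
  exact Fintype.card_lt_of_injective_of_notMem φ hinj (b := ((⟨t, htS⟩ : S) : ConnectedComponents S))
    (by rintro ⟨c, hc⟩; exact hnot c hc)

/-- The ends are the nearest points of the closed complement on either side of `t`. -/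
theorem exists_maximal_Ioo {S : Set ℝ} (hS : IsOpen S) {l r t : ℝ} (hl : l ∉ S) (hr : r ∉ S)
    (hlt : l ≤ t) (htr : t ≤ r) (ht : t ∈ S) :
    ∃ a b, l ≤ a ∧ b ≤ r ∧ t ∈ Ioo a b ∧ a ∉ S ∧ b ∉ S ∧ Ioo a b ⊆ S := by
  have hba : BddAbove (Sᶜ ∩ Iic t) := ⟨t, fun _ h => h.2⟩
  have hbb : BddBelow (Sᶜ ∩ Ici t) := ⟨t, fun _ h => h.2⟩
  have ha := (hS.isClosed_compl.inter isClosed_Iic).csSup_mem ⟨l, hl, hlt⟩ hba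
  have hb := (hS.isClosed_compl.inter isClosed_Ici).csInf_mem ⟨r, hr, htr⟩ hbb
  refine ⟨_, _, le_csSup hba ⟨hl, hlt⟩, csInf_le hbb ⟨hr, htr⟩, ⟨lt_of_le_of_ne ha.2 ?_,
    lt_of_le_of_ne hb.2 ?_⟩, ha.1, hb.1, fun x hx => ?_⟩
  · intro h
    exact ha.1 (by rw [h]; exact ht)
  · intro h
    exact hb.1 (by rw [← h]; exact ht)
  · by_contra hxS
    rcases le_total x t with h | h
    · exact absurd (le_csSup hba ⟨hxS, h⟩) (not_le.2 hx.1)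
    · exact absurd (csInf_le hbb ⟨hxS, h⟩) (not_le.2 hx.2)

variable {E : Type*} [NormedAddCommGroup E] [NormedSpace ℝ E]

/-- Two edges that meet at an inner point of both coincide. -/
theorem IsPolytope.edge_eq_of_inner [FiniteDimensional ℝ E] {P : Set E} {f : E →ₗ[ℝ] ℝ}
    (hP : IsPolytope P) {u v u' v' x : E} (he : IsEdge P u v) (he' : IsEdge P u' v')
    (huv' : f u' < f v') (hx : x ∈ segment ℝ u v) (hx' : x ∈ segment ℝ u' v') (hu : f u < f x)
    (hv : f x < f v) : u = u' ∧ v = v' := by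
  have hxo : x ∈ openSegment ℝ u v :=
    mem_openSegment_of_ne_left_right (fun h => by simp [h] at hu) (fun h => by simp [h] at hv) hx
  have hext := he'.2.1.isExtreme
  have hxu := hext.2 he.left_mem he.right_mem hx' hxo
  have hxv := hext.2 he.right_mem he.left_mem hx' (by rwa [openSegment_symm])
  rcases (hP.isVertex_left he).eq_or_eq_of_mem_segment he'.left_mem he'.right_mem hxu with h | h <;>
  rcases (hP.isVertex_right he).eq_or_eq_of_mem_segment he'.left_mem he'.right_mem hxv with h' | h'
  · subst h h'; linarith
  · exact ⟨h, h'⟩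
  · subst h h'; linarith
  · subst h h'; linarith

namespace Frame

variable {P : Set E} {f : E →ₗ[ℝ] ℝ}

theorem pt_of_le (A : Frame P f) (γ : MonotonePath P f) {t : ℝ} (h : t ≤ f A.lo) :
    A.pt γ t = A.lo := by
  refine A.eq_lo _ (A.pt_mem_poly γ t) ?_
  rw [A.f_pt_clamp, min_eq_left (h.trans A.lo_lt_hi.le), max_eq_left h]

theorem pt_of_ge (A : Frame P f) (γ : MonotonePath P f) {t : ℝ} (h : f A.hi ≤ t) :
    A.pt γ t = A.hi := by
  refine A.eq_hi _ (A.pt_mem_poly γ t) ?_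
  rw [A.f_pt_clamp, min_eq_right h, max_eq_right A.lo_lt_hi.le]

theorem mem_Ioo_of_pt_ne (A : Frame P f) {γ γ' : MonotonePath P f} {t : ℝ}
    (h : A.pt γ t ≠ A.pt γ' t) : t ∈ Ioo (f A.lo) (f A.hi) := by
  constructor
  · by_contra hn
    exact h ((A.pt_of_le γ (not_lt.1 hn)).trans (A.pt_of_le γ' (not_lt.1 hn)).symm)
  · by_contra hn
    exact h ((A.pt_of_ge γ (not_lt.1 hn)).trans (A.pt_of_ge γ' (not_lt.1 hn)).symm)

theorem support_inter_level (A : Frame P f) (γ : MonotonePath P f) {t : ℝ}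
    (ht : t ∈ Icc (f A.lo) (f A.hi)) : γ.support ∩ f ⁻¹' {t} = {A.pt γ t} := by
  ext x
  constructor
  · rintro ⟨hx, hxt⟩
    exact (A.pt_eq γ hx hxt).symm
  · rintro rfl
    exact ⟨A.pt_mem γ t, A.f_pt γ ht⟩

/-- No restriction to levels of `P` is needed: beyond them clamping makes both paths sit at the same
extreme vertex. -/
theorem disagreement_eq (A : Frame P f) (γ γ' : MonotonePath P f) :
    disagreement γ γ' = {t | A.pt γ t ≠ A.pt γ' t} := by
  ext t
  constructor
  · rintro ⟨⟨x, hx, rfl⟩, h⟩ e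
    rw [A.support_inter_level γ (A.level_mem hx), A.support_inter_level γ' (A.level_mem hx), e] at h
    exact h rfl
  · intro h
    have ht := Ioo_subset_Icc_self (A.mem_Ioo_of_pt_ne h)
    refine ⟨⟨A.pt γ t, A.pt_mem_poly γ t, A.f_pt γ ht⟩, ?_⟩
    rw [A.support_inter_level γ ht, A.support_inter_level γ' ht]
    exact fun e => h (singleton_injective e)

/-- Follow `γ` up to a common vertex and `γ'` from there on. -/
theorem exists_splice (A : Frame P f) {γ γ' : MonotonePath P f} {w : E} (hw : w ∈ γ.vertices)
    (hw' : w ∈ γ'.vertices) : ∃ δ : MonotonePath P f, (∀ t ≤ f w, A.pt δ t = A.pt γ t) ∧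
      ∀ t, f w ≤ t → A.pt δ t = A.pt γ' t := by
  obtain ⟨l₁, l₂, e⟩ := List.append_of_mem hw
  obtain ⟨m₁, m₂, e'⟩ := List.append_of_mem hw'
  have hne : l₁ ++ w :: m₂ ≠ [] := by simp
  have hhead : (l₁ ++ w :: m₂).head hne = A.lo := by
    rw [← A.head_eq γ]
    have : ∀ (l : List E) (hl : l ≠ []), l = l₁ ++ w :: l₂ →
        (l₁ ++ w :: m₂).head hne = l.head hl := by
      rintro l hl rfl
      cases l₁ <;> rfl
    exact this _ _ e
  have hlast : (l₁ ++ w :: m₂).getLast hne = A.hi := by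
    rw [← A.getLast_eq γ']
    have : ∀ (l : List E) (hl : l ≠ []), l = m₁ ++ w :: m₂ →
        (l₁ ++ w :: m₂).getLast hne = l.getLast hl := by
      rintro l hl rfl
      simp
    exact this _ _ e'
  have hc := γ.chain
  have hc' := γ'.chain
  rw [e, List.isChain_split] at hc
  rw [e', List.isChain_split] at hc'
  let δ : MonotonePath P f :=
    { vertices := l₁ ++ w :: m₂
      ne_nil := hne
      isVertex := by
        intro v hv
        rcases List.mem_append.1 hv with h | h
        · exact γ.isVertex v (by rw [e]; exact List.mem_append_left _ h)
        · exact γ'.isVertex v (by rw [e']; exact List.mem_append_right _ h)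
      source := fun x hx => by rw [hhead]; exact A.lo_le x hx
      sink := fun x hx => by rw [hlast]; exact A.le_hi x hx
      chain := List.isChain_split.2 ⟨hc.1, hc'.2⟩ }
  refine ⟨δ, fun t ht => ?_, fun t ht => ?_⟩
  · by_cases h : f A.lo ≤ t
    · by_cases hl : l₁ = []
      · subst hl
        have : w = A.lo := hhead
        rw [A.pt_of_le δ (this ▸ ht), A.pt_of_le γ (this ▸ ht)]
      · refine A.pt_eq_of_common_infix (l := l₁ ++ [w]) ⟨[], m₂, by simp [δ]⟩
          ⟨[], l₂, by simp [e]⟩ ?_ (by simp) ?_ (by simpa using ht)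
        · have := List.length_pos_of_ne_nil hl
          simp
          omega
        · rw [List.head_append_of_ne_nil hl]
          rw [List.head_append_of_ne_nil hl] at hhead
          rwa [hhead]
    · rw [A.pt_of_le δ (not_le.1 h).le, A.pt_of_le γ (not_le.1 h).le]
  · by_cases h : t ≤ f A.hi
    · by_cases hl : m₂ = []
      · subst hl
        have : w = A.hi := by simpa using hlast
        rw [A.pt_of_ge δ (this ▸ ht), A.pt_of_ge γ' (this ▸ ht)]
      · refine A.pt_eq_of_common_infix (l := w :: m₂) ⟨l₁, [], by simp [δ]⟩
          ⟨m₁, [], by simp [e']⟩ ?_ (by simp) (by simpa using ht) ?_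
        · have := List.length_pos_of_ne_nil hl
          simp
          omega
        · rw [List.getLast_append_of_ne_nil _ (by simp)] at hlast
          rwa [hlast]
    · rw [A.pt_of_ge δ (not_le.1 h).le, A.pt_of_ge γ' (not_le.1 h).le]

variable [FiniteDimensional ℝ E]

theorem isOpen_disagreement (A : Frame P f) (γ γ' : MonotonePath P f) :
    IsOpen (disagreement γ γ') := by
  rw [A.disagreement_eq]
  exact isOpen_ne_fun (A.continuous_pt γ) (A.continuous_pt γ')

/-- Two paths that meet do so in a vertex, or they share the edge in which they meet. -/
theorem mem_vertices_or_common_edge (A : Frame P f) {γ γ' : MonotonePath P f} {t : ℝ}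
    (h : A.pt γ t = A.pt γ' t) : A.pt γ t ∈ γ.vertices ∧ A.pt γ t ∈ γ'.vertices ∨
      ∃ u ∈ γ.vertices, ∃ v ∈ γ.vertices, f u < t ∧ t < f v ∧
        ∀ s ∈ Icc (f u) (f v), A.pt γ s = A.pt γ' s := by
  by_cases h1 : t ≤ f A.lo
  · left
    rw [A.pt_of_le γ h1]
    nth_rw 1 [← A.head_eq γ]
    rw [← A.head_eq γ']
    exact ⟨List.head_mem _, List.head_mem _⟩
  by_cases h2 : f A.hi ≤ t
  · left
    rw [A.pt_of_ge γ h2]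
    nth_rw 1 [← A.getLast_eq γ]
    rw [← A.getLast_eq γ']
    exact ⟨List.getLast_mem _, List.getLast_mem _⟩
  have ft : f (A.pt γ t) = t := A.f_pt γ ⟨(not_le.1 h1).le, (not_le.1 h2).le⟩
  by_cases hv : IsFaceOfDim P 0 {A.pt γ t}
  · exact Or.inl ⟨γ.mem_vertices_of_mem_support hv (A.pt_mem γ t),
      γ'.mem_vertices_of_mem_support hv (h ▸ A.pt_mem γ' t)⟩
  · right
    obtain ⟨u, v, huv, he, hlt, hx⟩ := γ.exists_edge (A.pt_mem γ t)
    obtain ⟨u', v', huv', he', hlt', hx'⟩ := γ'.exists_edge (A.pt_mem γ' t)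
    have hmem := functional_mem_Icc_of_mem_segment hlt.le hx
    have hxu : f u < f (A.pt γ t) := by
      refine lt_of_le_of_ne hmem.1 fun e => hv ?_
      rw [← injOn_segment hlt (left_mem_segment ℝ u v) hx e]
      exact A.poly.isVertex_left he
    have hxv : f (A.pt γ t) < f v := by
      refine lt_of_le_of_ne hmem.2 fun e => hv ?_
      rw [injOn_segment hlt hx (right_mem_segment ℝ u v) e]
      exact A.poly.isVertex_right he
    rw [← h] at hx'
    obtain ⟨rfl, rfl⟩ := A.poly.edge_eq_of_inner he he' hlt' hx hx' hxu hxv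
    rw [ft] at hxu hxv
    exact ⟨u, huv.subset (by simp), v, huv.subset (by simp), hxu, hxv, fun s hs =>
      A.pt_eq_of_common_infix huv huv' (by simp) (by simp) hs.1 hs.2⟩

/-- Apply the signature criterion to the levels of the vertices of `γ`. If the paths meet between
two levels of disagreement, they meet at a vertex of `γ` or along a common edge; since they differ
at `s`, the lower end of that edge is above `s`. -/
theorem finite_components (A : Frame P f) (γ γ' : MonotonePath P f) :
    Finite (ConnectedComponents (disagreement γ γ')) := by
  refine finite_connectedComponents_of_signature (V := f '' {v | v ∈ γ.vertices})
    (γ.vertices.finite_toSet.image f) ?_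
  rw [A.disagreement_eq]
  intro s hs t ht hst hV r hr e
  have hrI : r ∈ Icc (f A.lo) (f A.hi) := ⟨(A.mem_Ioo_of_pt_ne hs).1.le.trans hr.1,
    hr.2.trans (A.mem_Ioo_of_pt_ne ht).2.le⟩
  rcases A.mem_vertices_or_common_edge e with ⟨h, -⟩ | ⟨u, hu, v, hv, h1, h2, h⟩
  · exact hV _ ⟨_, h, rfl⟩ (by rwa [A.f_pt γ hrI])
  · have hus : f u < s := by
      by_contra hn
      exact hV _ ⟨u, hu, rfl⟩ ⟨not_lt.1 hn, h1.le.trans hr.2⟩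
    exact hs (h s ⟨hus.le, hr.1.trans h2.le⟩)

/-- Replace the part of `γ` on a component of the set of disagreement by that of `γ'`. -/
theorem exists_replace (A : Frame P f) {γ γ' : MonotonePath P f} {a b : ℝ} (hlt : a < b)
    (ha : f A.lo ≤ a) (hb : b ≤ f A.hi) (hab : ∀ t ∈ Ioo a b, A.pt γ t ≠ A.pt γ' t)
    (hea : A.pt γ a = A.pt γ' a) (heb : A.pt γ b = A.pt γ' b) :
    ∃ δ : MonotonePath P f, (∀ t ∈ Ioo a b, A.pt δ t = A.pt γ' t) ∧
      ∀ t, t ∉ Ioo a b → A.pt δ t = A.pt γ t := by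
  -- Meeting inside a common edge would extend the agreement past `a` into the interval.
  have hva : A.pt γ a ∈ γ.vertices ∧ A.pt γ a ∈ γ'.vertices := by
    refine (A.mem_vertices_or_common_edge hea).resolve_right ?_
    rintro ⟨u, -, v, -, h1, h2, h⟩
    obtain ⟨s, hs1, hs2⟩ := exists_between (lt_min hlt h2)
    exact hab s ⟨hs1, hs2.trans_le (min_le_left _ _)⟩
      (h s ⟨(h1.trans hs1).le, (hs2.trans_le (min_le_right _ _)).le⟩)
  have hvb : A.pt γ b ∈ γ.vertices ∧ A.pt γ b ∈ γ'.vertices := by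
    refine (A.mem_vertices_or_common_edge heb).resolve_right ?_
    rintro ⟨u, -, v, -, h1, h2, h⟩
    obtain ⟨s, hs1, hs2⟩ := exists_between (max_lt hlt h1)
    exact hab s ⟨(le_max_left _ _).trans_lt hs1, hs2⟩
      (h s ⟨((le_max_right _ _).trans_lt hs1).le, (hs2.trans h2).le⟩)
  have fa : f (A.pt γ a) = a := A.f_pt γ ⟨ha, hlt.le.trans hb⟩
  have fb : f (A.pt γ b) = b := A.f_pt γ ⟨ha.trans hlt.le, hb⟩
  obtain ⟨δ₁, h1, h2⟩ := A.exists_splice hva.1 hva.2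
  rw [fa] at h1 h2
  have hb1 : A.pt γ b ∈ δ₁.vertices := by
    refine δ₁.mem_vertices_of_mem_support (γ.isVertex _ hvb.1) ?_
    rw [heb, ← h2 b hlt.le]
    exact A.pt_mem δ₁ b
  obtain ⟨δ, h3, h4⟩ := A.exists_splice hb1 hvb.1
  rw [fb] at h3 h4
  refine ⟨δ, fun t ht => (h3 t ht.2.le).trans (h2 t ht.1.le), fun t ht => ?_⟩
  rcases le_or_gt t a with h | h
  · exact (h3 t (h.trans hlt.le)).trans (h1 t h)
  · exact h4 t (not_lt.1 fun h' => ht ⟨h, h'⟩)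

/-- Induction with `γ'` fixed, making `γ` agree with it on one more component each time. The bound
`≤ n` suffices as hypothesis because only a strict drop of the number of components is known, and
the factor two avoids division in `ℕ`. -/
theorem two_mul_dist_le_card_mul (A : Frame P f) (n : ℕ) (γ γ' : MonotonePath P f)
    (hn : Nat.card (ConnectedComponents (disagreement γ γ')) ≤ n) :
    (flipGraph P f).Reachable γ γ' ∧ 2 * (flipGraph P f).dist γ γ' ≤ n * numFaces 2 P := by
  induction n generalizing γ with
  | zero =>
    have hfin := A.finite_components γ γ'
    have hempty := (Nat.card_eq_zero.1 (Nat.le_zero.1 hn)).resolve_right (not_infinite_iff_finite.2 hfin)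
    have : γ = γ' := by
      refine A.path_ext fun t _ => ?_
      by_contra h
      exact hempty.false (((⟨t, by rw [A.disagreement_eq]; exact h⟩ : disagreement γ γ')) :
        ConnectedComponents (disagreement γ γ'))
    subst this
    simp
  | succ n ih =>
    have hfin := A.finite_components γ γ'
    by_cases he : ∃ t, t ∈ disagreement γ γ'
    · obtain ⟨t, ht⟩ := he
      have htI : t ∈ Ioo (f A.lo) (f A.hi) := A.mem_Ioo_of_pt_ne (by rwa [A.disagreement_eq] at ht)
      have hD := A.disagreement_eq γ γ'
      obtain ⟨a, b, hla, hbr, htab, ha, hb, hab⟩ := exists_maximal_Ioo (A.isOpen_disagreement γ γ')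
        (l := f A.lo) (r := f A.hi)
        (by rw [hD]; exact fun h => (A.mem_Ioo_of_pt_ne h).1.false)
        (by rw [hD]; exact fun h => (A.mem_Ioo_of_pt_ne h).2.false) htI.1.le htI.2.le ht
      have hcard := (card_connectedComponents_diff_lt ha hb htab ht).2
      have hlt := htab.1.trans htab.2
      simp only [hD, mem_ofPred_eq, not_not] at ha hb
      have hab' : ∀ t ∈ Ioo a b, A.pt γ t ≠ A.pt γ' t := fun s hs => by
        have := hab hs
        rwa [hD] at this
      obtain ⟨δ, h1, h2⟩ := A.exists_replace hlt hla hbr hab' ha hb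
      have hDδ : disagreement δ γ' = disagreement γ γ' \ Ioo a b := by
        rw [hD, A.disagreement_eq]
        ext s
        by_cases hs : s ∈ Ioo a b
        · simp [h1 s hs, hs]
        · simp only [mem_ofPred_eq, mem_sdiff, hs, h2 s hs, not_false_eq_true, and_true]
      obtain ⟨r1, d1⟩ := ih δ (by rw [hDδ]; omega)
      obtain ⟨r2, d2⟩ := A.two_mul_dist_le (γ := γ) (γ' := δ) hlt hla hbr
        (fun s hs => by rw [h1 s hs]; exact hab' s hs) (fun s hs => (h2 s hs).symm)
      refine ⟨r2.trans r1, ?_⟩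
      obtain ⟨p, hp⟩ := r2.exists_walk_length_eq_dist
      obtain ⟨q, hq⟩ := r1.exists_walk_length_eq_dist
      have := SimpleGraph.dist_le (p.append q)
      rw [SimpleGraph.Walk.length_append] at this
      rw [add_mul]
      omega
    · push Not at he
      have : γ = γ' := by
        refine A.path_ext fun t _ => ?_
        by_contra h
        exact he t (by rw [A.disagreement_eq]; exact h)
      subst this
      simp

end Frame

end MonotoneFlip

theorem mainTheorem2 {E : Type*} [NormedAddCommGroup E] [NormedSpace ℝ E] [FiniteDimensional ℝ E]
    (P : Set E) (hP : MonotoneFlip.IsPolytope P) (hdim : MonotoneFlip.dim P = 3)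
    (f : E →ₗ[ℝ] ℝ) (hf : MonotoneFlip.IsGeneric P f)
    (γ γ' : MonotoneFlip.MonotonePath P f) :
    {F : Set E | MonotoneFlip.IsFaceOfDim P 2 F}.Finite ∧
    Finite (ConnectedComponents (MonotoneFlip.disagreement γ γ')) ∧
    (MonotoneFlip.flipGraph P f).Reachable γ γ' ∧
    ((MonotoneFlip.flipGraph P f).dist γ γ' : ℝ) ≤
      (MonotoneFlip.nu γ γ' : ℝ) / 2 * (MonotoneFlip.numFaces 2 P : ℝ) := by
  obtain ⟨A⟩ := MonotoneFlip.exists_frame hP hdim hf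
  obtain ⟨hr, hd⟩ := A.two_mul_dist_le_card_mul _ γ γ' le_rfl
  refine ⟨hP.finite_faces 2, A.finite_components γ γ', hr, ?_⟩
  have : (2 * (MonotoneFlip.flipGraph P f).dist γ γ' : ℝ) ≤
      MonotoneFlip.nu γ γ' * MonotoneFlip.numFaces 2 P := by
    unfold MonotoneFlip.nu
    exact_mod_cast hd
  linarith
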